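/- **Theorem 4.1 (Subcritical case, random environment).** Let $d\ge 1$, let $\|\cdot\|$ be the sup norm on $\mathbb R^d$ and the associated matrix norm (maximal row sum of absolute values), and order $[0,\infty)^d$ coordinatewise. Let $(Y_n)_{n\ge 0}$ be $[0,\infty)^d$-valued random vectors and $(A_n)_{n\ge 1}$ be $[0,\infty)^{d\times d}$-valued random matrices such that the pairs $(A_n,Y_n)$, $n\ge1$, are i.i.d. and independent of $Y_0$, and such that the support of the law of $Y_1$ is unbounded. Let $$X_0=M_0=Y_0,\qquad X_n=A_nX_{n-1}+Y_n,\qquad M_n=\max\{A_nM_{n-1},Y_n\}\quad(n\ge 1),$$ the maximum being taken in each coordinate. *Branching process.* Let $\Phi$ be the set of measurable functions $[0,1]\to\mathbb N_0^d$. Let $(\Psi_n)_{n\ge1}=((\Psi_n^j)_{j\le d})_{n\ge1}$ be $\Phi^d$-valued random variables (where $\Phi^d$-valued means: a function of a random variable with values in a measurable space $E$, the value $\Psi_n^j(u)$ being a jointly measurable function of the point of $E$ and $u\in[0,1]$), such that the pairs $(\Psi_n,Y_n)$, $n\ge1$, are i.i.d. and independent of $Y_0$. Let $U^j_{m,n,k}$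 ($0\le m<n$, $k\ge1$, $1\le j\le d$) be i.i.d., uniform on $[0,1]$, and independent of $(\Psi,Y)$. Set $\xi^{i,j}_{m,n,k}=[\Psi^j_n(U^j_{m,n,k})]_i$, $B_{m,m}=\lfloor Y_m\rfloor$, $[B_{m,n}]_i=\sum_{j=1}^d\sum_{k=1}^{[B_{m,n-1}]_j}\xi^{i,j}_{m,n,k}$ for $n>m$, and $Z_n=\sum_{m=0}^nB_{m,n}$. When $Z$ is considered, $[A_n]_{i,j}=E[\xi^{i,j}_{0,n,1}\mid\Psi]$ almost surely, and $\mathcal V^j$ denotes the covariance matrix of $(\xi^{i,j}_{0,1,1})_{i\le d}$ given $\Psi$. *Recurrence.* Let $(V_n)_{n\ge0}$ be the Markov chain with the transition kernel of $X$ (respectively $M$, $Z$), started at $0$. The process $X$ (respectively $M$, $Z$) is called recurrent if its kernel is irreducible, i.e. for every $x\in[0,\infty)^d$ there is $n\ge0$ with $P[V_n\ge x]>0$, and there is $b\in(0,\infty)$ with $\sum_{n\ge0}P[\|V_n\|\le b]=\infty$. *Assumptions.* * (BD1) There is $\gamma_1\in\mathbb N$ such that a.s. $\|A_1\|\le\gamma_1$.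 * (PR) There are $\kappa>0$ and an integer $K\ge1$ such that a.s. all entries of $A_1\cdots A_K$ are at least $\kappa$. * (REG) There is $\beta\in(2/3,1)$ with $\lim_{x\to\infty}x^\beta P[\|Y_1\|>e^x]=0$, or $\liminf_{x\to\infty}xP[\|Y_1\|>e^x]>\lambda$. * (BD2) A.s. the conditional second moments of the $\xi^{i,j}_{0,1,1}$ given $\Psi$ are finite, and there is $\gamma_2\in\mathbb N$ such that a.s. $\|\mathcal V^1\|,\dots,\|\mathcal V^d\|\le\gamma_2$. *Claim.* Assume (BD1) and (PR). Then the limit $\lambda=\lim_{n\to\infty}-\frac1n\ln\|A_1\cdots A_n\|$ exists almost surely and is a finite constant (the negative of the maximal Lyapunov exponent). Assume in addition that $\lambda>0$ and (REG) hold, and let $y\in(0,\infty)$ satisfy $P[\|Y_1\|\le y]>0$. Then the following three statements are equivalent. * (XR) The autoregressive process $X$ is recurrent. * (MR) The max-autoregressive process $M$ is recurrent. * (RR) $\displaystyle\sum_{n\ge0}\prod_{m=0}^nP\big[\|Y_1\|\le ye^{m\lambda}\big]=\infty$. If moreover $A$ arises from $\Psi$ as above and (BD2) holds, then (XR), (MR)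 and (RR) are equivalent to * (ZR) The branching process with immigration $Z$ is recurrent. -/

import Mathlib

open MeasureTheory ProbabilityTheory Filter Topology

attribute [local instance] Matrix.linftyOpNormedAddCommGroup

namespace SubcriticalAR

noncomputable section

/-! Conventions.  Vectors in `Fin d → ℝ` carry the sup norm (Mathlib's norm on a finite product) and
the coordinatewise order; square matrices carry the associated operator norm, the maximal row sum
(the local instance above).  A sequence `(x_n)_{n ≥ 1}` is a function on `ℕ` whose value at `0` is
never used. -/

/-! ### Coefficient matrices and innovations -/

/-- The pair `(A_{n+1}, Y_{n+1})`, as a random variable with values in a product space. -/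
def arPair {Ω : Type*} {d : ℕ} (A : ℕ → Ω → Matrix (Fin d) (Fin d) ℝ) (Y : ℕ → Ω → Fin d → ℝ)
    (n : ℕ) (ω : Ω) : (Fin d → Fin d → ℝ) × (Fin d → ℝ) :=
  (fun i j => A (n + 1) ω i j, Y (n + 1) ω)

/-- The standing assumptions on `(A_n)_{n ≥ 1}` and `(Y_n)_{n ≥ 0}`: they are nonnegative, the pairs
`(A_n, Y_n)`, `n ≥ 1`, are i.i.d. (`A_n` and `Y_n` may depend on each other), their sequence is
independent of `Y_0`, and the support of the law of `Y_1` is unbounded. -/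
structure IsARData {Ω : Type*} [MeasurableSpace Ω] (P : Measure Ω) {d : ℕ}
    (A : ℕ → Ω → Matrix (Fin d) (Fin d) ℝ) (Y : ℕ → Ω → Fin d → ℝ) : Prop where
  nonneg_A : ∀ n ω i j, 0 ≤ A (n + 1) ω i j
  nonneg_Y : ∀ n ω i, 0 ≤ Y n ω i
  measurable_pair : ∀ n, Measurable (arPair A Y n)
  measurable_Y_zero : Measurable (Y 0)
  indep : iIndepFun (fun n => arPair A Y n) P
  identDistrib : ∀ n, IdentDistrib (arPair A Y n) (arPair A Y 0) P P
  indep_zero : IndepFun (Y 0) (fun ω n => arPair A Y n ω) P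
  unbounded : ∀ r : ℝ, 0 < P {ω | r < ‖Y 1 ω‖}

/-- The product `A_1 A_2 ⋯ A_n`. -/
def prodA {Ω : Type*} {d : ℕ} (A : ℕ → Ω → Matrix (Fin d) (Fin d) ℝ) :
    ℕ → Ω → Matrix (Fin d) (Fin d) ℝ
  | 0, _ => 1
  | n + 1, ω => prodA A n ω * A (n + 1) ω

/-- `S_n = - ln ‖A_1 ⋯ A_n‖`. -/
def logNorm {Ω : Type*} {d : ℕ} (A : ℕ → Ω → Matrix (Fin d) (Fin d) ℝ) (n : ℕ) (ω : Ω) : ℝ :=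
  -Real.log ‖prodA A n ω‖

/-- `lam` is the negative of the maximal Lyapunov exponent: almost surely `S_n / n → lam`. -/
def IsNegLyapunov {Ω : Type*} [MeasurableSpace Ω] (P : Measure Ω) {d : ℕ}
    (A : ℕ → Ω → Matrix (Fin d) (Fin d) ℝ) (lam : ℝ) : Prop :=
  ∀ᵐ ω ∂P, Tendsto (fun n : ℕ => logNorm A n ω / n) atTop (𝓝 lam)

/-- (BD1) The norm of the coefficient matrix is bounded by a constant. -/
def BD1 {Ω : Type*} [MeasurableSpace Ω] (P : Measure Ω) {d : ℕ}
    (A : ℕ → Ω → Matrix (Fin d) (Fin d) ℝ) : Prop :=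
  ∃ γ : ℕ, ∀ᵐ ω ∂P, ‖A 1 ω‖ ≤ γ

/-- (PR) Joint primitivity: for some `κ > 0` and `K ≥ 1`, almost surely all entries of `A_1 ⋯ A_K`
are at least `κ`. -/
def PR {Ω : Type*} [MeasurableSpace Ω] (P : Measure Ω) {d : ℕ}
    (A : ℕ → Ω → Matrix (Fin d) (Fin d) ℝ) : Prop :=
  ∃ κ : ℝ, 0 < κ ∧ ∃ K : ℕ, 1 ≤ K ∧ ∀ᵐ ω ∂P, ∀ i j, κ ≤ prodA A K ω i j

/-- (REG) Either `x ^ β * P[‖Y_1‖ > e ^ x] → 0` as `x → ∞` for some `β ∈ (2/3, 1)`, or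
`liminf x * P[‖Y_1‖ > e ^ x] > lam`.  The `liminf` is taken in `[0, ∞]`. -/
def REG {Ω : Type*} [MeasurableSpace Ω] (P : Measure Ω) {d : ℕ} (Y : ℕ → Ω → Fin d → ℝ)
    (lam : ℝ) : Prop :=
  (∃ β : ℝ, 2 / 3 < β ∧ β < 1 ∧
    Tendsto (fun x : ℝ => x ^ β * P.real {ω | Real.exp x < ‖Y 1 ω‖}) atTop (𝓝 0)) ∨
  ENNReal.ofReal lam <
    liminf (fun x : ℝ => ENNReal.ofReal x * P {ω | Real.exp x < ‖Y 1 ω‖}) atTop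

/-! ### The autoregressive and the max-autoregressive chain -/

/-- The AR(1) chain `X_0 = Y_0`, `X_n = A_n X_{n-1} + Y_n`. -/
def arChain {Ω : Type*} {d : ℕ} (A : ℕ → Ω → Matrix (Fin d) (Fin d) ℝ)
    (Y : ℕ → Ω → Fin d → ℝ) : ℕ → Ω → Fin d → ℝ
  | 0, ω => Y 0 ω
  | n + 1, ω => (A (n + 1) ω).mulVec (arChain A Y n ω) + Y (n + 1) ω

/-- The max-autoregressive chain `M_0 = Y_0`, `M_n = max {A_n M_{n-1}, Y_n}` (coordinatewise). -/
def maxChain {Ω : Type*} {d : ℕ} (A : ℕ → Ω → Matrix (Fin d) (Fin d) ℝ)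
    (Y : ℕ → Ω → Fin d → ℝ) : ℕ → Ω → Fin d → ℝ
  | 0, ω => Y 0 ω
  | n + 1, ω => (A (n + 1) ω).mulVec (maxChain A Y n ω) ⊔ Y (n + 1) ω

/-! ### Multitype branching in random environment with immigration -/

/-- The set `Φ` of measurable functions `[0,1] → ℕ^d`; such a function applied to a uniform random
variable gives the numbers of children of the `d` types of one individual. -/
abbrev OffspringRule (d : ℕ) : Type :=
  {f : unitInterval → Fin d → ℕ // Measurable f}

/-- A measurable space `E` of environment states.  The state `e` stands for the element
`(rule e j)_j` of `Φ^d`, where `rule e j` governs the reproduction of an individual of type `j`.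
A `Φ^d`-valued random variable is `rule ∘ Ψ_n` for an `E`-valued random variable `Ψ_n`.  (All of
`Φ^d` carries no σ-algebra for which the evaluation is jointly measurable, hence the space `E`.) -/
structure EnvSpace (E : Type*) [MeasurableSpace E] (d : ℕ) where
  rule : E → Fin d → OffspringRule d
  measurable_eval : ∀ j, Measurable (fun p : E × unitInterval => (rule p.1 j).1 p.2)

/-- Number of children of type `i` of an individual of type `j` in the environment state `e`, as a
real function of the uniform variable. -/
def EnvSpace.children {E : Type*} [MeasurableSpace E] {d : ℕ} (R : EnvSpace E d) (e : E)
    (i j : Fin d) (u : unitInterval) : ℝ :=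
  ((R.rule e j).1 u i : ℝ)

/-- The matrix whose `(i, j)` entry is the mean number, in the environment state `e`, of children of
type `i` of an individual of type `j`. -/
def EnvSpace.meanMatrix {E : Type*} [MeasurableSpace E] {d : ℕ} (R : EnvSpace E d) (e : E) :
    Matrix (Fin d) (Fin d) ℝ :=
  Matrix.of fun i j => ∫ u, R.children e i j u

/-- The covariance matrix, in the environment state `e`, of the vector of the numbers of children of
an individual of type `j`. -/
def EnvSpace.covMatrix {E : Type*} [MeasurableSpace E] {d : ℕ} (R : EnvSpace E d) (e : E)
    (j : Fin d) : Matrix (Fin d) (Fin d) ℝ :=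
  Matrix.of fun i k => covariance (R.children e i j) (R.children e k j) volume

/-- The pair `(Ψ_{n+1}, Y_{n+1})`. -/
def envPair {Ω E : Type*} {d : ℕ} (Ψ : ℕ → Ω → E) (Y : ℕ → Ω → Fin d → ℝ) (n : ℕ) (ω : Ω) :
    E × (Fin d → ℝ) :=
  (Ψ (n + 1) ω, Y (n + 1) ω)

/-- The indices `(m, n, k, j)` with `m < n` of the variables `U_{m,n,k+1}^j`. -/
abbrev UIndex (d : ℕ) : Type := {p : ℕ × ℕ × ℕ × Fin d // p.1 < p.2.1}

/-- The assumptions on the environment `(Ψ_n)_{n ≥ 1}`, the immigration `(Y_n)_{n ≥ 0}` and the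
uniform variables `U m n k j = U_{m,n,k+1}^j`, `m < n`: the pairs `(Ψ_n, Y_n)`, `n ≥ 1`, are i.i.d.
and their sequence is independent of `Y_0`; the `U` are i.i.d., uniform on `[0,1]`, and their family
is independent of `(Ψ, Y)`. -/
structure IsBranchingData {Ω : Type*} [MeasurableSpace Ω] (P : Measure Ω) {E : Type*}
    [MeasurableSpace E] {d : ℕ} (Ψ : ℕ → Ω → E) (Y : ℕ → Ω → Fin d → ℝ)
    (U : ℕ → ℕ → ℕ → Fin d → Ω → unitInterval) : Prop where
  nonneg_Y : ∀ n ω i, 0 ≤ Y n ω i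
  measurable_pair : ∀ n, Measurable (envPair Ψ Y n)
  measurable_Y_zero : Measurable (Y 0)
  indep : iIndepFun (fun n => envPair Ψ Y n) P
  identDistrib : ∀ n, IdentDistrib (envPair Ψ Y n) (envPair Ψ Y 0) P P
  indep_zero : IndepFun (Y 0) (fun ω n => envPair Ψ Y n ω) P
  measurable_U : ∀ m n k j, m < n → Measurable (U m n k j)
  uniform_U : ∀ m n k j, m < n → P.map (U m n k j) = volume
  indep_U : iIndepFun
    (fun (p : UIndex d) ω => U p.1.1 p.1.2.1 p.1.2.2.1 p.1.2.2.2 ω) P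
  indep_U_env : IndepFun
    (fun ω => ((fun n => Ψ (n + 1) ω, fun n => Y n ω) : (ℕ → E) × (ℕ → Fin d → ℝ)))
    (fun ω (p : UIndex d) => U p.1.1 p.1.2.1 p.1.2.2.1 p.1.2.2.2 ω) P

/-- `cohort R Ψ Y U m l` is `B_{m, m+l}`: the numbers of individuals of the `d` types, at time
`m + l`, that descend from those who immigrated at time `m`. -/
def cohort {Ω E : Type*} [MeasurableSpace E] {d : ℕ} (R : EnvSpace E d) (Ψ : ℕ → Ω → E)
    (Y : ℕ → Ω → Fin d → ℝ) (U : ℕ → ℕ → ℕ → Fin d → Ω → unitInterval) (m : ℕ) :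
    ℕ → Ω → Fin d → ℕ
  | 0, ω => fun i => ⌊Y m ω i⌋₊
  | l + 1, ω => fun i =>
      ∑ j, ∑ k ∈ Finset.range (cohort R Ψ Y U m l ω j),
        (R.rule (Ψ (m + l + 1) ω) j).1 (U m (m + l + 1) k j ω) i

/-- The branching process `Z_n = ∑_{m ≤ n} B_{m,n}` with immigration `⌊Y⌋` in the environment `Ψ`;
its values are read in `[0, ∞)^d`. -/
def branchingChain {Ω E : Type*} [MeasurableSpace E] {d : ℕ} (R : EnvSpace E d) (Ψ : ℕ → Ω → E)
    (Y : ℕ → Ω → Fin d → ℝ) (U : ℕ → ℕ → ℕ → Fin d → Ω → unitInterval) (n : ℕ) (ω : Ω) :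
    Fin d → ℝ :=
  fun i => ((∑ m ∈ Finset.range (n + 1), cohort R Ψ Y U m (n - m) ω i : ℕ) : ℝ)

/-- (BD2) In the environment state `Ψ_1`, almost surely, the offspring vectors of all types have
finite second moments, and their covariance matrices are bounded in norm by a constant. -/
def BD2 {Ω : Type*} [MeasurableSpace Ω] (P : Measure Ω) {E : Type*} [MeasurableSpace E] {d : ℕ}
    (R : EnvSpace E d) (Ψ : ℕ → Ω → E) : Prop :=
  ∃ γ : ℕ, ∀ᵐ ω ∂P, ∀ j,
    (∀ i, MemLp (R.children (Ψ 1 ω) i j) 2 volume) ∧ ‖R.covMatrix (Ψ 1 ω) j‖ ≤ γ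

/-! ### Recurrence -/

/-- The sequence `Y` with `Y_0` replaced by `0`.  Each of the chains above starts at `Y_0`, so that
this replacement gives the Markov chain with the same transition kernel started at `0`. -/
def fromZero {Ω : Type*} {d : ℕ} (Y : ℕ → Ω → Fin d → ℝ) : ℕ → Ω → Fin d → ℝ
  | 0, _ => 0
  | n + 1, ω => Y (n + 1) ω

/-- Irreducibility for the state space `[0, ∞)^d` of the transition kernel of an order-preserving
Markov chain; `V` is the chain with this kernel started at `0`. -/
def IsIrreducible {Ω : Type*} [MeasurableSpace Ω] (P : Measure Ω) {d : ℕ}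
    (V : ℕ → Ω → Fin d → ℝ) : Prop :=
  ∀ x : Fin d → ℝ, 0 ≤ x → ∃ n, 0 < P {ω | x ≤ V n ω}

/-- Recurrence of the transition kernel of an order-preserving Markov chain; `V` is the chain with
this kernel started at `0`.  The kernel is irreducible and `∑ₙ P[‖V_n‖ ≤ b] = ∞` for some finite
`b > 0`. -/
def IsRecurrent {Ω : Type*} [MeasurableSpace Ω] (P : Measure Ω) {d : ℕ}
    (V : ℕ → Ω → Fin d → ℝ) : Prop :=
  IsIrreducible P V ∧ ∃ b : ℝ, 0 < b ∧ ∑' n, P {ω | ‖V n ω‖ ≤ b} = ⊤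

/-- (XR) The autoregressive process is recurrent. -/
def XR {Ω : Type*} [MeasurableSpace Ω] (P : Measure Ω) {d : ℕ}
    (A : ℕ → Ω → Matrix (Fin d) (Fin d) ℝ) (Y : ℕ → Ω → Fin d → ℝ) : Prop :=
  IsRecurrent P (arChain A (fromZero Y))

/-- (MR) The max-autoregressive process is recurrent. -/
def MR {Ω : Type*} [MeasurableSpace Ω] (P : Measure Ω) {d : ℕ}
    (A : ℕ → Ω → Matrix (Fin d) (Fin d) ℝ) (Y : ℕ → Ω → Fin d → ℝ) : Prop :=
  IsRecurrent P (maxChain A (fromZero Y))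

/-- (ZR) The branching process with immigration is recurrent. -/
def ZR {Ω : Type*} [MeasurableSpace Ω] (P : Measure Ω) {E : Type*} [MeasurableSpace E] {d : ℕ}
    (R : EnvSpace E d) (Ψ : ℕ → Ω → E) (Y : ℕ → Ω → Fin d → ℝ)
    (U : ℕ → ℕ → ℕ → Fin d → Ω → unitInterval) : Prop :=
  IsRecurrent P (branchingChain R Ψ (fromZero Y) U)

/-- (RR) `∑_{n ≥ 0} ∏_{m=0}^n P[‖Y_1‖ ≤ y e^{m lam}] = ∞`. -/
def RR {Ω : Type*} [MeasurableSpace Ω] (P : Measure Ω) {d : ℕ} (Y : ℕ → Ω → Fin d → ℝ)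
    (lam y : ℝ) : Prop :=
  ∑' n : ℕ, ∏ m ∈ Finset.range (n + 1), P {ω | ‖Y 1 ω‖ ≤ y * Real.exp (m * lam)} = ⊤

end

end SubcriticalAR

open MeasureTheory ProbabilityTheory Filter Topology

attribute [local instance] Matrix.linftyOpNormedAddCommGroup

namespace SubcriticalAR

noncomputable section

/-! ### Products of matrices from a primitive set -/

section

variable {d : ℕ}

/-! For a fixed time n the i.i.d. pairs may be listed backwards. The chain X started at 0 then has
at time n the law of the sum over k < n of the vectors a_0 ⋯ a_{k-1} y_k (`arChain_eq_transportSum`,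
`measure_arChain_le`), and M dominates each of these transported vectors (`transport_le_maxChain`).
By primitivity the transport multiplies the norm of a nonnegative vector by ‖a_0 ⋯ a_{k-1}‖ =
e^{-S_k} up to a bounded factor (`exists_mul_norm_le`), and S_k is close to k λ. So the chain is
small at time n essentially when ‖y_k‖ is at most of order e^{kλ} for all k < n, and by independence
this has probability close to p_n = ∏_{m<n} P[‖Y_1‖ ≤ y e^{mλ}]. Recurrence is thus divergence of ∑
p_n; irreducibility always holds, because one large innovation spreads to all coordinates within K
steps.

The work lies in replacing S_k by k λ. The same distortion bound makes S almost additive: S_{m+n} is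
the sum of S_m and an independent copy of S_n, up to a bounded error. Halving n repeatedly gives
sub-Gaussian fluctuations of order √n around n λ (`exists_subgaussian_of_halving`,
`exists_concentration`), and with Borel-Cantelli the existence of λ. Deviations δ_k are then sought
that are so large that |S_k - kλ| > δ_k is improbable even in comparison with p_k, and so small that
thresholds moved by the factor e^{2δ_k} leave the products of the same order (`UpperRate`). If the
tail of ln ‖Y_1‖ is o(x^{-β}) with β > 2/3, powers δ_k = k^a succeed (`exists_rate_of_tail`). If the
tail is heavier than λ/x, linear δ_k yield a summable polynomial rate, and ∑ p_n converges as well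
(`exists_rate_of_heavy_tail`).

Upper bound (`tsum_lintegral_prod_smallBound_ne_top`): decompose according to the last deviation
time j. The deviation at j is independent of the later vectors, and after j each vector has to stay
below a threshold shifted by a multiple of j; the sum over j costs only a constant. Lower bound
(`exists_tsum_measure_transportSum_eq_top`): require that ‖y_k‖ stays slightly below e^{kλ} for all
k < n; given this, late deviations have probability at most 1/2, and without them the transported
sum is bounded.

In a fixed environment the cohorts of Z are independent, and the mean of Z_n is at most the
transported sum. Markov's inequality turns bounded X into bounded Z. Conversely, Chebyshev's
inequality shows that a cohort is much smaller than its mean with a probability of the form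
`smallBound`, so the upper bound covers Z as well as M. The implications proved are XR → MR → RR →
XR and XR → ZR → RR. -/

/-- The product `a 0 * a 1 * ⋯ * a (n - 1)`. -/
def seqProd (a : ℕ → Matrix (Fin d) (Fin d) ℝ) : ℕ → Matrix (Fin d) (Fin d) ℝ
  | 0 => 1
  | n + 1 => seqProd a n * a n

/-- A set of nonnegative matrices, bounded in norm by `γ`, all of whose `K`-fold products have
entries at least `κ`. -/
structure IsPrimitiveSet (T : Set (Matrix (Fin d) (Fin d) ℝ)) (γ κ : ℝ) (K : ℕ) : Prop where
  nonneg : ∀ a ∈ T, ∀ i j, 0 ≤ a i j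
  norm_le : ∀ a ∈ T, ‖a‖ ≤ γ
  one_le : 1 ≤ γ
  pos : 0 < κ
  one_le_length : 1 ≤ K
  le_prod : ∀ a : ℕ → Matrix (Fin d) (Fin d) ℝ, (∀ i, a i ∈ T) → ∀ i j, κ ≤ seqProd a K i j

theorem seqProd_add (a : ℕ → Matrix (Fin d) (Fin d) ℝ) (m n : ℕ) :
    seqProd a (m + n) = seqProd a m * seqProd (fun i => a (m + i)) n := by
  induction n with
  | zero => simp [seqProd]
  | succ n ih => rw [← add_assoc]; simp [seqProd, ih, Matrix.mul_assoc]

theorem seqProd_congr {a b : ℕ → Matrix (Fin d) (Fin d) ℝ} {n : ℕ} (h : ∀ i < n, a i = b i) :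
    seqProd a n = seqProd b n := by
  induction n with
  | zero => rfl
  | succ n ih => simp [seqProd, ih fun i hi => h i (by omega), h n (by omega)]

theorem seqProd_nonneg {a : ℕ → Matrix (Fin d) (Fin d) ℝ} (h : ∀ k i j, 0 ≤ a k i j) (n : ℕ) :
    ∀ i j, 0 ≤ seqProd a n i j := by
  induction n with
  | zero => intro i j; simp only [seqProd, Matrix.one_apply]; split_ifs <;> norm_num
  | succ n ih =>
    intro i j
    simp only [seqProd, Matrix.mul_apply]
    exact Finset.sum_nonneg fun k _ => mul_nonneg (ih i k) (h n k j)

theorem seqProd_succ' (a : ℕ → Matrix (Fin d) (Fin d) ℝ) (n : ℕ) :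
    seqProd a (n + 1) = a 0 * seqProd (fun i => a (i + 1)) n := by
  rw [add_comm n 1, seqProd_add]
  simp [seqProd, add_comm]

theorem mulVec_nonneg {A : Matrix (Fin d) (Fin d) ℝ} (hA : ∀ i j, 0 ≤ A i j) {v : Fin d → ℝ}
    (hv : 0 ≤ v) : 0 ≤ A.mulVec v := fun i =>
  show 0 ≤ ∑ j, A i j * v j from Finset.sum_nonneg fun j _ => mul_nonneg (hA i j) (hv j)

theorem mulVec_mono {A : Matrix (Fin d) (Fin d) ℝ} (hA : ∀ i j, 0 ≤ A i j) {v w : Fin d → ℝ}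
    (hv : v ≤ w) : A.mulVec v ≤ A.mulVec w := fun i =>
  show ∑ j, A i j * v j ≤ ∑ j, A i j * w j from
    Finset.sum_le_sum fun j _ => mul_le_mul_of_nonneg_left (hv j) (hA i j)

theorem norm_mono {v w : Fin d → ℝ} (hv : 0 ≤ v) (hw : v ≤ w) : ‖v‖ ≤ ‖w‖ := by
  refine (pi_norm_le_iff_of_nonneg (norm_nonneg _)).2 fun i => ?_
  refine le_trans ?_ (norm_le_pi_norm w i)
  rw [Real.norm_of_nonneg (hv i), Real.norm_of_nonneg ((hv i).trans (hw i))]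
  exact hw i

theorem norm_le_sum {v : Fin d → ℝ} (hv : 0 ≤ v) : ‖v‖ ≤ ∑ i, v i := by
  refine (pi_norm_le_iff_of_nonneg (Finset.sum_nonneg fun i _ => hv i)).2 fun i => ?_
  rw [Real.norm_of_nonneg (hv i)]
  exact Finset.single_le_sum (fun i _ => hv i) (Finset.mem_univ i)

theorem sum_le_norm (v : Fin d → ℝ) : ∑ i, v i ≤ d * ‖v‖ := by
  calc ∑ i, v i ≤ ∑ _i : Fin d, ‖v‖ := Finset.sum_le_sum fun i _ =>
        (le_abs_self _).trans (norm_le_pi_norm v i)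
    _ = d * ‖v‖ := by simp

/-- The row sums of a nonnegative matrix form its image of the all-ones vector. Bounds for the
action on nonnegative vectors thereby become bounds for matrix norms, by the choice `v = 1`. -/
theorem norm_eq_norm_mulVec_one {A : Matrix (Fin d) (Fin d) ℝ} (hA : ∀ i j, 0 ≤ A i j) :
    ‖A‖ = ‖A.mulVec 1‖ := by
  rw [Matrix.linfty_opNorm_def, Pi.norm_def]
  congr 2
  ext i
  simp only [Matrix.mulVec, dotProduct, Pi.one_apply, mul_one, NNReal.coe_sum, coe_nnnorm]
  rw [Real.norm_of_nonneg (Finset.sum_nonneg fun j _ => hA i j)]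
  exact Finset.sum_congr rfl fun j _ => Real.norm_of_nonneg (hA i j)

theorem norm_const_smul_one [NeZero d] (r : ℝ) : ‖(fun _ => r : Fin d → ℝ)‖ = |r| := by
  simp

namespace IsPrimitiveSet

variable {T : Set (Matrix (Fin d) (Fin d) ℝ)} {γ κ : ℝ} {K : ℕ}

theorem seqProd_nonneg (hT : IsPrimitiveSet T γ κ K) {a : ℕ → Matrix (Fin d) (Fin d) ℝ}
    (ha : ∀ i, a i ∈ T) (n : ℕ) : ∀ i j, 0 ≤ seqProd a n i j :=
  SubcriticalAR.seqProd_nonneg (fun k => hT.nonneg _ (ha k)) n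

theorem le_seqProd_mulVec (hT : IsPrimitiveSet T γ κ K) {a : ℕ → Matrix (Fin d) (Fin d) ℝ}
    (ha : ∀ i, a i ∈ T) {v : Fin d → ℝ} (hv : 0 ≤ v) :
    (fun _ => κ * ‖v‖) ≤ (seqProd a K).mulVec v := by
  intro i
  calc κ * ‖v‖ ≤ κ * ∑ j, v j := mul_le_mul_of_nonneg_left (norm_le_sum hv) hT.pos.le
    _ = ∑ j, κ * v j := Finset.mul_sum _ _ _
    _ ≤ _ := Finset.sum_le_sum fun j _ =>
      mul_le_mul_of_nonneg_right (hT.le_prod a ha i j) (hv j)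

variable [NeZero d]

theorem norm_seqProd_le (hT : IsPrimitiveSet T γ κ K) {a : ℕ → Matrix (Fin d) (Fin d) ℝ}
    (ha : ∀ i, a i ∈ T) (n : ℕ) : ‖seqProd a n‖ ≤ γ ^ n := by
  induction n with
  | zero => simp [seqProd]
  | succ n ih =>
    rw [pow_succ]
    exact (Matrix.linfty_opNorm_mul _ _).trans
      (mul_le_mul ih (hT.norm_le _ (ha n)) (norm_nonneg _) (by have := hT.one_le; positivity))

theorem le_norm_seqProd_mulVec (hT : IsPrimitiveSet T γ κ K)
    {a : ℕ → Matrix (Fin d) (Fin d) ℝ} (ha : ∀ i, a i ∈ T) {v : Fin d → ℝ} (hv : 0 ≤ v) :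
    κ * ‖v‖ ≤ ‖(seqProd a K).mulVec v‖ := by
  have h := norm_mono (fun _ => mul_nonneg hT.pos.le (norm_nonneg v)) (hT.le_seqProd_mulVec ha hv)
  rw [norm_const_smul_one] at h
  exact (le_abs_self _).trans h

/-- A single matrix may have zero entries, but primitivity applies to its powers: the `K`-th power
expands norms by at least `κ`, and `K - 1` of its factors expand them by at most `γ ^ (K - 1)`, so
the remaining one cannot contract too much. -/
theorem le_norm_mulVec (hT : IsPrimitiveSet T γ κ K) {a : Matrix (Fin d) (Fin d) ℝ}
    (ha : a ∈ T) {v : Fin d → ℝ} (hv : 0 ≤ v) : κ / γ ^ K * ‖v‖ ≤ ‖a.mulVec v‖ := by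
  have hγ : 0 < γ ^ K := by have := hT.one_le; positivity
  obtain ⟨k, rfl⟩ : ∃ k, K = k + 1 := ⟨K - 1, by have := hT.one_le_length; omega⟩
  have h := hT.le_norm_seqProd_mulVec (a := fun _ => a) (fun _ => ha) hv
  rw [seqProd, ← Matrix.mulVec_mulVec] at h
  have h2 := (h.trans (Matrix.linfty_opNorm_mulVec _ _)).trans
    (mul_le_mul_of_nonneg_right (hT.norm_seqProd_le (fun _ => ha) k) (norm_nonneg _))
  rw [div_mul_eq_mul_div, div_le_iff₀ hγ, mul_comm _ (γ ^ (k + 1))]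
  exact h2.trans (mul_le_mul_of_nonneg_right (pow_le_pow_right₀ hT.one_le (by omega))
    (norm_nonneg _))

theorem pow_mul_le_norm_seqProd_mulVec (hT : IsPrimitiveSet T γ κ K)
    {a : ℕ → Matrix (Fin d) (Fin d) ℝ} (ha : ∀ i, a i ∈ T) (n : ℕ) {v : Fin d → ℝ}
    (hv : 0 ≤ v) : (κ / γ ^ K) ^ n * ‖v‖ ≤ ‖(seqProd a n).mulVec v‖ := by
  have hc : 0 ≤ κ / γ ^ K := by have := hT.one_le; have := hT.pos; positivity
  induction n generalizing v with
  | zero => simp [seqProd]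
  | succ n ih =>
    rw [seqProd, ← Matrix.mulVec_mulVec, pow_succ, mul_assoc]
    exact (mul_le_mul_of_nonneg_left (hT.le_norm_mulVec (ha n) hv) (by positivity)).trans
      (ih (mulVec_nonneg (hT.nonneg _ (ha n)) hv))

theorem ratio_le_one (hT : IsPrimitiveSet T γ κ K) {a : Matrix (Fin d) (Fin d) ℝ} (ha : a ∈ T) :
    κ / γ ^ K ≤ 1 := by
  have hγ : 0 < γ ^ K := by have := hT.one_le; positivity
  rw [div_le_one hγ]
  have h := hT.le_norm_seqProd_mulVec (a := fun _ => a) (fun _ => ha) (v := 1) zero_le_one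
  rw [← norm_eq_norm_mulVec_one (hT.seqProd_nonneg (fun _ => ha) K)] at h
  simpa using h.trans (hT.norm_seqProd_le (fun _ => ha) K)

/-- All products of matrices in a primitive set distort the norm of nonnegative vectors by a
bounded factor. -/
theorem exists_mul_norm_le (hT : IsPrimitiveSet T γ κ K) :
    ∃ c : ℝ, 0 < c ∧ c ≤ 1 ∧ ∀ a : ℕ → Matrix (Fin d) (Fin d) ℝ, (∀ i, a i ∈ T) →
      ∀ (n : ℕ) (v : Fin d → ℝ), 0 ≤ v →
        c * (‖seqProd a n‖ * ‖v‖) ≤ ‖(seqProd a n).mulVec v‖ := by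
  have hγ : 0 < γ ^ K := by have := hT.one_le; positivity
  have hγ1 : 1 ≤ γ ^ K := one_le_pow₀ hT.one_le
  have hκ := hT.pos
  by_cases hne : T.Nonempty
  swap
  · exact ⟨1, one_pos, le_rfl, fun a ha => (hne ⟨_, ha 0⟩).elim⟩
  obtain ⟨b, hb⟩ := hne
  set r := κ / γ ^ K with hr
  have hr0 : 0 < r := by positivity
  have hr1 : r ≤ 1 := hT.ratio_le_one hb
  refine ⟨r ^ K / γ ^ K, by positivity, (div_le_one hγ).2 ((pow_le_one₀ hr0.le hr1).trans hγ1),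
    fun a ha n v hv => ?_⟩
  -- A short product loses at most a factor `r` per matrix. In a long product the last `K` matrices
  -- act first on `v` and leave a vector with all entries at least `κ * ‖v‖`; the other matrices
  -- then act on a multiple of the all-ones vector, where a nonnegative matrix attains its norm. The
  -- constant `r ^ K / γ ^ K` serves both cases.
  rcases lt_or_ge n K with hn | hn
  · refine le_trans ?_ (hT.pow_mul_le_norm_seqProd_mulVec ha n hv)
    have h1 : ‖seqProd a n‖ ≤ γ ^ K :=
      (hT.norm_seqProd_le ha n).trans (pow_le_pow_right₀ hT.one_le hn.le)
    calc r ^ K / γ ^ K * (‖seqProd a n‖ * ‖v‖) ≤ r ^ K / γ ^ K * (γ ^ K * ‖v‖) := by gcongr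
      _ = r ^ K * ‖v‖ := by field_simp
      _ ≤ r ^ n * ‖v‖ := mul_le_mul_of_nonneg_right
        (pow_le_pow_of_le_one hr0.le hr1 hn.le) (norm_nonneg _)
  · obtain ⟨m, rfl⟩ : ∃ m, n = m + K := ⟨n - K, by omega⟩
    set b : ℕ → Matrix (Fin d) (Fin d) ℝ := fun i => a (m + i) with hb'
    have hbT : ∀ i, b i ∈ T := fun i => ha _
    rw [seqProd_add]
    have h1 : ‖seqProd a m * seqProd b K‖ ≤ ‖seqProd a m‖ * γ ^ K :=
      (Matrix.linfty_opNorm_mul _ _).trans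
        (mul_le_mul_of_nonneg_left (hT.norm_seqProd_le hbT K) (norm_nonneg _))
    have h2 : ‖seqProd a m‖ * (κ * ‖v‖) ≤ ‖(seqProd a m * seqProd b K).mulVec v‖ := by
      rw [← Matrix.mulVec_mulVec]
      have h3 := norm_mono
        (mulVec_nonneg (hT.seqProd_nonneg ha m) fun _ => mul_nonneg hκ.le (norm_nonneg v))
        (mulVec_mono (hT.seqProd_nonneg ha m) (hT.le_seqProd_mulVec hbT hv))
      refine le_trans (le_of_eq ?_) h3
      have : (fun _ => κ * ‖v‖ : Fin d → ℝ) = (κ * ‖v‖) • (1 : Fin d → ℝ) := by ext; simp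
      rw [this, Matrix.mulVec_smul, norm_smul, ← norm_eq_norm_mulVec_one (hT.seqProd_nonneg ha m),
        Real.norm_of_nonneg (by positivity), mul_comm]
    have hrK : r ^ K ≤ r := by
      simpa using pow_le_pow_of_le_one hr0.le hr1 hT.one_le_length
    calc r ^ K / γ ^ K * (‖seqProd a m * seqProd b K‖ * ‖v‖)
        ≤ r ^ K / γ ^ K * (‖seqProd a m‖ * γ ^ K * ‖v‖) := by gcongr
      _ = r ^ K * (‖seqProd a m‖ * ‖v‖) := by field_simp
      _ ≤ κ * (‖seqProd a m‖ * ‖v‖) := by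
        have : r ≤ κ := div_le_self hκ.le hγ1
        gcongr; exact hrK.trans this
      _ = ‖seqProd a m‖ * (κ * ‖v‖) := by ring
      _ ≤ _ := h2

theorem norm_seqProd_pos (hT : IsPrimitiveSet T γ κ K) {a : ℕ → Matrix (Fin d) (Fin d) ℝ}
    (ha : ∀ i, a i ∈ T) (n : ℕ) : 0 < ‖seqProd a n‖ := by
  have hc : 0 < κ / γ ^ K := by have := hT.one_le; have := hT.pos; positivity
  rw [norm_eq_norm_mulVec_one (hT.seqProd_nonneg ha n)]
  refine lt_of_lt_of_le ?_ (hT.pow_mul_le_norm_seqProd_mulVec ha n zero_le_one)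
  simp only [norm_one, mul_one]
  positivity

/-- The converse of submultiplicativity up to a constant: the second block maps the all-ones vector
to a nonnegative vector, whose norm the first block distorts only boundedly. -/
theorem exists_mul_norm_seqProd_le (hT : IsPrimitiveSet T γ κ K) :
    ∃ c : ℝ, 0 < c ∧ c ≤ 1 ∧ ∀ a : ℕ → Matrix (Fin d) (Fin d) ℝ, (∀ i, a i ∈ T) → ∀ m n : ℕ,
      c * (‖seqProd a m‖ * ‖seqProd (fun i => a (m + i)) n‖) ≤ ‖seqProd a (m + n)‖ := by
  obtain ⟨c, hc, hc1, h⟩ := hT.exists_mul_norm_le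
  refine ⟨c, hc, hc1, fun a ha m n => ?_⟩
  have hn := hT.seqProd_nonneg (a := fun i => a (m + i)) (fun i => ha _) n
  rw [norm_eq_norm_mulVec_one (hT.seqProd_nonneg ha (m + n)), norm_eq_norm_mulVec_one hn,
    seqProd_add, ← Matrix.mulVec_mulVec]
  exact h a ha m _ (mulVec_nonneg hn zero_le_one)

/-- Dropping one factor changes the norm of a product by a bounded factor. -/
theorem exists_mul_norm_seqProd_drop_le (hT : IsPrimitiveSet T γ κ K) :
    ∃ c : ℝ, 0 < c ∧ ∀ a : ℕ → Matrix (Fin d) (Fin d) ℝ, (∀ i, a i ∈ T) → ∀ m n : ℕ,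
      c * (‖seqProd a m‖ * ‖seqProd (fun i => a (m + 1 + i)) n‖) ≤ ‖seqProd a (m + 1 + n)‖ := by
  obtain ⟨c, hc, hc1, h⟩ := hT.exists_mul_norm_seqProd_le
  have hr : 0 < κ / γ ^ K := by have := hT.one_le; have := hT.pos; positivity
  refine ⟨c * (c * (κ / γ ^ K)), by positivity, fun a ha m n => ?_⟩
  refine le_trans ?_ (h a ha (m + 1) n)
  have h1 := h a ha m 1
  have h2 : κ / γ ^ K ≤ ‖seqProd (fun i => a (m + i)) 1‖ := by
    have := hT.pow_mul_le_norm_seqProd_mulVec (a := fun i => a (m + i)) (fun i => ha _) 1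
      (v := 1) zero_le_one
    rw [← norm_eq_norm_mulVec_one (hT.seqProd_nonneg (fun i => ha _) 1)] at this
    simpa using this
  calc c * (c * (κ / γ ^ K)) * (‖seqProd a m‖ * ‖seqProd (fun i => a (m + 1 + i)) n‖)
      = c * ((c * (‖seqProd a m‖ * (κ / γ ^ K))) * ‖seqProd (fun i => a (m + 1 + i)) n‖) := by ring
    _ ≤ c * (‖seqProd a (m + 1)‖ * ‖seqProd (fun i => a (m + 1 + i)) n‖) := by
      have h3 : c * (‖seqProd a m‖ * (κ / γ ^ K)) ≤ ‖seqProd a (m + 1)‖ := le_trans (by gcongr) h1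
      gcongr

theorem exists_abs_log_le (hT : IsPrimitiveSet T γ κ K) :
    ∃ L : ℝ, 0 ≤ L ∧ ∀ a : ℕ → Matrix (Fin d) (Fin d) ℝ, (∀ i, a i ∈ T) → ∀ n : ℕ,
      |Real.log ‖seqProd a n‖| ≤ L * n := by
  have hr : 0 < κ / γ ^ K := by have := hT.one_le; have := hT.pos; positivity
  refine ⟨max (Real.log γ) (-Real.log (κ / γ ^ K)), le_max_of_le_left (Real.log_nonneg hT.one_le),
    fun a ha n => ?_⟩
  have h1 := hT.norm_seqProd_le ha n
  have h2 := hT.pow_mul_le_norm_seqProd_mulVec ha n (v := 1) zero_le_one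
  rw [← norm_eq_norm_mulVec_one (hT.seqProd_nonneg ha n), norm_one, mul_one] at h2
  have h3 := Real.log_le_log (hT.norm_seqProd_pos ha n) h1
  have h4 := Real.log_le_log (by positivity) h2
  rw [Real.log_pow] at h3 h4
  rw [abs_le]
  have hn : (0 : ℝ) ≤ n := Nat.cast_nonneg n
  constructor
  · nlinarith [mul_le_mul_of_nonneg_right (le_max_right (Real.log γ) (-Real.log (κ / γ ^ K))) hn]
  · nlinarith [mul_le_mul_of_nonneg_right (le_max_left (Real.log γ) (-Real.log (κ / γ ^ K))) hn]

/-- Submultiplicativity and its approximate converse bound the error from both sides, uniformly in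
both lengths. This almost additivity takes the place of the subadditive ergodic theorem and also
yields the concentration. -/
theorem exists_abs_log_add_le (hT : IsPrimitiveSet T γ κ K) :
    ∃ C : ℝ, 0 ≤ C ∧ ∀ a : ℕ → Matrix (Fin d) (Fin d) ℝ, (∀ i, a i ∈ T) → ∀ m n : ℕ,
      |Real.log ‖seqProd a (m + n)‖ - Real.log ‖seqProd a m‖
        - Real.log ‖seqProd (fun i => a (m + i)) n‖| ≤ C := by
  obtain ⟨c, hc, hc1, h⟩ := hT.exists_mul_norm_seqProd_le
  refine ⟨-Real.log c, neg_nonneg.2 (Real.log_nonpos hc.le hc1), fun a ha m n => ?_⟩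
  have p1 := hT.norm_seqProd_pos ha m
  have p2 := hT.norm_seqProd_pos (a := fun i => a (m + i)) (fun i => ha _) n
  have p3 := hT.norm_seqProd_pos ha (m + n)
  have h1 := Real.log_le_log (by positivity) (h a ha m n)
  have h2 : ‖seqProd a (m + n)‖ ≤ ‖seqProd a m‖ * ‖seqProd (fun i => a (m + i)) n‖ := by
    rw [seqProd_add]; exact Matrix.linfty_opNorm_mul _ _
  have h3 := Real.log_le_log p3 h2
  rw [Real.log_mul hc.ne' (by positivity), Real.log_mul p1.ne' p2.ne'] at h1
  rw [Real.log_mul p1.ne' p2.ne'] at h3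
  have := Real.log_nonpos hc.le hc1
  rw [abs_le]
  constructor <;> linarith

end IsPrimitiveSet

end

/-! ### Sequences of independent pairs -/

section

/-- The values of `(A_n, Y_n)`. -/
abbrev ARPair (d : ℕ) : Type := (Fin d → Fin d → ℝ) × (Fin d → ℝ)

/-- The sequence of matrices of a sequence of pairs. -/
def mats {d : ℕ} (z : ℕ → ARPair d) (k : ℕ) : Matrix (Fin d) (Fin d) ℝ :=
  Matrix.of (z k).1

theorem prodA_eq_seqProd {Ω : Type*} {d : ℕ} (A : ℕ → Ω → Matrix (Fin d) (Fin d) ℝ) (Y : ℕ → Ω → Fin d → ℝ) (n : ℕ)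
    (ω : Ω) : prodA A n ω = seqProd (mats fun k => arPair A Y k ω) n := by
  induction n with
  | zero => rfl
  | succ n ih => rw [prodA, seqProd, ih]; rfl

/-- A measurable function of a family that depends on the coordinates in `S` only is measurable with
respect to these coordinates. -/
theorem comap_le_iSup_of_dependsOn {Ω ι β ε : Type*} [MeasurableSpace β] [Nonempty β]
    [MeasurableSpace ε] {f : ι → Ω → β} (S : Set ι) (F : (ι → β) → ε) (hF : Measurable F)
    (hFS : ∀ x y, (∀ i ∈ S, x i = y i) → F x = F y) :
    MeasurableSpace.comap (fun ω => F fun i => f i ω) inferInstance ≤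
      ⨆ i ∈ S, MeasurableSpace.comap (f i) inferInstance := by
  classical
  obtain ⟨b⟩ := ‹Nonempty β›
  rw [← measurable_iff_comap_le]
  have h1 : (fun ω => F fun i => f i ω) = F ∘ fun ω i => if i ∈ S then f i ω else b := by
    funext ω
    exact hFS _ _ fun i hi => by simp [hi]
  rw [h1]
  refine hF.comp ?_
  refine @measurable_pi_lambda _ _ _ (_) _ _ fun i => ?_
  by_cases hi : i ∈ S
  · simp only [hi, if_true]
    rw [measurable_iff_comap_le]
    exact le_iSup₂_of_le i hi le_rfl
  · simp only [hi, if_false]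
    exact @measurable_const _ _ _ (_) _

variable {Ω : Type*} [MeasurableSpace Ω] {P : Measure Ω}

/-- The variables `ζ k` are independent and identically distributed. -/
structure IsIID (P : Measure Ω) {β : Type*} [MeasurableSpace β] (ζ : ℕ → Ω → β) : Prop where
  measurable : ∀ k, Measurable (ζ k)
  indep : iIndepFun ζ P
  identDistrib : ∀ k, IdentDistrib (ζ k) (ζ 0) P P

/-- Measurable functions of an independent family that depend on disjoint sets of coordinates are
independent. -/
theorem indepFun_of_dependsOn {ι β γ δ : Type*} [MeasurableSpace β] [MeasurableSpace γ]
    [MeasurableSpace δ] {f : ι → Ω → β} (hf : iIndepFun f P) (hm : ∀ i, Measurable (f i))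
    {S T : Set ι} (hST : Disjoint S T) {F : (ι → β) → γ} {G : (ι → β) → δ} (hF : Measurable F)
    (hG : Measurable G) (hFS : ∀ x y, (∀ i ∈ S, x i = y i) → F x = F y)
    (hGT : ∀ x y, (∀ i ∈ T, x i = y i) → G x = G y) :
    IndepFun (fun ω => F fun i => f i ω) (fun ω => G fun i => f i ω) P := by
  classical
  rcases isEmpty_or_nonempty β with hβ | hβ
  · rcases isEmpty_or_nonempty ι with hι | ⟨⟨i⟩⟩
    · have h1 : ∀ x, F x = F (fun i => (hι.false i).elim) := fun x => hFS _ _ fun i => (hι.false i).elim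
      have h2 : (fun ω => F fun i => f i ω) = fun _ => F (fun i => (hι.false i).elim) :=
        funext fun ω => h1 _
      rw [h2]
      have := hf.isProbabilityMeasure
      exact indepFun_const_left _ _
    · have : IsEmpty Ω := ⟨fun ω => hβ.false (f i ω)⟩
      have h0 : P = 0 := Measure.eq_zero_of_isEmpty P
      have := hf.isProbabilityMeasure
      exact absurd h0 (IsProbabilityMeasure.ne_zero P)
  · exact indep_of_indep_of_le_left (indep_of_indep_of_le_right
      (indep_iSup_of_disjoint (fun i => (hm i).comap_le) hf hST)
      (comap_le_iSup_of_dependsOn T G hG hGT)) (comap_le_iSup_of_dependsOn S F hF hFS)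

/-- An i.i.d. sequence has the same law as each of its injective reindexings. -/
theorem IsIID.identDistrib_reindex {β : Type*} [MeasurableSpace β] {ζ : ℕ → Ω → β}
    (h : IsIID P ζ) {σ : ℕ → ℕ} (hσ : σ.Injective) :
    IdentDistrib (fun ω k => ζ (σ k) ω) (fun ω k => ζ k ω) P P := by
  have := h.indep.isProbabilityMeasure
  refine ⟨(measurable_pi_lambda _ fun k => h.measurable _).aemeasurable,
    (measurable_pi_lambda _ fun k => h.measurable _).aemeasurable, ?_⟩
  rw [(iIndepFun_iff_map_fun_eq_infinitePi_map fun k => h.measurable k).1 h.indep,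
    (iIndepFun_iff_map_fun_eq_infinitePi_map fun k => h.measurable (σ k)).1 (h.indep.precomp hσ)]
  congr 1
  funext k
  rw [(h.identDistrib (σ k)).map_eq, (h.identDistrib k).map_eq]

theorem IsIID.comp {β γ : Type*} [MeasurableSpace β] [MeasurableSpace γ] {ζ : ℕ → Ω → β}
    (h : IsIID P ζ) {g : β → γ} (hg : Measurable g) : IsIID P (fun k ω => g (ζ k ω)) where
  measurable k := hg.comp (h.measurable k)
  indep := h.indep.comp (fun _ => g) fun _ => hg
  identDistrib k := (h.identDistrib k).comp hg

theorem IsIID.ae_forall {β : Type*} [MeasurableSpace β] {ζ : ℕ → Ω → β} (h : IsIID P ζ)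
    {s : Set β} (hs : MeasurableSet s) (h0 : ∀ᵐ ω ∂P, ζ 0 ω ∈ s) : ∀ᵐ ω ∂P, ∀ k, ζ k ω ∈ s :=
  ae_all_iff.2 fun k => (h.identDistrib k).symm.ae_mem_snd hs h0

/-- An independent pair can be resampled. -/
theorem lintegral_of_indepFun {β γ : Type*} [MeasurableSpace β] [MeasurableSpace γ]
    [IsProbabilityMeasure P] {X : Ω → β} {Z : Ω → γ} (hX : Measurable X) (hZ : Measurable Z)
    (h : IndepFun X Z P) {φ : β × γ → ENNReal} (hφ : Measurable φ) :
    ∫⁻ ω, φ (X ω, Z ω) ∂P = ∫⁻ ω, ∫⁻ ω', φ (X ω, Z ω') ∂P ∂P := by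
  have h1 := (indepFun_iff_map_prod_eq_prod_map_map hX.aemeasurable hZ.aemeasurable).1 h
  have : IsProbabilityMeasure (P.map X) := Measure.isProbabilityMeasure_map hX.aemeasurable
  have : IsProbabilityMeasure (P.map Z) := Measure.isProbabilityMeasure_map hZ.aemeasurable
  rw [← lintegral_map hφ (hX.prodMk hZ), h1, lintegral_prod _ hφ.aemeasurable,
    lintegral_map hφ.lintegral_prod_right' hX]
  refine lintegral_congr fun ω => ?_
  exact lintegral_map (hφ.comp measurable_prodMk_left) hZ

theorem measurable_norm_matrix {α : Type*} [MeasurableSpace α] {d : ℕ}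
    {f : α → Matrix (Fin d) (Fin d) ℝ} (h : ∀ i j, Measurable fun x => f x i j) :
    Measurable fun x => ‖f x‖ := by
  simp only [Matrix.linfty_opNorm_def]
  refine Measurable.coe_nnreal_real ?_
  have h1 : ∀ s : Finset (Fin d), Measurable fun x => s.sup fun i => ∑ j, ‖f x i j‖₊ := by
    intro s
    induction s using Finset.induction_on with
    | empty => simp only [Finset.sup_empty]; exact measurable_const
    | insert i s hi ih =>
      simp only [Finset.sup_insert]
      exact (Finset.measurable_sum _ fun j _ => (h i j).nnnorm).sup ih
  exact h1 _

theorem norm_matrix_le_iff {d : ℕ} {A : Matrix (Fin d) (Fin d) ℝ} {r : ℝ} (hr : 0 ≤ r) :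
    ‖A‖ ≤ r ↔ ∀ i, ∑ j, |A i j| ≤ r := by
  lift r to NNReal using hr
  rw [Matrix.linfty_opNorm_def, NNReal.coe_le_coe, Finset.sup_le_iff]
  simp only [Finset.mem_univ, true_imp_iff, ← NNReal.coe_le_coe, NNReal.coe_sum, coe_nnnorm,
    Real.norm_eq_abs]

variable {d : ℕ}

theorem measurable_mats_apply (k : ℕ) (i j : Fin d) :
    Measurable fun z : ℕ → ARPair d => mats z k i j := by
  simp only [mats, Matrix.of_apply]
  exact (measurable_pi_apply j).comp ((measurable_pi_apply i).comp
    (measurable_fst.comp (measurable_pi_apply k)))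

theorem measurable_seqProd_apply {α : Type*} [MeasurableSpace α]
    {a : α → ℕ → Matrix (Fin d) (Fin d) ℝ} (h : ∀ k i j, Measurable fun x => a x k i j) (n : ℕ) :
    ∀ i j, Measurable fun x => seqProd (a x) n i j := by
  induction n with
  | zero => intro i j; simp only [seqProd]; exact measurable_const
  | succ n ih =>
    intro i j
    simp only [seqProd, Matrix.mul_apply]
    exact Finset.measurable_sum _ fun k _ => (ih i k).mul (h n k j)

theorem measurable_norm_seqProd (n : ℕ) :
    Measurable fun z : ℕ → ARPair d => ‖seqProd (mats z) n‖ :=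
  measurable_norm_matrix (measurable_seqProd_apply measurable_mats_apply n)

theorem continuous_seqProd_apply (n : ℕ) (i j : Fin d) :
    Continuous fun x : ℕ → Fin d → Fin d → ℝ => seqProd (fun k => Matrix.of (x k)) n i j := by
  induction n generalizing i j with
  | zero => simp only [seqProd]; exact continuous_const
  | succ n ih =>
    simp only [seqProd, Matrix.mul_apply, Matrix.of_apply]
    exact continuous_finsetSum _ fun k _ => (ih i k).mul (by fun_prop)

theorem IsARData.isIID {A : ℕ → Ω → Matrix (Fin d) (Fin d) ℝ} {Y : ℕ → Ω → Fin d → ℝ}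
    (h : IsARData P A Y) : IsIID P (arPair A Y) :=
  ⟨h.measurable_pair, h.indep, h.identDistrib⟩

/-- The support of the law of the coefficient matrix is a primitive set. -/
theorem exists_isPrimitiveSet [IsProbabilityMeasure P] {A : ℕ → Ω → Matrix (Fin d) (Fin d) ℝ}
    {Y : ℕ → Ω → Fin d → ℝ} (h : IsARData P A Y) (h1 : BD1 P A) (h2 : PR P A) :
    ∃ (T : Set (Matrix (Fin d) (Fin d) ℝ)) (γ κ : ℝ) (K : ℕ), IsPrimitiveSet T γ κ K ∧
      ∀ᵐ ω ∂P, ∀ k, mats (fun k => arPair A Y k ω) k ∈ T := by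
  obtain ⟨γ, hγ⟩ := h1
  obtain ⟨κ, hκ, K, hK, hprod⟩ := h2
  set ζ : ℕ → Ω → Fin d → Fin d → ℝ := fun k ω => (arPair A Y k ω).1 with hζ
  have hiid : IsIID P ζ := h.isIID.comp measurable_fst
  set μ := P.map (ζ 0) with hμ
  set T : Set (Matrix (Fin d) (Fin d) ℝ) := {M | (fun i j => M i j) ∈ μ.support} with hT
  have hmeas : MeasurableSet μ.support := Measure.isClosed_support.measurableSet
  refine ⟨T, max γ 1, κ, K, ⟨?_, ?_, le_max_right _ _, hκ, hK, ?_⟩, ?_⟩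
  · intro a ha
    have hcl : IsClosed {x : Fin d → Fin d → ℝ | ∀ i j, 0 ≤ x i j} := by
      simp only [Set.ofPred_forall]
      exact isClosed_iInter fun i => isClosed_iInter fun j =>
        isClosed_le continuous_const (by fun_prop)
    refine Measure.support_subset_of_isClosed hcl ?_ ha
    rw [hμ, mem_ae_map_iff (hiid.measurable 0).aemeasurable hcl.measurableSet]
    exact Filter.Eventually.of_forall fun ω => h.nonneg_A 0 ω
  · intro a ha
    have hcl : IsClosed {x : Fin d → Fin d → ℝ | ∀ i, ∑ j, |x i j| ≤ max (γ : ℝ) 1} := by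
      simp only [Set.ofPred_forall]
      exact isClosed_iInter fun i => isClosed_le (by fun_prop) continuous_const
    rw [norm_matrix_le_iff (le_max_of_le_right zero_le_one)]
    refine Measure.support_subset_of_isClosed hcl ?_ ha
    rw [hμ, mem_ae_map_iff (hiid.measurable 0).aemeasurable hcl.measurableSet]
    filter_upwards [hγ] with ω hω
    exact (norm_matrix_le_iff (le_max_of_le_right zero_le_one)).1 (hω.trans (le_max_left _ _))
  -- If a product of `K` matrices of the support had an entry below `κ`, then so would all products
  -- of matrices from small neighbourhoods of the factors. By independence such factors occur with
  -- positive probability, against (PR).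
  · intro a ha i j
    by_contra! hlt
    have hop : IsOpen {x : ℕ → Fin d → Fin d → ℝ | seqProd (fun k => Matrix.of (x k)) K i j < κ} :=
      isOpen_lt (continuous_seqProd_apply K i j) continuous_const
    obtain ⟨I, u, hu, hsub⟩ : ∃ (I : Finset ℕ) (u : ℕ → Set (Fin d → Fin d → ℝ)),
        (∀ k ∈ I, IsOpen (u k) ∧ (fun i j => a k i j) ∈ u k) ∧ (I : Set ℕ).pi u ⊆
          {x : ℕ → Fin d → Fin d → ℝ | seqProd (fun k => Matrix.of (x k)) K i j < κ} :=
      isOpen_pi_iff.1 hop (fun k i j => a k i j) hlt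
    have hpos : 0 < P (⋂ k ∈ I, ζ k ⁻¹' u k) := by
      rw [hiid.indep.measure_inter_preimage_eq_mul I fun k hk => (hu k hk).1.measurableSet]
      refine pos_iff_ne_zero.2 (Finset.prod_ne_zero_iff.2 fun k hk => ?_)
      rw [← Measure.map_apply (hiid.measurable k) (hu k hk).1.measurableSet,
        (hiid.identDistrib k).map_eq]
      have hak : (fun i j => a k i j : Fin d → Fin d → ℝ) ∈ μ.support := ha k
      exact ((Measure.mem_support_iff_forall _).1 hak (u k)
        ((hu k hk).1.mem_nhds (hu k hk).2)).ne'
    have hnull : P (⋂ k ∈ I, ζ k ⁻¹' u k) = 0 := by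
      refine measure_mono_null ?_ (ae_iff.1 hprod)
      intro ω hω
      have hm : (fun k => ζ k ω) ∈ (I : Set ℕ).pi u := fun k hk => by
        simpa using Set.mem_iInter₂.1 hω k hk
      have h3 := hsub hm
      simp only [Set.mem_ofPred_eq, not_forall, not_le]
      refine ⟨i, j, ?_⟩
      rw [prodA_eq_seqProd A Y]
      exact h3
    exact hpos.ne' hnull
  · refine hiid.ae_forall hmeas ?_
    have h3 : μ.support ∈ ae μ := Measure.support_mem_ae
    rwa [hμ, mem_ae_map_iff (hiid.measurable 0).aemeasurable hmeas] at h3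

end

/-! ### Concentration of the decay of the products -/

section

variable {Ω : Type*} [MeasurableSpace Ω] {P : Measure Ω} {d : ℕ}

/-- An i.i.d. sequence of pairs with nonnegative vectors whose matrices almost surely belong to a
primitive set. -/
structure PrimitiveIID (P : Measure Ω) (ζ : ℕ → Ω → ARPair d)
    (T : Set (Matrix (Fin d) (Fin d) ℝ)) (γ κ : ℝ) (K : ℕ) : Prop where
  iid : IsIID P ζ
  prim : IsPrimitiveSet T γ κ K
  mem : ∀ᵐ ω ∂P, ∀ k, mats (fun k => ζ k ω) k ∈ T
  nonneg : ∀ k ω, 0 ≤ (ζ k ω).2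

/-- `S_n = -ln ‖a_0 ⋯ a_{n-1}‖` for a sequence of pairs `(a_k, y_k)`. -/
def decay (z : ℕ → ARPair d) (n : ℕ) : ℝ := -Real.log ‖seqProd (mats z) n‖

theorem measurable_decay (n : ℕ) : Measurable fun z : ℕ → ARPair d => decay z n :=
  (Real.measurable_log.comp (measurable_norm_seqProd n)).neg

theorem _root_.ProbabilityTheory.HasSubgaussianMGF.mono {X : Ω → ℝ} {c c' : NNReal}
    (h : HasSubgaussianMGF X c P) (hc : c ≤ c') : HasSubgaussianMGF X c' P where
  integrable_exp_mul := h.integrable_exp_mul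
  mgf_le t := (h.mgf_le t).trans (Real.exp_le_exp.2 (by have : (c : ℝ) ≤ c' := hc; gcongr))

/-- An almost additive sequence is at bounded distance from a linear one. -/
theorem exists_abs_sub_mul_le {e : ℕ → ℝ} {C L : ℝ}
    (h : ∀ m n, |e (m + n) - e m - e n| ≤ C) (hL : ∀ n, |e n| ≤ L * n) :
    ∃ l : ℝ, ∀ n : ℕ, |e n - n * l| ≤ C := by
  have hC : 0 ≤ C := (abs_nonneg _).trans (h 0 0)
  -- Fekete's lemma applies to both `e + C` and `-e + C`. The two limits are opposite, since the
  -- quotients add up to `2 * C / n`, and each limit is a lower bound for its quotients, which gives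
  -- the two inequalities.
  have h1 : Subadditive fun n => e n + C := fun m n => by
    have := (abs_le.1 (h m n)).2; simp only; linarith
  have h2 : Subadditive fun n => -e n + C := fun m n => by
    have := (abs_le.1 (h m n)).1; simp only; linarith
  have hb1 : BddBelow (Set.range fun n : ℕ => (e n + C) / n) := by
    refine ⟨-|L|, ?_⟩
    rintro _ ⟨n, rfl⟩
    rcases Nat.eq_zero_or_pos n with rfl | hn
    · simp
    have hn' : (0 : ℝ) < n := by exact_mod_cast hn
    simp only
    rw [le_div_iff₀ hn']
    have := (abs_le.1 (hL n)).1
    have h3 := mul_le_mul_of_nonneg_right (le_abs_self L) hn'.le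
    linarith
  have hb2 : BddBelow (Set.range fun n : ℕ => (-e n + C) / n) := by
    refine ⟨-|L|, ?_⟩
    rintro _ ⟨n, rfl⟩
    rcases Nat.eq_zero_or_pos n with rfl | hn
    · simp
    have hn' : (0 : ℝ) < n := by exact_mod_cast hn
    simp only
    rw [le_div_iff₀ hn']
    have := (abs_le.1 (hL n)).2
    have h3 := mul_le_mul_of_nonneg_right (le_abs_self L) hn'.le
    linarith
  have t1 := h1.tendsto_lim hb1
  have t2 := h2.tendsto_lim hb2
  have t3 : Tendsto (fun n : ℕ => 2 * C / (n : ℝ)) atTop (𝓝 0) :=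
    tendsto_const_div_atTop_nhds_zero_nat _
  have hsum : h1.lim + h2.lim = 0 := by
    refine tendsto_nhds_unique (t1.add t2) (t3.congr fun n => ?_)
    ring
  refine ⟨h1.lim, fun n => ?_⟩
  rcases Nat.eq_zero_or_pos n with rfl | hn
  · have := hL 0
    simp only [Nat.cast_zero, mul_zero, zero_mul, sub_zero] at this ⊢
    linarith
  have hn' : (0 : ℝ) < n := by exact_mod_cast hn
  have a1 := h1.lim_le_div hb1 hn.ne'
  have a2 := h2.lim_le_div hb2 hn.ne'
  rw [le_div_iff₀ hn'] at a1 a2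
  have a3 : h2.lim = -h1.lim := by linarith
  rw [a3] at a2
  rw [abs_le]
  constructor <;> nlinarith

/-- If the fluctuations at time `n` are those of two independent copies at time `n / 2`, up to a
bounded error, then they are sub-Gaussian with variance proxy of order `n`. -/
theorem exists_subgaussian_of_halving [IsProbabilityMeasure P] {X : ℕ → Ω → ℝ} {C L : ℝ}
    (hC : 0 ≤ C) (hL : 0 ≤ L) (hm : ∀ n, AEMeasurable (X n) P)
    (hbd : ∀ n, ∀ᵐ ω ∂P, |X n ω| ≤ L * n)
    (hsplit : ∀ m n, 1 ≤ m → n = m + m ∨ n = m + m + 1 → ∃ X' : Ω → ℝ,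
      IdentDistrib (X m) X' P P ∧ IndepFun (X m) X' P ∧
      ∀ᵐ ω ∂P, |X n ω - X m ω - X' ω| ≤ C) :
    ∃ D : ℝ, 0 < D ∧ ∀ n : ℕ, 1 ≤ n → ∃ c : NNReal, (c : ℝ) = D * n ∧
      HasSubgaussianMGF (fun ω => X n ω - ∫ ω, X n ω ∂P) c P := by
  have hs2 : 1 < √2 := by
    rw [Real.lt_sqrt zero_le_one]; norm_num
  have hs2' : √2 * √2 = 2 := Real.mul_self_sqrt zero_le_two
  -- With `s ^ 2` as variance proxy, halving gives `s_n ≤ √2 * s_m + C`. The bound `s_n ≤ D * √n -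
  -- E` reproduces itself under this recursion because `√2 * E - C = E`, and `D` is chosen so that
  -- it holds at `n = 1`.
  set E := C / (√2 - 1) with hE
  have hE0 : 0 ≤ E := div_nonneg hC (by linarith)
  have hEC : √2 * E - C = E := by
    have : √2 - 1 ≠ 0 := by linarith
    rw [hE]; field_simp; ring
  set D := L + E + 1 with hD
  have hint : ∀ n, Integrable (X n) P := fun n =>
    Integrable.of_mem_Icc (-(L * n)) (L * n) (hm n) ((hbd n).mono fun ω hω => abs_le.1 hω)
  have key : ∀ n : ℕ, 1 ≤ n → ∃ s : NNReal, (s : ℝ) ≤ D * √n - E ∧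
      HasSubgaussianMGF (fun ω => X n ω - ∫ ω, X n ω ∂P) (s ^ 2) P := by
    intro n
    induction n using Nat.strong_induction_on with
    | _ n ih =>
      intro hn
      rcases hn.eq_or_lt with rfl | hn2
      · have h1 := hasSubgaussianMGF_of_mem_Icc (hm 1)
          ((hbd 1).mono fun ω hω => abs_le.1 hω)
        refine ⟨_, ?_, h1⟩
        simp only [NNReal.coe_div, coe_nnnorm, NNReal.coe_ofNat, Nat.cast_one, mul_one,
          Real.sqrt_one]
        rw [Real.norm_of_nonneg (by linarith)]
        linarith
      obtain ⟨m, hm1, hmn⟩ : ∃ m, 1 ≤ m ∧ (n = m + m ∨ n = m + m + 1) := ⟨n / 2, by omega, by omega⟩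
      obtain ⟨s, hs, hsub⟩ := ih m (by omega) hm1
      obtain ⟨X', hid, hind, hR⟩ := hsplit m n hm1 hmn
      have hX'm := hid.aemeasurable_snd
      have hX'int : Integrable X' P := hid.integrable_iff.1 (hint m)
      have hsub' : HasSubgaussianMGF (fun ω => X' ω - ∫ ω, X m ω ∂P) (s ^ 2) P :=
        hsub.congr_identDistrib (hid.comp (u := fun x => x - ∫ ω, X m ω ∂P) (by fun_prop))
      have hsum := hsub.add_of_indepFun hsub'
        (hind.comp (φ := fun x => x - ∫ ω, X m ω ∂P) (ψ := fun x => x - ∫ ω, X m ω ∂P)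
          (by fun_prop) (by fun_prop))
      -- The error term depends on both halves. It is bounded, hence sub-Gaussian after centring,
      -- and adding it without independence adds the square roots of the proxies.
      have hRsub := hasSubgaussianMGF_of_mem_Icc (((hm n).sub (hm m)).sub hX'm)
        (hR.mono fun ω hω => abs_le.1 hω)
      have htot := hsum.add hRsub
      refine ⟨_, ?_, htot.congr ?_⟩
      · have h2 : ((NNReal.sqrt (s ^ 2 + s ^ 2) + NNReal.sqrt ((‖C - -C‖₊ / 2) ^ 2) : NNReal) : ℝ)
            = √2 * s + C := by
          rw [NNReal.sqrt_sq]
          simp only [NNReal.coe_add, Real.coe_sqrt, NNReal.coe_pow, NNReal.coe_div, coe_nnnorm,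
            NNReal.coe_ofNat]
          rw [Real.norm_of_nonneg (by linarith), ← two_mul, Real.sqrt_mul zero_le_two,
            Real.sqrt_sq (NNReal.coe_nonneg s)]
          ring
        rw [h2]
        have h3 : √2 * √m ≤ √n := by
          rw [← Real.sqrt_mul zero_le_two]
          refine Real.sqrt_le_sqrt ?_
          have : 2 * m ≤ n := by omega
          exact_mod_cast this
        have h4 : 0 ≤ D := by linarith
        nlinarith [mul_le_mul_of_nonneg_left hs (Real.sqrt_nonneg 2),
          mul_le_mul_of_nonneg_left h3 h4]
      · refine Filter.Eventually.of_forall fun ω => ?_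
        have h5 : ∫ ω, (X n - X m - X') ω ∂P
            = ∫ ω, X n ω ∂P - ∫ ω, X m ω ∂P - ∫ ω, X m ω ∂P := by
          rw [hid.integral_eq, integral_sub' ((hint n).sub (hint m)) hX'int,
            integral_sub' (hint n) (hint m), ← hid.integral_eq]
        simp only [Pi.sub_apply] at h5 ⊢
        rw [h5]
        ring
  have hD0 : 0 < D := by linarith
  refine ⟨D ^ 2, by positivity, fun n hn => ?_⟩
  obtain ⟨s, hs, hsub⟩ := key n hn
  refine ⟨(D ^ 2 * n).toNNReal, Real.coe_toNNReal _ (by positivity), hsub.mono ?_⟩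
  rw [← NNReal.coe_le_coe, Real.coe_toNNReal _ (by positivity), NNReal.coe_pow]
  calc (s : ℝ) ^ 2 ≤ (D * √n) ^ 2 := pow_le_pow_left₀ (NNReal.coe_nonneg s) (by linarith) 2
    _ = D ^ 2 * n := by rw [mul_pow, Real.sq_sqrt (Nat.cast_nonneg n)]

theorem measure_abs_sub_ge_le_of_subgaussian [IsProbabilityMeasure P] {X : Ω → ℝ} {c : NNReal}
    (h : HasSubgaussianMGF X c P) {t : ℝ} (ht : 0 ≤ t) :
    P.real {ω | t ≤ |X ω|} ≤ 2 * Real.exp (-t ^ 2 / (2 * c)) := by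
  have h1 := h.measure_ge_le ht
  have h2 := h.neg.measure_ge_le ht
  have h3 : {ω | t ≤ |X ω|} ⊆ {ω | t ≤ X ω} ∪ {ω | t ≤ (-X) ω} := fun ω hω => by
    rcases le_abs.1 (show t ≤ |X ω| from hω) with h | h
    · exact Or.inl h
    · exact Or.inr h
  calc P.real {ω | t ≤ |X ω|} ≤ P.real ({ω | t ≤ X ω} ∪ {ω | t ≤ (-X) ω}) := measureReal_mono h3
    _ ≤ _ := measureReal_union_le _ _
    _ ≤ _ := by linarith

namespace PrimitiveIID

variable {ζ : ℕ → Ω → ARPair d} {T : Set (Matrix (Fin d) (Fin d) ℝ)} {γ κ : ℝ} {K : ℕ}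

theorem measurable_seq (h : PrimitiveIID P ζ T γ κ K) : Measurable fun ω k => ζ k ω :=
  measurable_pi_lambda _ h.iid.measurable

theorem measurable_decay (h : PrimitiveIID P ζ T γ κ K) (n : ℕ) :
    Measurable fun ω => decay (fun k => ζ k ω) n :=
  (SubcriticalAR.measurable_decay n).comp h.measurable_seq

/-- The sub-Gaussian fluctuations of `S_n` around a linear function of `n`. -/
theorem exists_concentration [NeZero d] [IsProbabilityMeasure P]
    (h : PrimitiveIID P ζ T γ κ K) :
    ∃ lam C c : ℝ, 0 < C ∧ 0 < c ∧ ∀ n : ℕ, 1 ≤ n → ∀ t : ℝ, 0 ≤ t →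
      P.real {ω | t ≤ |decay (fun k => ζ k ω) n - n * lam|} ≤ C * Real.exp (-(c * t ^ 2 / n)) := by
  obtain ⟨L, hL, hLb⟩ := h.prim.exists_abs_log_le
  obtain ⟨C, hC, hCb⟩ := h.prim.exists_abs_log_add_le
  set X : ℕ → Ω → ℝ := fun n ω => decay (fun k => ζ k ω) n with hX
  have hbd : ∀ n, ∀ᵐ ω ∂P, |X n ω| ≤ L * n := fun n => h.mem.mono fun ω hω => by
    simp only [hX, decay, abs_neg]; exact hLb _ hω n
  have hshift : ∀ m n, IdentDistrib (X n)
      (fun ω => decay (fun k => ζ (m + k) ω) n) P P := fun m n =>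
    ((h.iid.identDistrib_reindex (σ := fun k => m + k)
      (add_right_injective m)).comp (SubcriticalAR.measurable_decay n)).symm
  have hadd : ∀ m n, ∀ᵐ ω ∂P,
      |X (m + n) ω - X m ω - decay (fun k => ζ (m + k) ω) n| ≤ C := fun m n =>
    h.mem.mono fun ω hω => by
      have := hCb _ hω m n
      have e : (fun i => mats (fun k => ζ k ω) (m + i)) = mats fun k => ζ (m + k) ω := rfl
      rw [← abs_neg, e] at this
      refine le_trans (le_of_eq ?_) this
      simp only [hX, decay]
      congr 1
      ring
  have hmeas : ∀ n, AEMeasurable (X n) P := fun n => (h.measurable_decay n).aemeasurable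
  have hint : ∀ n, Integrable (X n) P := fun n =>
    Integrable.of_mem_Icc (-(L * n)) (L * n) (hmeas n) ((hbd n).mono fun ω hω => abs_le.1 hω)
  -- An odd time `m + m + 1` is split twice, at a cost of `C` each, and the logarithm of the single
  -- remaining factor is at most `L`.
  obtain ⟨D, hD, hsub⟩ := exists_subgaussian_of_halving (P := P) (X := X) (C := C + (C + L)) (L := L)
    (by linarith) hL hmeas hbd (by
      intro m n hm hmn
      refine ⟨fun ω => decay (fun k => ζ (m + k) ω) m, hshift m m, ?_, ?_⟩
      · refine indepFun_of_dependsOn h.iid.indep h.iid.measurable (S := {i | i < m})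
          (T := {i | m ≤ i}) (F := fun z => decay z m) (G := fun z => decay (fun k => z (m + k)) m)
          ?_ (SubcriticalAR.measurable_decay m) ?_ ?_ ?_
        · exact Set.disjoint_left.2 fun i (hi : i < m) (hi' : m ≤ i) => absurd hi (not_lt.2 hi')
        · exact (SubcriticalAR.measurable_decay m).comp
            (measurable_pi_lambda _ fun k => measurable_pi_apply _)
        · intro x y hxy
          simp only [decay]
          rw [seqProd_congr fun i hi => ?_]
          simp only [mats]; rw [hxy i hi]
        · intro x y hxy
          simp only [decay]
          rw [seqProd_congr fun i hi => ?_]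
          simp only [mats]; rw [hxy (m + i) (Nat.le_add_right m i)]
      · rcases hmn with rfl | rfl
        · filter_upwards [hadd m m] with ω hω
          linarith
        · filter_upwards [hadd m m, hadd (m + m) 1, h.mem] with ω h1 h2 h3
          have h4 := hLb _ (fun i => h3 (m + m + i)) 1
          have h5 : |decay (fun k => ζ (m + m + k) ω) 1| ≤ L := by
            have e : (fun i => mats (fun k => ζ k ω) (m + m + i)) =
              mats fun k => ζ (m + m + k) ω := rfl
            rw [e] at h4
            simp only [decay, abs_neg]
            simpa using h4
          rw [abs_le] at *
          constructor <;> linarith)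
  -- By stationarity the expectations of `S_n` are almost additive as well, and their slope is
  -- `lam`.
  obtain ⟨lam, hlam⟩ := exists_abs_sub_mul_le (e := fun n => ∫ ω, X n ω ∂P) (C := C) (L := L) (by
    intro m n
    rw [(hshift m n).integral_eq]
    have hi2 : Integrable (fun ω => decay (fun k => ζ (m + k) ω) n) P :=
      (hshift m n).integrable_iff.1 (hint n)
    rw [← integral_sub (hint _) (hint _), ← integral_sub (by exact (hint _).sub (hint _)) hi2]
    have := norm_integral_le_of_norm_le_const (μ := P)
      (f := fun ω => X (m + n) ω - X m ω - decay (fun k => ζ (m + k) ω) n) (hadd m n)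
    simpa using this) (by
    intro n
    simpa using norm_integral_le_of_norm_le_const (μ := P) (f := X n) (hbd n))
  -- Expectation and `n * lam` differ by at most `C`. For `t ≥ 2 * C` this takes up at most half of
  -- `t`, whence the constant `1 / (8 * D)`; for smaller `t` the prefactor makes the bound exceed
  -- one.
  refine ⟨lam, 2 * Real.exp (C ^ 2 / (2 * D)), 1 / (8 * D), by positivity, by positivity,
    fun n hn t ht => ?_⟩
  have hn' : (1 : ℝ) ≤ n := by exact_mod_cast hn
  obtain ⟨c, hc, hsubn⟩ := hsub n hn
  rcases lt_or_ge t (2 * C) with htC | htC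
  · refine measureReal_le_one.trans ?_
    rw [mul_assoc, ← Real.exp_add]
    have h1 : 1 / (8 * D) * t ^ 2 / n ≤ C ^ 2 / (2 * D) := by
      have h2 : t ^ 2 ≤ (2 * C) ^ 2 := pow_le_pow_left₀ ht htC.le 2
      calc 1 / (8 * D) * t ^ 2 / n ≤ 1 / (8 * D) * t ^ 2 :=
            div_le_self (by positivity) hn'
        _ ≤ 1 / (8 * D) * (2 * C) ^ 2 := by gcongr
        _ = C ^ 2 / (2 * D) := by field_simp; ring
    have h3 := Real.one_le_exp (x := C ^ 2 / (2 * D) + -(1 / (8 * D) * t ^ 2 / n)) (by linarith)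
    linarith
  · have h1 := measure_abs_sub_ge_le_of_subgaussian hsubn (t := t / 2) (by linarith)
    have h2 : {ω | t ≤ |X n ω - n * lam|} ⊆ {ω | t / 2 ≤ |X n ω - ∫ ω, X n ω ∂P|} := by
      intro ω hω
      have h3 := abs_sub_le (X n ω) (∫ ω, X n ω ∂P) (n * lam)
      have h4 := hlam n
      have h5 : t ≤ |X n ω - n * lam| := hω
      show t / 2 ≤ _
      linarith
    refine (measureReal_mono h2).trans (h1.trans ?_)
    have h3 : -(t / 2) ^ 2 / (2 * (c : ℝ)) = -(1 / (8 * D) * t ^ 2 / n) := by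
      rw [hc]; field_simp; ring
    rw [h3]
    have h4 : 1 ≤ Real.exp (C ^ 2 / (2 * D)) := Real.one_le_exp (by positivity)
    have h5 := Real.exp_pos (-(1 / (8 * D) * t ^ 2 / n))
    nlinarith

end PrimitiveIID

/-- Strong law from sub-Gaussian deviations. -/
theorem ae_tendsto_div_of_deviation [IsFiniteMeasure P] {X : ℕ → Ω → ℝ} {lam C c : ℝ}
    (hc : 0 < c) (h : ∀ n : ℕ, 1 ≤ n → ∀ t : ℝ, 0 ≤ t →
      P.real {ω | t ≤ |X n ω - n * lam|} ≤ C * Real.exp (-(c * t ^ 2 / n))) :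
    ∀ᵐ ω ∂P, Tendsto (fun n : ℕ => X n ω / n) atTop (𝓝 lam) := by
  have h1 : ∀ k : ℕ, ∀ᵐ ω ∂P, ∀ᶠ n : ℕ in atTop,
      ω ∉ {ω | (n : ℝ) / (k + 1) ≤ |X n ω - n * lam|} := by
    intro k
    refine ae_eventually_notMem ?_
    have hk : (0 : ℝ) < k + 1 := by positivity
    have hr : Real.exp (-(c / (k + 1) ^ 2)) < 1 := Real.exp_lt_one_iff.2 (by
      have : 0 < c / (k + 1 : ℝ) ^ 2 := by positivity
      linarith)
    have hs : Summable fun n : ℕ => P.real {ω | (n : ℝ) / (k + 1) ≤ |X n ω - n * lam|} := by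
      rw [← summable_nat_add_iff 1]
      refine Summable.of_nonneg_of_le (fun n => measureReal_nonneg) (fun n => ?_)
        (((summable_nat_add_iff 1).2
          (summable_geometric_of_lt_one (Real.exp_pos _).le hr)).mul_left C)
      refine (h (n + 1) (by omega) _ (by positivity)).trans (le_of_eq ?_)
      rw [← Real.exp_nat_mul]
      congr 2
      push_cast
      field_simp
    have h2 := hs.tsum_ofReal_ne_top
    simpa [ofReal_measureReal] using h2
  filter_upwards [ae_all_iff.2 h1] with ω hω
  rw [Metric.tendsto_atTop]
  intro ε hε
  obtain ⟨k, hk⟩ := exists_nat_one_div_lt hε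
  obtain ⟨N, hN⟩ := eventually_atTop.1 (hω k)
  refine ⟨max N 1, fun n hn => ?_⟩
  have hn1 : (0 : ℝ) < n := by
    have : 1 ≤ n := le_trans (le_max_right _ _) hn
    exact_mod_cast this
  have h2 := hN n (le_trans (le_max_left _ _) hn)
  simp only [not_le] at h2
  rw [Real.dist_eq]
  have h3 : X n ω / n - lam = (X n ω - n * lam) / n := by field_simp
  rw [h3, abs_div, abs_of_pos hn1, div_lt_iff₀ hn1]
  refine h2.trans ?_
  rw [div_eq_mul_one_div, mul_comm]
  gcongr

end

/-! ### Summation of stretched exponentials -/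

section

theorem exists_rpow_le {s t ε : ℝ} (hs : 0 ≤ s) (hst : s < t) (hε : 0 < ε) :
    ∃ C : ℝ, 0 ≤ C ∧ ∀ x : ℝ, 0 ≤ x → x ^ s ≤ ε * x ^ t + C := by
  -- Beyond `M` the factor `x ^ (t - s)` is at least `1 / ε`; up to `M` the constant `M ^ s`
  -- suffices.
  set M := (1 / ε) ^ (1 / (t - s)) with hM
  have hM0 : 0 < M := by positivity
  refine ⟨M ^ s, by positivity, fun x hx => ?_⟩
  rcases le_total x M with h | h
  · have h1 := Real.rpow_le_rpow hx h hs
    have h2 : 0 ≤ ε * x ^ t := by positivity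
    linarith
  · have hx0 : 0 < x := hM0.trans_le h
    have h1 : 1 / ε ≤ x ^ (t - s) := by
      have h2 := Real.rpow_le_rpow hM0.le h (by linarith : 0 ≤ t - s)
      rwa [hM, ← Real.rpow_mul (by positivity), one_div_mul_cancel (by linarith), Real.rpow_one]
        at h2
    have h3 : x ^ t = x ^ s * x ^ (t - s) := by rw [← Real.rpow_add hx0]; congr 1; ring
    have h4 : 1 ≤ ε * x ^ (t - s) := by
      rw [div_le_iff₀ hε] at h1; linarith
    have h5 : 0 ≤ x ^ s := by positivity
    have h6 : 0 ≤ M ^ s := by positivity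
    rw [h3]
    nlinarith

theorem summable_exp_neg_rpow {c s : ℝ} (hc : 0 < c) (hs : 0 < s) :
    Summable fun n : ℕ => Real.exp (-(c * (n : ℝ) ^ s)) := by
  have h1 := (isLittleO_exp_neg_mul_rpow_atTop hc (-2 / s)).comp_tendsto
    ((tendsto_rpow_atTop hs).comp tendsto_natCast_atTop_atTop)
  refine summable_of_isBigO_nat (g := fun n : ℕ => (n : ℝ) ^ (-2 : ℝ))
    (Real.summable_nat_rpow.2 (by norm_num)) (h1.isBigO.congr (fun n => ?_) fun n => ?_)
  · simp only [Function.comp]; congr 1; ring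
  · simp only [Function.comp]
    rw [← Real.rpow_mul (Nat.cast_nonneg n)]
    congr 1
    field_simp

theorem summable_exp_add_rpow {c C s t : ℝ} (hc : 0 < c) (hs : 0 ≤ s) (hst : s < t) :
    Summable fun n : ℕ => Real.exp (-(c * (n : ℝ) ^ t) + C * (n : ℝ) ^ s) := by
  obtain ⟨D, hD, h⟩ := exists_rpow_le hs hst (ε := c / (2 * (|C| + 1))) (by positivity)
  refine Summable.of_nonneg_of_le (fun n => (Real.exp_pos _).le) (fun n => ?_)
    ((summable_exp_neg_rpow (half_pos hc) (hs.trans_lt hst)).mul_left (Real.exp (|C| * D)))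
  rw [← Real.exp_add]
  refine Real.exp_le_exp.2 ?_
  have hn : (0 : ℝ) ≤ (n : ℝ) ^ s := by positivity
  have hn' : (0 : ℝ) ≤ (n : ℝ) ^ t := by positivity
  have h1 : C * (n : ℝ) ^ s ≤ |C| * (n : ℝ) ^ s := mul_le_mul_of_nonneg_right (le_abs_self C) hn
  have h2 := mul_le_mul_of_nonneg_left (h n (Nat.cast_nonneg n)) (abs_nonneg C)
  have h3 : |C| * (c / (2 * (|C| + 1)) * (n : ℝ) ^ t) ≤ c / 2 * (n : ℝ) ^ t := by
    have h4 : |C| * (c / (2 * (|C| + 1))) ≤ c / 2 := by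
      rw [mul_div_assoc', div_le_div_iff₀ (by positivity) two_pos]
      nlinarith [abs_nonneg C]
    calc |C| * (c / (2 * (|C| + 1)) * (n : ℝ) ^ t)
        = |C| * (c / (2 * (|C| + 1))) * (n : ℝ) ^ t := by ring
      _ ≤ _ := mul_le_mul_of_nonneg_right h4 hn'
  linarith

/-- Products of comparable factors whose differences are summable are comparable. -/
theorem exists_prod_le_mul_prod {u v : ℕ → ℝ} {f : ℝ} (hf : 0 < f) (hu : ∀ m, f ≤ u m)
    (huv : ∀ m, u m ≤ v m) (hs : Summable fun m => v m - u m) :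
    ∃ C : ℝ, 1 ≤ C ∧ ∀ s : Finset ℕ, ∏ m ∈ s, v m ≤ C * ∏ m ∈ s, u m := by
  refine ⟨Real.exp ((∑' m, (v m - u m)) / f), Real.one_le_exp (div_nonneg
    (tsum_nonneg fun m => sub_nonneg.2 (huv m)) hf.le), fun s => ?_⟩
  -- Since `u m ≥ f`, the ratio `v m / u m` is at most `1 + (v m - u m) / f`, hence at most the
  -- exponential of `(v m - u m) / f`, and these exponents are summable.
  have h1 : ∏ m ∈ s, v m ≤ ∏ m ∈ s, (Real.exp ((v m - u m) / f) * u m) := by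
    refine Finset.prod_le_prod (fun m _ => hf.le.trans ((hu m).trans (huv m))) fun m _ => ?_
    have h2 := Real.add_one_le_exp ((v m - u m) / f)
    have h3 : 0 < u m := hf.trans_le (hu m)
    have h4 : v m - u m ≤ (v m - u m) / f * u m := by
      rw [div_mul_eq_mul_div, le_div_iff₀ hf]
      exact mul_le_mul_of_nonneg_left (hu m) (sub_nonneg.2 (huv m))
    nlinarith
  refine h1.trans ?_
  rw [Finset.prod_mul_distrib, ← Real.exp_sum, ← Finset.sum_div]
  refine mul_le_mul_of_nonneg_right ?_ (Finset.prod_nonneg fun m _ => hf.le.trans (hu m))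
  refine Real.exp_le_exp.2 (div_le_div_of_nonneg_right ?_ hf.le)
  exact hs.sum_le_tsum s fun m _ => sub_nonneg.2 (huv m)

/-- The number of integers `m` such that `m * lam` is at distance at most `2 * m ^ a + B` of `x`. -/
theorem exists_card_le {lam a B : ℝ} (hlam : 0 < lam) (ha : 0 < a) (ha1 : a < 1) (hB : 0 ≤ B) :
    ∃ C : ℝ, 0 ≤ C ∧ ∀ (x : ℝ) (s : Finset ℕ),
      (∀ m ∈ s, |x - m * lam| ≤ 2 * (m : ℝ) ^ a + B) → (s.card : ℝ) ≤ C * (1 + (max x 0) ^ a) := by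
  obtain ⟨D, hD, hDx⟩ := exists_rpow_le ha.le ha1 (ε := lam / 4) (by positivity)
  set E := 2 / lam * (B + 2 * D) with hE
  have hE0 : 0 ≤ E := by positivity
  set R := (2 / lam) ^ a with hR
  have hR0 : 0 ≤ R := by positivity
  refine ⟨1 + 2 * B / lam + 4 / lam * (R + E ^ a), by positivity, fun x s hs => ?_⟩
  have hxa : 0 ≤ (max x 0) ^ a := by positivity
  rcases s.eq_empty_or_nonempty with rfl | hne
  · simp only [Finset.card_empty, Nat.cast_zero]; positivity
  -- The set lies between its extreme elements. Both are related to the same `x`, so their distance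
  -- is of order `m₂ ^ a`, and `m₂` is of order `1 + max x 0` because `a < 1`.
  set m₁ := s.min' hne
  set m₂ := s.max' hne
  have h1 := abs_le.1 (hs m₁ (s.min'_mem hne))
  have h2 := abs_le.1 (hs m₂ (s.max'_mem hne))
  have h12 : m₁ ≤ m₂ := s.min'_le_max' hne
  have hcard : s.card ≤ m₂ + 1 - m₁ := by
    rw [← Nat.card_Icc]
    exact Finset.card_le_card fun m hm => Finset.mem_Icc.2 ⟨s.min'_le m hm, s.le_max' m hm⟩
  have hcard' : (s.card : ℝ) ≤ m₂ + 1 - m₁ := by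
    have : ((m₂ + 1 - m₁ : ℕ) : ℝ) = m₂ + 1 - m₁ := by
      rw [Nat.cast_sub (by omega)]; push_cast; ring
    rw [← this]; exact_mod_cast hcard
  have hpow : (m₁ : ℝ) ^ a ≤ (m₂ : ℝ) ^ a :=
    Real.rpow_le_rpow (Nat.cast_nonneg _) (by exact_mod_cast h12) ha.le
  have hgap : lam * ((m₂ : ℝ) - m₁) ≤ 4 * (m₂ : ℝ) ^ a + 2 * B := by nlinarith
  have hD2 := hDx m₂ (Nat.cast_nonneg _)
  rw [Real.rpow_one] at hD2
  have hm2 : (m₂ : ℝ) ≤ 2 / lam * max x 0 + E := by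
    have : x ≤ max x 0 := le_max_left _ _
    rw [hE, ← mul_add, div_mul_eq_mul_div, le_div_iff₀ hlam]
    nlinarith
  have hm2a : (m₂ : ℝ) ^ a ≤ R * (max x 0) ^ a + E ^ a := by
    calc (m₂ : ℝ) ^ a ≤ (2 / lam * max x 0 + E) ^ a :=
          Real.rpow_le_rpow (Nat.cast_nonneg _) hm2 ha.le
      _ ≤ (2 / lam * max x 0) ^ a + E ^ a :=
          Real.rpow_add_le_add_rpow (by positivity) hE0 ha.le ha1.le
      _ = R * (max x 0) ^ a + E ^ a := by
          rw [Real.mul_rpow (by positivity) (by positivity)]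
  have hgap' : (m₂ : ℝ) - m₁ ≤ 4 / lam * (m₂ : ℝ) ^ a + 2 * B / lam := by
    rw [div_mul_eq_mul_div, ← add_div, le_div_iff₀ hlam]; linarith
  have h5 : 4 / lam * (m₂ : ℝ) ^ a ≤ 4 / lam * (R * (max x 0) ^ a + E ^ a) :=
    mul_le_mul_of_nonneg_left hm2a (by positivity)
  have h6 : 0 ≤ 2 * B / lam := by positivity
  have h7 : 0 ≤ 4 / lam * R := by positivity
  have h8 : 0 ≤ 4 / lam * E ^ a := by positivity
  nlinarith [mul_nonneg h6 hxa, mul_nonneg h8 hxa]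

/-- A discrete form of integrating the derivative of `x ^ a`. Each summand belongs to a threshold `k
+ 1` not exceeding `x`, so that taking expectations turns the sum into one over tail probabilities.
-/
theorem rpow_le_one_add_sum {a : ℝ} (ha : 0 < a) (ha1 : a < 1) {x : ℝ} (hx : 0 ≤ x) :
    x ^ a ≤ 1 + ∑ k ∈ Finset.range ⌊x⌋₊, ((k : ℝ) + 1) ^ (a - 1) := by
  set n := ⌊x⌋₊ with hn
  have h1 : x ^ a ≤ (n : ℝ) ^ a + 1 := by
    calc x ^ a ≤ ((n : ℝ) + 1) ^ a := Real.rpow_le_rpow hx (Nat.lt_floor_add_one x).le ha.le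
      _ ≤ (n : ℝ) ^ a + 1 ^ a :=
        Real.rpow_add_le_add_rpow (Nat.cast_nonneg _) zero_le_one ha.le ha1.le
      _ = _ := by rw [Real.one_rpow]
  have h2 : (n : ℝ) ^ a ≤ ∑ k ∈ Finset.range n, ((k : ℝ) + 1) ^ (a - 1) := by
    rcases Nat.eq_zero_or_pos n with h0 | h0
    · simp [h0, Real.zero_rpow ha.ne']
    have hn0 : (0 : ℝ) < n := by exact_mod_cast h0
    calc (n : ℝ) ^ a = ∑ _k ∈ Finset.range n, (n : ℝ) ^ (a - 1) := by
          rw [Finset.sum_const, Finset.card_range, nsmul_eq_mul, Real.rpow_sub_one hn0.ne']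
          field_simp
      _ ≤ _ := Finset.sum_le_sum fun k hk => by
          refine Real.rpow_le_rpow_of_nonpos (by positivity) ?_ (by linarith)
          have := Finset.mem_range.1 hk
          exact_mod_cast this
  linarith

variable {Ω : Type*} [MeasurableSpace Ω] {P : Measure Ω}

/-- If the logarithm of `N` has a moment of order `a`, then the sum of the probabilities that it is
at distance at most `2 * m ^ a + B` of `m * lam` is finite. -/
theorem summable_measureReal_window [IsProbabilityMeasure P] {N : Ω → ℝ} (hN : Measurable N)
    (hN0 : ∀ ω, 0 ≤ N ω)
    {lam a b y B C₀ : ℝ} (hlam : 0 < lam) (ha : 0 < a) (hab : a < b) (hb : b < 1) (hy : 0 < y)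
    (hB : 0 ≤ B)
    (htail : ∀ k : ℕ, P.real {ω | y * Real.exp (k + 1) ≤ N ω} ≤ C₀ * ((k : ℝ) + 1) ^ (-b)) :
    Summable fun m : ℕ => P.real {ω | y * Real.exp (m * lam - 2 * (m : ℝ) ^ a - B) < N ω ∧
      N ω ≤ y * Real.exp (m * lam + 2 * (m : ℝ) ^ a + B)} := by
  obtain ⟨C, hC, hcard⟩ := exists_card_le hlam ha (hab.trans hb) hB
  set W : ℕ → Set Ω := fun m => {ω | y * Real.exp (m * lam - 2 * (m : ℝ) ^ a - B) < N ω ∧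
      N ω ≤ y * Real.exp (m * lam + 2 * (m : ℝ) ^ a + B)} with hW
  set V : ℕ → Set Ω := fun k => {ω | y * Real.exp (k + 1) ≤ N ω} with hV
  have hWm : ∀ m, MeasurableSet (W m) := fun m =>
    (measurableSet_lt measurable_const hN).inter (measurableSet_le hN measurable_const)
  have hVm : ∀ k, MeasurableSet (V k) := fun k => measurableSet_le measurable_const hN
  -- With `x = ln (N / y)`, at most of order `1 + (max x 0) ^ a` windows contain a given point. This
  -- power is bounded by a sum over the thresholds `y * e ^ (k + 1)` that `N` reaches, that is, over
  -- the events `V k`.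
  have hpt : ∀ (n : ℕ) (ω : Ω),
      (Summable fun k : ℕ => (V k).indicator (fun _ => ((k : ℝ) + 1) ^ (a - 1)) ω) ∧
      ∑ m ∈ Finset.range n, (W m).indicator (fun _ => (1 : ℝ)) ω ≤
      2 * C + C * ∑' k : ℕ, (V k).indicator (fun _ => ((k : ℝ) + 1) ^ (a - 1)) ω := by
    classical
    intro n ω
    set g : ℕ → ℝ := fun k => (V k).indicator (fun _ => ((k : ℝ) + 1) ^ (a - 1)) ω with hg
    have hg0 : ∀ k, 0 ≤ g k := fun k => Set.indicator_nonneg (fun _ _ => by positivity) _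
    set x := Real.log (N ω / y) with hx
    have hsum : ∑ m ∈ Finset.range n, (W m).indicator (fun _ => (1 : ℝ)) ω
        = (((Finset.range n).filter fun m => ω ∈ W m).card : ℝ) := by
      rw [Finset.card_filter]
      push_cast
      exact Finset.sum_congr rfl fun m _ => by simp [Set.indicator_apply]
    have hle : (((Finset.range n).filter fun m => ω ∈ W m).card : ℝ)
        ≤ C * (1 + (max x 0) ^ a) := by
      refine hcard x _ fun m hm => ?_
      obtain ⟨h1, h2⟩ := (Finset.mem_filter.1 hm).2
      have hN0 : 0 < N ω := lt_trans (by positivity) h1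
      rw [mul_comm, ← lt_div_iff₀ hy] at h1
      rw [mul_comm, ← div_le_iff₀ hy] at h2
      have h3 := (Real.lt_log_iff_exp_lt (div_pos hN0 hy)).2 h1
      have h4 := (Real.log_le_iff_le_exp (div_pos hN0 hy)).2 h2
      rw [abs_le]
      constructor <;> linarith
    have hgV : ∀ k : ℕ, k < ⌊max x 0⌋₊ → g k = ((k : ℝ) + 1) ^ (a - 1) := by
      intro k hk
      have hk1 : ((k + 1 : ℕ) : ℝ) ≤ max x 0 := (Nat.le_floor_iff (le_max_right _ _)).1 hk
      push_cast at hk1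
      have hk0 : (0 : ℝ) < k + 1 := by positivity
      have hkx : (k : ℝ) + 1 ≤ x := (le_max_iff.1 hk1).resolve_right (by linarith)
      have hpos : 0 < N ω / y := by
        refine div_pos ((hN0 ω).lt_of_ne fun h0 => ?_) hy
        rw [hx, ← h0, zero_div, Real.log_zero] at hkx
        linarith
      have : ω ∈ V k := by
        have h1 := (Real.le_log_iff_exp_le hpos).1 hkx
        rw [le_div_iff₀ hy, mul_comm] at h1
        exact h1
      simp only [hg, Set.indicator_of_mem this]
    have hgV' : ∀ k ∉ Finset.range ⌊max x 0⌋₊, g k = 0 := by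
      intro k hk
      refine Set.indicator_of_notMem (fun hmem => hk (Finset.mem_range.2 ?_)) _
      have h1 : y * Real.exp (k + 1) ≤ N ω := hmem
      rw [mul_comm, ← le_div_iff₀ hy] at h1
      have h2 := (Real.le_log_iff_exp_le ((Real.exp_pos _).trans_le h1)).2 h1
      refine Nat.le_floor ?_
      push_cast
      exact h2.trans (le_max_left _ _)
    have htsum : ∑' k, g k = ∑ k ∈ Finset.range ⌊max x 0⌋₊, ((k : ℝ) + 1) ^ (a - 1) := by
      rw [tsum_eq_sum hgV']
      exact Finset.sum_congr rfl fun k hk => hgV k (Finset.mem_range.1 hk)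
    have hr := rpow_le_one_add_sum ha (hab.trans hb) (le_max_right x 0)
    refine ⟨summable_of_ne_finset_zero hgV', ?_⟩
    rw [hsum, htsum]
    nlinarith
  have hbound : ∀ n, ∑ m ∈ Finset.range n, P (W m) ≤ ENNReal.ofReal (2 * C) +
      ENNReal.ofReal C * ∑' k : ℕ, ENNReal.ofReal (((k : ℝ) + 1) ^ (a - 1)) * P (V k) := by
    intro n
    have h1 : ∑ m ∈ Finset.range n, P (W m)
        = ∫⁻ ω, ENNReal.ofReal (∑ m ∈ Finset.range n, (W m).indicator (fun _ => (1 : ℝ)) ω) ∂P := by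
      have h2 : ∀ ω, ENNReal.ofReal (∑ m ∈ Finset.range n, (W m).indicator (fun _ => (1 : ℝ)) ω)
          = ∑ m ∈ Finset.range n, (W m).indicator 1 ω := fun ω => by
        rw [ENNReal.ofReal_sum_of_nonneg fun m _ => Set.indicator_nonneg (fun _ _ => zero_le_one) _]
        refine Finset.sum_congr rfl fun m _ => ?_
        by_cases hm : ω ∈ W m <;> simp [hm]
      simp only [h2]
      rw [lintegral_finsetSum _ fun m _ => measurable_one.indicator (hWm m)]
      exact Finset.sum_congr rfl fun m _ => (lintegral_indicator_one (hWm m)).symm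
    have h3 : ∑' k : ℕ, ENNReal.ofReal (((k : ℝ) + 1) ^ (a - 1)) * P (V k)
        = ∫⁻ ω, ∑' k : ℕ, ENNReal.ofReal ((V k).indicator (fun _ => ((k : ℝ) + 1) ^ (a - 1)) ω)
          ∂P := by
      rw [lintegral_tsum fun k => ((measurable_const.indicator (hVm k)).ennreal_ofReal).aemeasurable]
      refine tsum_congr fun k => ?_
      rw [← lintegral_indicator_const (hVm k)]
      refine lintegral_congr fun ω => ?_
      by_cases hk : ω ∈ V k <;> simp [hk]
    have hmeas : Measurable fun ω =>
        ∑' k : ℕ, ENNReal.ofReal ((V k).indicator (fun _ => ((k : ℝ) + 1) ^ (a - 1)) ω) :=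
      Measurable.tsum fun k => (measurable_const.indicator (hVm k)).ennreal_ofReal
    rw [h1, h3, ← lintegral_const_mul _ hmeas]
    calc _ ≤ ∫⁻ ω, (ENNReal.ofReal (2 * C) + ENNReal.ofReal C * ∑' k : ℕ,
            ENNReal.ofReal ((V k).indicator (fun _ => ((k : ℝ) + 1) ^ (a - 1)) ω)) ∂P := by
          refine lintegral_mono fun ω => ?_
          obtain ⟨h4, h5⟩ := hpt n ω
          refine (ENNReal.ofReal_le_ofReal h5).trans ?_
          rw [ENNReal.ofReal_add (by positivity) (mul_nonneg hC (tsum_nonneg fun k =>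
            Set.indicator_nonneg (fun _ _ => by positivity) _)), ENNReal.ofReal_mul hC,
            ENNReal.ofReal_tsum_of_nonneg (fun k =>
            Set.indicator_nonneg (fun _ _ => by positivity) _) h4]
      _ = _ := by
          rw [lintegral_add_left measurable_const, lintegral_const, measure_univ, mul_one]
  -- The terms are of order `(k + 1) ^ (a - 1 - b)`; this is where `a < b` is used.
  have hfin : ∑' k : ℕ, ENNReal.ofReal (((k : ℝ) + 1) ^ (a - 1)) * P (V k) ≠ ⊤ := by
    have hs : Summable fun k : ℕ => C₀ * (((k : ℝ) + 1) ^ (a - 1 - b)) := by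
      refine Summable.mul_left _ ?_
      have := (summable_nat_add_iff 1).2
        (Real.summable_nat_rpow.2 (show a - 1 - b < -1 by linarith))
      simpa using this
    refine ne_top_of_le_ne_top hs.tsum_ofReal_ne_top (ENNReal.tsum_le_tsum fun k => ?_)
    have hk : (0 : ℝ) < k + 1 := by positivity
    rw [← ofReal_measureReal, ← ENNReal.ofReal_mul (by positivity)]
    refine ENNReal.ofReal_le_ofReal ?_
    calc ((k : ℝ) + 1) ^ (a - 1) * P.real (V k)
        ≤ ((k : ℝ) + 1) ^ (a - 1) * (C₀ * ((k : ℝ) + 1) ^ (-b)) := by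
          gcongr; exact htail k
      _ = C₀ * ((k : ℝ) + 1) ^ (a - 1 - b) := by
          rw [sub_eq_add_neg (a - 1), Real.rpow_add hk]; ring
  refine ENNReal.summable_toReal (f := fun m => P (W m)) ?_
  refine ne_top_of_le_ne_top ?_ (ENNReal.tsum_le_of_sum_range_le hbound)
  exact ENNReal.add_ne_top.2 ⟨ENNReal.ofReal_ne_top, ENNReal.mul_ne_top ENNReal.ofReal_ne_top hfin⟩

end

/-! ### Survival products for polynomially decaying tails -/

section

variable {Ω : Type*} [MeasurableSpace Ω] {P : Measure Ω}

/-- The distribution function of a real random variable. -/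
def distFun (P : Measure Ω) (N : Ω → ℝ) (x : ℝ) : ℝ := P.real {ω | N ω ≤ x}

theorem distFun_nonneg (N : Ω → ℝ) (x : ℝ) : 0 ≤ distFun P N x := measureReal_nonneg

theorem distFun_le_one [IsProbabilityMeasure P] (N : Ω → ℝ) (x : ℝ) : distFun P N x ≤ 1 :=
  measureReal_le_one

theorem distFun_mono [IsProbabilityMeasure P] (N : Ω → ℝ) : Monotone (distFun P N) :=
  fun _ _ h => measureReal_mono fun _ hω => le_trans hω h

theorem one_sub_distFun [IsProbabilityMeasure P] {N : Ω → ℝ} (hN : Measurable N) (x : ℝ) :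
    1 - distFun P N x = P.real {ω | x < N ω} := by
  have h := probReal_add_probReal_compl (μ := P) (measurableSet_le hN (measurable_const (a := x)))
  have h2 : {ω | N ω ≤ x}ᶜ = {ω | x < N ω} := by ext; simp
  rw [h2] at h
  rw [distFun]
  linarith

theorem distFun_sub_le [IsProbabilityMeasure P] {N : Ω → ℝ} {x x' : ℝ} :
    distFun P N x' - distFun P N x ≤ P.real {ω | x < N ω ∧ N ω ≤ x'} := by
  have h : {ω | N ω ≤ x'} ⊆ {ω | N ω ≤ x} ∪ {ω | x < N ω ∧ N ω ≤ x'} := fun ω hω => by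
    rcases le_or_gt (N ω) x with h | h
    · exact Or.inl h
    · exact Or.inr ⟨h, hω⟩
  have h1 := (measureReal_mono (μ := P) h).trans (measureReal_union_le _ _)
  simp only [distFun]
  linarith

/-- `p_n = ∏_{m < n} F(y e^{m lam})`. -/
def survProd (F : ℝ → ℝ) (lam y : ℝ) (n : ℕ) : ℝ :=
  ∏ m ∈ Finset.range n, F (y * Real.exp (m * lam))

/-- Deviations `δ k` of `S_k` from `k * lam` that are negligible for the products of the values of
`F` along `e^{S_k}`, which decay at rate `π`. -/
structure UpperRate (F : ℝ → ℝ) (lam y : ℝ) (δ π : ℕ → ℝ) : Prop where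
  nonneg : ∀ k, 0 ≤ δ k
  mono : Monotone δ
  summable_exp : Summable fun k => Real.exp (-δ k)
  le_half : ∃ B : ℝ, ∀ k : ℕ, δ k ≤ lam * k / 2 + B
  pos : ∀ n, 0 < π n
  prod_le : ∀ B : ℝ, 0 ≤ B → ∃ C : ℝ, ∀ J n : ℕ,
    ∏ k ∈ Finset.Ico (J + 1) n, F (y * Real.exp (k * lam + 2 * δ k + B)) ≤ C * (π n / π J)
  summable_dev : ∀ c : ℝ, 0 < c → ∀ M : ℕ,
    Summable fun j : ℕ => Real.exp (-(c * δ j ^ 2 / j)) / π (M * j)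

/-- For large `k` the shift `B` is absorbed by replacing `μ * (k + 1)` by its half; the finitely
many small `k` are covered by the constant `D ^ β`. -/
theorem exists_tail_le [IsProbabilityMeasure P] {N : Ω → ℝ} {β : ℝ} (hβ : 0 < β)
    (h : Tendsto (fun x : ℝ => x ^ β * P.real {ω | Real.exp x < N ω}) atTop (𝓝 0)) {μ : ℝ}
    (hμ : 0 < μ) (B : ℝ) :
    ∃ C : ℝ, 0 ≤ C ∧ ∀ k : ℕ,
      P.real {ω | Real.exp (μ * (k + 1) - B) < N ω} ≤ C * ((k : ℝ) + 1) ^ (-β) := by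
  obtain ⟨x₀, hx₀⟩ := eventually_atTop.1 (h.eventually (eventually_le_nhds zero_lt_one))
  set D := max (|B| * 2 / μ) (max x₀ 1 * 2 / μ) with hD
  have hD0 : 0 < D := lt_max_of_lt_right (by positivity)
  refine ⟨max (D ^ β) ((μ / 2) ^ (-β)), le_max_of_le_left (by positivity), fun k => ?_⟩
  have hk : (0 : ℝ) < k + 1 := by positivity
  rcases lt_or_ge ((k : ℝ) + 1) D with hlt | hge
  · refine measureReal_le_one.trans ?_
    calc (1 : ℝ) = ((k : ℝ) + 1) ^ β * ((k : ℝ) + 1) ^ (-β) := by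
          rw [← Real.rpow_add hk, add_neg_cancel, Real.rpow_zero]
      _ ≤ D ^ β * ((k : ℝ) + 1) ^ (-β) := by gcongr
      _ ≤ _ := by gcongr; exact le_max_left _ _
  · have h1 : |B| ≤ μ * (k + 1) / 2 := by
      have := (le_max_left _ _).trans hge
      rw [div_le_iff₀ hμ] at this
      linarith
    have h2 : max x₀ 1 ≤ μ * (k + 1) / 2 := by
      have := (le_max_right _ _).trans hge
      rw [div_le_iff₀ hμ] at this
      linarith
    have h3 : μ * (k + 1) / 2 ≤ μ * (k + 1) - B := by linarith [le_abs_self B]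
    have hpos : 0 < μ * (k + 1) / 2 := by positivity
    have h4 := hx₀ _ ((le_max_left _ _).trans h2)
    calc P.real {ω | Real.exp (μ * (k + 1) - B) < N ω}
        ≤ P.real {ω | Real.exp (μ * (k + 1) / 2) < N ω} :=
          measureReal_mono fun ω hω => lt_of_le_of_lt (Real.exp_le_exp.2 h3) hω
      _ ≤ (μ * (k + 1) / 2) ^ (-β) := by
          rw [Real.rpow_neg hpos.le, ← one_div, le_div_iff₀ (by positivity), mul_comm]
          exact h4
      _ = (μ / 2) ^ (-β) * ((k : ℝ) + 1) ^ (-β) := by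
          rw [← Real.mul_rpow (by positivity) hk.le]; congr 1; ring
      _ ≤ _ := by gcongr; exact le_max_right _ _

section Tail

variable [IsProbabilityMeasure P] {N : Ω → ℝ} {β lam y : ℝ}

theorem survProd_pos (hlam : 0 < lam) (hy : 0 < y) (hf : 0 < distFun P N y) (n : ℕ) :
    0 < survProd (distFun P N) lam y n :=
  Finset.prod_pos fun m _ => hf.trans_le (distFun_mono N
    (le_mul_of_one_le_right hy.le (Real.one_le_exp (by positivity))))

theorem survProd_antitone : Antitone (survProd (distFun P N) lam y) :=
  antitone_nat_of_succ_le fun n => by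
    rw [survProd, survProd, Finset.prod_range_succ]
    exact mul_le_of_le_one_right (Finset.prod_nonneg fun m _ => distFun_nonneg _ _)
      (distFun_le_one _ _)

/-- All factors are at least `f`, so the negative logarithm of the product is at most the sum of the
tails divided by `f`. The `k`-th tail is of order `(k + 1) ^ (-β)`, which for `k < n` is at most `(n
+ 1) ^ θ * (k + 1) ^ (-(β + θ))`, and the last power is summable since `β + θ > 1`. -/
theorem exists_inv_survProd_le (hN : Measurable N) (hlam : 0 < lam) (hy : 0 < y)
    (hf : 0 < distFun P N y) (hβ : 0 < β) {θ : ℝ} (hθ : 0 ≤ θ) (hβθ : 1 < β + θ)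
    (h : Tendsto (fun x : ℝ => x ^ β * P.real {ω | Real.exp x < N ω}) atTop (𝓝 0)) :
    ∃ C : ℝ, ∀ n : ℕ, (survProd (distFun P N) lam y n)⁻¹ ≤ Real.exp (C + C * (n : ℝ) ^ θ) := by
  obtain ⟨C₁, hC₁, htail⟩ := exists_tail_le hβ h hlam (-Real.log y)
  set f := distFun P N y with hf'
  have hs : Summable fun k : ℕ => ((k : ℝ) + 1) ^ (-(β + θ)) := by
    have := (summable_nat_add_iff 1).2
      (Real.summable_nat_rpow.2 (show -(β + θ) < -1 by linarith))
    simpa using this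
  set s₀ := ∑' k : ℕ, ((k : ℝ) + 1) ^ (-(β + θ)) with hs₀
  have hs0 : 0 ≤ s₀ := tsum_nonneg fun k => by positivity
  have hsum : ∀ n : ℕ, ∑ m ∈ Finset.range n, (1 - distFun P N (y * Real.exp (m * lam)))
      ≤ 1 + C₁ * s₀ * (n : ℝ) ^ θ := by
    intro n
    cases n with
    | zero => simp only [Finset.range_zero, Finset.sum_empty]; positivity
    | succ n =>
      rw [Finset.sum_range_succ', add_comm]
      refine add_le_add (by linarith [distFun_nonneg (P := P) N (y * Real.exp ((0 : ℕ) * lam))]) ?_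
      calc ∑ k ∈ Finset.range n, (1 - distFun P N (y * Real.exp ((k + 1 : ℕ) * lam)))
          ≤ ∑ k ∈ Finset.range n, C₁ * (((n + 1 : ℕ) : ℝ) ^ θ * ((k : ℝ) + 1) ^ (-(β + θ))) := by
            refine Finset.sum_le_sum fun k hk => ?_
            rw [one_sub_distFun hN]
            have h1 := htail k
            have h2 : Real.exp (lam * (k + 1) - -Real.log y)
                = y * Real.exp ((k + 1 : ℕ) * lam) := by
              rw [sub_neg_eq_add, Real.exp_add, Real.exp_log hy]; push_cast; ring_nf
            rw [h2] at h1
            refine h1.trans (mul_le_mul_of_nonneg_left ?_ hC₁)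
            have hk0 : (0 : ℝ) < k + 1 := by positivity
            have hkn : (k : ℝ) + 1 ≤ ((n + 1 : ℕ) : ℝ) := by
              have := Finset.mem_range.1 hk
              push_cast
              have : (k : ℝ) ≤ n := by exact_mod_cast this.le
              linarith
            calc ((k : ℝ) + 1) ^ (-β) = ((k : ℝ) + 1) ^ θ * ((k : ℝ) + 1) ^ (-(β + θ)) := by
                  rw [← Real.rpow_add hk0]; congr 1; ring
              _ ≤ _ := by gcongr
        _ = C₁ * ((n + 1 : ℕ) : ℝ) ^ θ * ∑ k ∈ Finset.range n, ((k : ℝ) + 1) ^ (-(β + θ)) := by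
            rw [Finset.mul_sum]; exact Finset.sum_congr rfl fun k _ => by ring
        _ ≤ C₁ * ((n + 1 : ℕ) : ℝ) ^ θ * s₀ := by
            gcongr
            exact hs.sum_le_tsum _ fun k _ => by positivity
        _ = _ := by ring
  refine ⟨max (1 / f) (C₁ * s₀ / f), fun n => ?_⟩
  have hp : ∀ m : ℕ, f ≤ distFun P N (y * Real.exp (m * lam)) := fun m =>
    distFun_mono N (le_mul_of_one_le_right hy.le (Real.one_le_exp (by positivity)))
  have h1 : Real.exp (-((∑ m ∈ Finset.range n, (1 - distFun P N (y * Real.exp (m * lam)))) / f))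
      ≤ survProd (distFun P N) lam y n := by
    rw [Finset.sum_div, ← Finset.sum_neg_distrib, Real.exp_sum, survProd]
    refine Finset.prod_le_prod (fun m _ => (Real.exp_pos _).le) fun m _ => ?_
    set x := distFun P N (y * Real.exp (m * lam)) with hx
    have hx0 : 0 < x := hf.trans_le (hp m)
    have h2 := Real.one_sub_inv_le_log_of_pos hx0
    rw [← Real.le_log_iff_exp_le hx0]
    refine le_trans ?_ h2
    have h3 : (1 - x) / x ≤ (1 - x) / f :=
      div_le_div_of_nonneg_left (by linarith [distFun_le_one (P := P) N (y * Real.exp (m * lam))])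
        hf (hp m)
    have h4 : 1 - x⁻¹ = -((1 - x) / x) := by field_simp; ring
    linarith
  calc (survProd (distFun P N) lam y n)⁻¹
      ≤ (Real.exp (-((∑ m ∈ Finset.range n,
        (1 - distFun P N (y * Real.exp (m * lam)))) / f)))⁻¹ :=
        inv_anti₀ (Real.exp_pos _) h1
    _ = Real.exp ((∑ m ∈ Finset.range n, (1 - distFun P N (y * Real.exp (m * lam)))) / f) := by
        rw [Real.exp_neg, inv_inv]
    _ ≤ _ := by
        refine Real.exp_le_exp.2 ?_
        calc _ ≤ (1 + C₁ * s₀ * (n : ℝ) ^ θ) / f := by gcongr; exact hsum n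
          _ = 1 / f + C₁ * s₀ / f * (n : ℝ) ^ θ := by ring
          _ ≤ _ := by gcongr <;> first | exact le_max_left _ _ | exact le_max_right _ _

/-- Under the first alternative of (REG), deviations of order `k ^ a` with a suitable `a < 1` are
negligible. -/
theorem exists_rate_of_tail (hN : Measurable N) (hN0 : ∀ ω, 0 ≤ N ω) (hlam : 0 < lam) (hy : 0 < y)
    (hf : 0 < distFun P N y) (hβ : 2 / 3 < β) (hβ1 : β < 1)
    (h : Tendsto (fun x : ℝ => x ^ β * P.real {ω | Real.exp x < N ω}) atTop (𝓝 0)) :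
    ∃ δ : ℕ → ℝ, UpperRate (distFun P N) lam y δ (survProd (distFun P N) lam y) ∧
      ∀ B : ℝ, 0 ≤ B → ∃ c : ℝ, 0 < c ∧ ∀ n, c * survProd (distFun P N) lam y n ≤
        ∏ m ∈ Finset.range n, distFun P N (max y (y * Real.exp (m * lam - 2 * δ m - B))) := by
  -- The windows require `a < β`. Deviations of size `k ^ a` have probability about `exp (-c * k ^
  -- (2 * a - 1)) = exp (-c * k ^ (β / 2))`, which has to beat the inverse of the survival product,
  -- at most `exp (C + C * k ^ θ)` with `θ = 1 / 2 - β / 4`. The conditions `a < β`, `β + θ > 1` and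
  -- `θ < β / 2` are each equivalent to `β > 2 / 3`.
  set a := 1 / 2 + β / 4 with ha
  set F := distFun P N with hF
  have ha0 : 0 < a := by linarith
  have hab : a < β := by linarith
  have ha1 : a < 1 := by linarith
  obtain ⟨C₀, hC₀, htail⟩ := exists_tail_le (by linarith) h one_pos (1 - Real.log y)
  have htail' : ∀ k : ℕ, P.real {ω | y * Real.exp (k + 1) ≤ N ω} ≤ C₀ * ((k : ℝ) + 1) ^ (-β) := by
    refine fun k => le_trans (measureReal_mono ?_) (htail k)
    refine fun ω (hω : _ ≤ N ω) => lt_of_lt_of_le ?_ hω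
    have : Real.exp (1 * ((k : ℝ) + 1) - (1 - Real.log y)) = y * Real.exp k := by
      rw [show 1 * ((k : ℝ) + 1) - (1 - Real.log y) = Real.log y + k by ring, Real.exp_add,
        Real.exp_log hy]
    rw [this]
    exact mul_lt_mul_of_pos_left (Real.exp_lt_exp.2 (by linarith)) hy
  have hwin := fun (B : ℝ) (hB : 0 ≤ B) =>
    summable_measureReal_window hN hN0 hlam ha0 hab hβ1 hy hB htail'
  have hfm : ∀ m : ℕ, F y ≤ F (y * Real.exp (m * lam)) := fun m =>
    distFun_mono N (le_mul_of_one_le_right hy.le (Real.one_le_exp (by positivity)))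
  have hppos := survProd_pos hlam hy hf
  refine ⟨fun k => (k : ℝ) ^ a, ⟨fun k => by positivity, fun m n hmn => ?_, ?_, ?_, hppos,
    fun B hB => ?_, fun c hc M => ?_⟩, fun B hB => ?_⟩
  · exact Real.rpow_le_rpow (Nat.cast_nonneg _) (by exact_mod_cast hmn) ha0.le
  · simpa using summable_exp_neg_rpow one_pos ha0
  · obtain ⟨D, _, hD⟩ := exists_rpow_le ha0.le ha1 (half_pos hlam)
    refine ⟨D, fun k => (hD k (Nat.cast_nonneg k)).trans (le_of_eq ?_)⟩
    rw [Real.rpow_one]; ring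
  · obtain ⟨C, hC, hprod⟩ := exists_prod_le_mul_prod (u := fun m : ℕ => F (y * Real.exp (m * lam)))
      (v := fun m : ℕ => F (y * Real.exp (m * lam + 2 * (m : ℝ) ^ a + B))) hf hfm
      (fun m => distFun_mono N (by gcongr; linarith [show (0 : ℝ) ≤ (m : ℝ) ^ a by positivity]))
      (Summable.of_nonneg_of_le (fun m => sub_nonneg.2 (distFun_mono N (by
          gcongr; linarith [show (0 : ℝ) ≤ (m : ℝ) ^ a by positivity])))
        (fun m => distFun_sub_le.trans (by
          exact measureReal_mono fun ω hω => ⟨lt_of_le_of_lt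
            (by gcongr; linarith [show (0 : ℝ) ≤ (m : ℝ) ^ a by positivity]) hω.1, hω.2⟩))
        (hwin B hB))
    -- The product starts at `J + 1`, whereas the ratio of the survival products also contains the
    -- factor with index `J`, which is at least `F y`.
    refine ⟨C * (F y)⁻¹, fun J n => (hprod _).trans ?_⟩
    rw [mul_assoc]
    refine mul_le_mul_of_nonneg_left ?_ (by linarith)
    rw [← div_eq_inv_mul, div_div, le_div_iff₀ (mul_pos (hppos J) hf)]
    rcases Nat.lt_or_ge J n with hJ | hJ
    · have h1 : survProd F lam y n = survProd F lam y (J + 1) *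
          ∏ k ∈ Finset.Ico (J + 1) n, F (y * Real.exp (k * lam)) :=
        (Finset.prod_range_mul_prod_Ico _ hJ).symm
      have h2 : survProd F lam y J * F y ≤ survProd F lam y (J + 1) := by
        rw [survProd, survProd, Finset.prod_range_succ]
        exact mul_le_mul_of_nonneg_left (hfm J) (hppos J).le
      rw [h1, mul_comm]
      exact mul_le_mul_of_nonneg_right h2 (Finset.prod_nonneg fun k _ => distFun_nonneg _ _)
    · rw [Finset.Ico_eq_empty (by omega), Finset.prod_empty, one_mul]
      exact (mul_le_of_le_one_right (hppos J).le (distFun_le_one _ _)).trans (survProd_antitone hJ)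
  · obtain ⟨C, hC⟩ := exists_inv_survProd_le hN hlam hy hf (by linarith)
      (θ := 1 / 2 - β / 4) (by linarith) (by linarith) h
    refine Summable.of_nonneg_of_le (fun j => div_nonneg (Real.exp_pos _).le (hppos _).le)
      (fun j => ?_) ((summable_exp_add_rpow (C := C * (M : ℝ) ^ (1 / 2 - β / 4)) hc
        (show (0 : ℝ) ≤ 1 / 2 - β / 4 by linarith)
        (show 1 / 2 - β / 4 < β / 2 by linarith)).mul_left (Real.exp C))
    have h1 : c * ((j : ℝ) ^ a) ^ 2 / j = c * (j : ℝ) ^ (β / 2) := by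
      rcases Nat.eq_zero_or_pos j with rfl | hj
      · rw [Nat.cast_zero, div_zero, Real.zero_rpow (by linarith), mul_zero]
      · have hj' : (0 : ℝ) < j := by exact_mod_cast hj
        rw [mul_div_assoc, ← Real.rpow_natCast, ← Real.rpow_mul hj'.le, ← Real.rpow_sub_one hj'.ne']
        congr 2
        rw [ha]; push_cast; ring
    rw [h1, div_eq_mul_inv, ← Real.exp_add]
    refine (mul_le_mul_of_nonneg_left (hC (M * j)) (Real.exp_pos _).le).trans (le_of_eq ?_)
    rw [← Real.exp_add]
    congr 1
    push_cast
    rw [Real.mul_rpow (Nat.cast_nonneg _) (Nat.cast_nonneg _)]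
    ring
  -- Cutting the lowered thresholds off at `y` keeps every factor at least `F y`, as the comparison
  -- of products needs.
  · obtain ⟨C, hC, hprod⟩ := exists_prod_le_mul_prod (v := fun m : ℕ => F (y * Real.exp (m * lam)))
      (u := fun m : ℕ => F (max y (y * Real.exp (m * lam - 2 * (m : ℝ) ^ a - B)))) hf
      (fun m => distFun_mono N (le_max_left _ _))
      (fun m => distFun_mono N (max_le
        (le_mul_of_one_le_right hy.le (Real.one_le_exp (by positivity)))
        (by gcongr; linarith [show (0 : ℝ) ≤ (m : ℝ) ^ a by positivity])))
      (Summable.of_nonneg_of_le (fun m => sub_nonneg.2 (distFun_mono N (max_le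
        (le_mul_of_one_le_right hy.le (Real.one_le_exp (by positivity)))
        (by gcongr; linarith [show (0 : ℝ) ≤ (m : ℝ) ^ a by positivity]))))
        (fun m => distFun_sub_le.trans (by
          exact measureReal_mono fun ω hω => ⟨lt_of_le_of_lt (le_max_right _ _) hω.1,
            hω.2.trans (by gcongr; linarith [show (0 : ℝ) ≤ (m : ℝ) ^ a by positivity])⟩))
        (hwin B hB))
    refine ⟨C⁻¹, by positivity, fun n => ?_⟩
    rw [inv_mul_le_iff₀ (by positivity)]
    exact hprod (Finset.range n)

end Tail

end

/-! ### Survival products for heavy tails -/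

section

variable {Ω : Type*} [MeasurableSpace Ω] {P : Measure Ω}

/-- A product of factors that are eventually bounded by the ratios of `(k + 1) ^ (-s)`. -/
theorem exists_prod_Ico_le_rpow {v : ℕ → ℝ} {s : ℝ} (hs : 0 ≤ s) (hv0 : ∀ k, 0 ≤ v k)
    (hv1 : ∀ k, v k ≤ 1) {k₀ : ℕ} (hv : ∀ k, k₀ ≤ k → 1 ≤ k → v k ≤ Real.exp (-(s / k))) :
    ∃ C : ℝ, ∀ J n : ℕ, ∏ k ∈ Finset.Ico (J + 1) n, v k ≤
      C * (((n : ℝ) + 1) ^ (-s) / ((J : ℝ) + 1) ^ (-s)) := by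
  have hpow : ∀ k : ℕ, (2 : ℝ) ^ (-s) * ((k : ℝ) + 1) ^ (-s) ≤ ((k : ℝ) + 1 + 1) ^ (-s) := by
    intro k
    rw [← Real.mul_rpow (by norm_num) (by positivity)]
    exact Real.rpow_le_rpow_of_nonpos (by positivity)
      (by nlinarith [Nat.cast_nonneg (α := ℝ) k]) (by linarith)
  have hexp : ∀ k : ℕ, 1 ≤ k → Real.exp (-(s / k)) * (k : ℝ) ^ (-s) ≤ ((k : ℝ) + 1) ^ (-s) := by
    intro k hk
    have hk0 : (0 : ℝ) < k := by exact_mod_cast hk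
    have h1 : Real.log ((k + 1 : ℝ) / k) ≤ 1 / k := by
      refine (Real.log_le_sub_one_of_pos (by positivity)).trans (le_of_eq ?_)
      field_simp; ring
    rw [Real.log_div (by positivity) hk0.ne'] at h1
    rw [Real.rpow_def_of_pos hk0, Real.rpow_def_of_pos (by positivity), ← Real.exp_add]
    refine Real.exp_le_exp.2 ?_
    have := mul_le_mul_of_nonneg_left h1 hs
    have h2 : s * (1 / k) = s / k := by ring
    nlinarith
  set D : ℝ := 2 ^ s with hD
  have hD1 : 1 ≤ D := Real.one_le_rpow one_le_two hs
  have hD' : (2 : ℝ) ^ (-s) = D⁻¹ := Real.rpow_neg zero_le_two s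
  rw [hD'] at hpow
  have hstep : ∀ k : ℕ, 1 ≤ k →
      v k ≤ (if k < k₀ then D else 1) * (((k : ℝ) + 1) ^ (-s) / (k : ℝ) ^ (-s)) := by
    intro k hk
    have hk0 : (0 : ℝ) < k := by exact_mod_cast hk
    have hkp : 0 < (k : ℝ) ^ (-s) := by positivity
    rw [← mul_div_assoc, le_div_iff₀ hkp]
    split_ifs with hlt
    · obtain ⟨m, rfl⟩ : ∃ m, k = m + 1 := ⟨k - 1, by omega⟩
      have h1 := hpow m
      rw [inv_mul_le_iff₀ (by positivity)] at h1
      push_cast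
      refine le_trans ?_ h1
      exact mul_le_of_le_one_left (by positivity) (hv1 _)
    · rw [one_mul]
      exact (mul_le_mul_of_nonneg_right (hv k (not_lt.1 hlt) hk) hkp.le).trans (hexp k hk)
  have htel : ∀ J n : ℕ, J < n →
      ∏ k ∈ Finset.Ico (J + 1) n, (((k : ℝ) + 1) ^ (-s) / (k : ℝ) ^ (-s))
        = (n : ℝ) ^ (-s) / ((J : ℝ) + 1) ^ (-s) := by
    intro J n hJ
    induction n, hJ using Nat.le_induction with
    | base =>
      simp only [Nat.succ_eq_add_one, Finset.Ico_self, Finset.prod_empty]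
      push_cast
      rw [div_self (by positivity)]
    | succ n hn ih =>
      have hn0 : (0 : ℝ) < n := by
        have : 0 < n := by omega
        exact_mod_cast this
      rw [Finset.prod_Ico_succ_top hn, ih]
      have : (n : ℝ) ^ (-s) ≠ 0 := by positivity
      push_cast
      field_simp
  -- For `k < k₀` only `v k ≤ 1` is known, and the ratio of consecutive powers is at least `D⁻¹`;
  -- this costs `D` for each of at most `k₀` indices. The last `D` replaces `n` by `n + 1` in the
  -- telescoped quotient.
  refine ⟨D ^ k₀ * D, fun J n => ?_⟩
  have hDk : 1 ≤ D ^ k₀ := one_le_pow₀ hD1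
  rcases Nat.lt_or_ge J n with hJ | hJ
  · calc ∏ k ∈ Finset.Ico (J + 1) n, v k
        ≤ ∏ k ∈ Finset.Ico (J + 1) n,
          ((if k < k₀ then D else 1) * (((k : ℝ) + 1) ^ (-s) / (k : ℝ) ^ (-s))) :=
          Finset.prod_le_prod (fun k _ => hv0 k) fun k hk => hstep k
            (by have := (Finset.mem_Ico.1 hk).1; omega)
      _ = (∏ k ∈ Finset.Ico (J + 1) n, if k < k₀ then D else 1) *
          ((n : ℝ) ^ (-s) / ((J : ℝ) + 1) ^ (-s)) := by
          rw [Finset.prod_mul_distrib, htel J n hJ]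
      _ ≤ D ^ k₀ * (D * ((n : ℝ) + 1) ^ (-s) / ((J : ℝ) + 1) ^ (-s)) := by
          refine mul_le_mul ?_ ?_ (by positivity) (by positivity)
          · rw [← Finset.prod_filter, Finset.prod_const]
            refine pow_le_pow_right₀ hD1 ?_
            calc _ ≤ (Finset.range k₀).card := Finset.card_le_card fun k hk =>
                  Finset.mem_range.2 (Finset.mem_filter.1 hk).2
              _ = k₀ := Finset.card_range k₀
          · refine div_le_div_of_nonneg_right ?_ (by positivity)
            obtain ⟨m, rfl⟩ : ∃ m, n = m + 1 := ⟨n - 1, by omega⟩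
            have h1 := hpow m
            rw [inv_mul_le_iff₀ (by positivity)] at h1
            push_cast
            exact h1
      _ = _ := by ring
  · rw [Finset.Ico_eq_empty (by omega), Finset.prod_empty]
    have h1 : 1 ≤ ((n : ℝ) + 1) ^ (-s) / ((J : ℝ) + 1) ^ (-s) := by
      rw [one_le_div (by positivity)]
      refine Real.rpow_le_rpow_of_nonpos (by positivity) ?_ (by linarith)
      have : (n : ℝ) ≤ J := by exact_mod_cast hJ
      linarith
    have h2 : 1 ≤ D ^ k₀ * D := one_le_mul_of_one_le_of_one_le hDk hD1
    exact one_le_mul_of_one_le_of_one_le h2 h1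

/-- Under the second alternative of (REG), linear deviations are negligible. -/
theorem exists_rate_of_heavy_tail [IsProbabilityMeasure P] {N : Ω → ℝ} (hN : Measurable N)
    {lam y q : ℝ} (hlam : 0 < lam) (hy : 0 < y) (hq : lam < q)
    (h : ∀ᶠ x : ℝ in atTop, q ≤ x * P.real {ω | Real.exp x < N ω}) :
    ∃ δ π : ℕ → ℝ, UpperRate (distFun P N) lam y δ π ∧ Summable π ∧
      Summable (survProd (distFun P N) lam y) := by
  set F := distFun P N with hF
  -- The first bound makes `δ k = ε * k` at most `lam * k / 2`. The second makes `lam + 3 * ε < q`,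
  -- hence `s > 1`. In `3 * ε`, two parts come from `2 * δ k`, and the third absorbs `B` and `ln y`
  -- for large `k`.
  set ε := min (lam / 2) ((q - lam) / 6) with hε
  have hε0 : 0 < ε := lt_min (by linarith) (by linarith)
  have hε1 : ε ≤ lam / 2 := min_le_left _ _
  have hε2 : ε ≤ (q - lam) / 6 := min_le_right _ _
  set s := q / (lam + 3 * ε) with hs
  have hs1 : 1 < s := by rw [hs, one_lt_div (by linarith)]; linarith
  obtain ⟨x₀, hx₀⟩ := eventually_atTop.1 h
  set π : ℕ → ℝ := fun n => ((n : ℝ) + 1) ^ (-s) with hπ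
  have hπ0 : ∀ n, 0 < π n := fun n => by positivity
  have hprod : ∀ B : ℝ, 0 ≤ B → ∃ C : ℝ, ∀ J n : ℕ,
      ∏ k ∈ Finset.Ico (J + 1) n, F (y * Real.exp (k * lam + 2 * (ε * k) + B)) ≤
        C * (π n / π J) := by
    intro B hB
    obtain ⟨k₀, hk₀⟩ := exists_nat_ge (max ((B + |Real.log y|) / ε) (max x₀ 0 / lam))
    refine exists_prod_Ico_le_rpow (k₀ := k₀) (by linarith) (fun k => distFun_nonneg _ _)
      (fun k => distFun_le_one _ _) fun k hk hk1 => ?_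
    have hk0 : (0 : ℝ) < k := by exact_mod_cast hk1
    have hkk : (k₀ : ℝ) ≤ k := by exact_mod_cast hk
    have h1 := ((le_max_left _ _).trans hk₀).trans hkk
    have h2 := ((le_max_right _ _).trans hk₀).trans hkk
    rw [div_le_iff₀ hε0] at h1
    rw [div_le_iff₀ hlam] at h2
    set x := (lam + 3 * ε) * k with hx
    have hx1 : x₀ ≤ x := by
      have := le_max_left x₀ 0
      nlinarith [mul_pos hε0 hk0]
    have hx2 : y * Real.exp (k * lam + 2 * (ε * k) + B) ≤ Real.exp x := by
      rw [← Real.exp_log hy, ← Real.exp_add, Real.exp_le_exp]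
      have := le_abs_self (Real.log y)
      nlinarith
    have hx0 : 0 < x := by positivity
    have h3 := hx₀ x hx1
    rw [← one_sub_distFun hN] at h3
    have h4 : F (Real.exp x) ≤ 1 - s / k := by
      have h5 : s / k = q / x := by rw [hs, hx, div_div]
      rw [h5]
      have h6 : q / x ≤ 1 - F (Real.exp x) := by rw [div_le_iff₀ hx0]; linarith
      linarith
    refine (distFun_mono N hx2).trans (h4.trans ?_)
    have := Real.add_one_le_exp (-(s / k))
    linarith
  have hπs : Summable π := by
    have := (summable_nat_add_iff 1).2 (Real.summable_nat_rpow.2 (show -s < -1 by linarith))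
    simpa [hπ] using this
  refine ⟨fun k => ε * k, π, ⟨fun k => by positivity, fun m n hmn => ?_, ?_, ⟨0, fun k => ?_⟩, hπ0,
    hprod, fun c hc M => ?_⟩, hπs, ?_⟩
  · have : (m : ℝ) ≤ n := by exact_mod_cast hmn
    gcongr
  · simpa using summable_exp_neg_rpow hε0 one_pos
  · have := mul_le_mul_of_nonneg_right hε1 (Nat.cast_nonneg (α := ℝ) k)
    linarith
  · refine Summable.of_nonneg_of_le (fun j => div_nonneg (Real.exp_pos _).le (hπ0 _).le)
      (fun j => ?_) ((summable_exp_add_rpow (c := c * ε ^ 2) (C := s * (M + 2)) (by positivity)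
        (show (0 : ℝ) ≤ 1 / 2 by norm_num) (show (1 / 2 : ℝ) < 1 by norm_num)).mul_left (Real.exp s))
    have h1 : c * (ε * j) ^ 2 / j = c * ε ^ 2 * (j : ℝ) ^ (1 : ℝ) := by
      rcases Nat.eq_zero_or_pos j with rfl | hj
      · simp
      · have hj' : (0 : ℝ) < j := by exact_mod_cast hj
        rw [Real.rpow_one]; field_simp
    simp only [h1, hπ]
    rw [Real.rpow_neg (by positivity), div_inv_eq_mul, Real.exp_add, mul_left_comm]
    refine mul_le_mul_of_nonneg_left ?_ (Real.exp_pos _).le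
    rw [← Real.exp_add, Real.rpow_def_of_pos (by positivity)]
    refine Real.exp_le_exp.2 ?_
    have hj0 : (0 : ℝ) ≤ (j : ℝ) ^ (1 / 2 : ℝ) := by positivity
    have hjj : (j : ℝ) = (j : ℝ) ^ (1 / 2 : ℝ) * (j : ℝ) ^ (1 / 2 : ℝ) := by
      rw [← Real.sqrt_eq_rpow, Real.mul_self_sqrt (Nat.cast_nonneg j)]
    set r := (j : ℝ) ^ (1 / 2 : ℝ) with hr
    have hM0 : (0 : ℝ) ≤ M := Nat.cast_nonneg M
    -- The inverse of the rate grows only polynomially. Bounding the logarithm by a multiple of the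
    -- square root brings it into the form required by `summable_exp_add_rpow`.
    have h2 : Real.log (((M * j : ℕ) : ℝ) + 1) ≤ 1 + (M + 2) * r := by
      have h3 : ((M * j : ℕ) : ℝ) + 1 ≤ Real.exp ((M + 1) * r) * Real.exp r := by
        have h4 := Real.add_one_le_exp ((M + 1) * r)
        have h5 := Real.add_one_le_exp r
        push_cast
        rw [hjj]
        have h6 : 0 ≤ (M + 1) * r := by positivity
        calc (M : ℝ) * (r * r) + 1 ≤ ((M + 1) * r + 1) * (r + 1) := by nlinarith [mul_nonneg hM0 hj0]
          _ ≤ _ := mul_le_mul h4 h5 (by positivity) (Real.exp_pos _).le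
      rw [← Real.exp_add] at h3
      have h7 := (Real.log_le_iff_le_exp (by positivity)).2 h3
      linarith
    nlinarith
  · obtain ⟨C, hC⟩ := hprod 0 le_rfl
    rw [← summable_nat_add_iff 1]
    refine Summable.of_nonneg_of_le (fun n => Finset.prod_nonneg fun m _ => distFun_nonneg _ _)
      (fun n => ?_) (((summable_nat_add_iff 1).2 hπs).mul_left (C / π 0))
    have h1 : survProd F lam y (n + 1)
        = F (y * Real.exp ((0 : ℕ) * lam)) * ∏ k ∈ Finset.Ico (0 + 1) (n + 1),
          F (y * Real.exp (k * lam)) := by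
      rw [survProd, Finset.range_eq_Ico, Finset.prod_eq_prod_Ico_succ_bot (by omega)]
    rw [h1]
    calc _ ≤ ∏ k ∈ Finset.Ico (0 + 1) (n + 1), F (y * Real.exp (k * lam)) :=
          mul_le_of_le_one_left (Finset.prod_nonneg fun k _ => distFun_nonneg _ _)
            (distFun_le_one _ _)
      _ ≤ ∏ k ∈ Finset.Ico (0 + 1) (n + 1), F (y * Real.exp (k * lam + 2 * (ε * k) + 0)) :=
          Finset.prod_le_prod (fun k _ => distFun_nonneg _ _) fun k _ => distFun_mono N
            (by gcongr; have : 0 ≤ ε * k := by positivity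
                linarith)
      _ ≤ C * (π (n + 1) / π 0) := hC 0 (n + 1)
      _ = _ := by ring

end

/-! ### The main upper bound -/

section

variable {Ω : Type*} [MeasurableSpace Ω] {P : Measure Ω} {d : ℕ}

/-- The sum of the norms of the first `k` partial products. -/
def sumNorm (z : ℕ → ARPair d) (k : ℕ) : ℝ := ∑ i ∈ Finset.range k, ‖seqProd (mats z) i‖

/-- A bound for the probability that the vector `y_k`, transported by `a_0 ⋯ a_{k-1}`, has not
become large. -/
def smallBound (C : ℝ) (z : ℕ → ARPair d) (k : ℕ) : ENNReal :=
  if ‖(z k).2‖ < 1 then 1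
  else min 1 (ENNReal.ofReal (C * sumNorm z k / (‖seqProd (mats z) k‖ * ‖(z k).2‖)))

theorem smallBound_le_one (C : ℝ) (z : ℕ → ARPair d) (k : ℕ) : smallBound C z k ≤ 1 := by
  rw [smallBound]
  split_ifs
  · exact le_rfl
  · exact min_le_left _ _

theorem measurable_norm_snd (k : ℕ) : Measurable fun z : ℕ → ARPair d => ‖(z k).2‖ :=
  measurable_norm.comp (measurable_snd.comp (measurable_pi_apply k))

theorem measurable_smallBound (C : ℝ) (k : ℕ) :
    Measurable fun z : ℕ → ARPair d => smallBound C z k := by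
  refine Measurable.ite (measurableSet_lt (measurable_norm_snd k) measurable_const)
    measurable_const (measurable_const.min (Measurable.ennreal_ofReal ?_))
  exact (measurable_const.mul (Finset.measurable_sum _ fun i _ => measurable_norm_seqProd i)).div
    ((measurable_norm_seqProd k).mul (measurable_norm_snd k))

theorem seqProd_mats_congr {z z' : ℕ → ARPair d} {n : ℕ} (h : ∀ i < n, z i = z' i) :
    seqProd (mats z) n = seqProd (mats z') n :=
  seqProd_congr fun i hi => by simp only [mats, h i hi]

theorem prod_le_prod_of_superset_of_le_one {s t : Finset ℕ} {u : ℕ → ℝ} (hst : s ⊆ t)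
    (h0 : ∀ k, 0 ≤ u k) (h1 : ∀ k, u k ≤ 1) : ∏ k ∈ t, u k ≤ ∏ k ∈ s, u k := by
  rw [← Finset.prod_sdiff hst]
  exact mul_le_of_le_one_left (Finset.prod_nonneg fun k _ => h0 k)
    (Finset.prod_le_one (fun k _ => h0 k) fun k _ => h1 k)

namespace PrimitiveIID

variable {ζ : ℕ → Ω → ARPair d} {T : Set (Matrix (Fin d) (Fin d) ℝ)} {γ κ : ℝ} {K : ℕ}

theorem measurable_norm_snd (h : PrimitiveIID P ζ T γ κ K) (k : ℕ) :
    Measurable fun ω => ‖(ζ k ω).2‖ :=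
  (SubcriticalAR.measurable_norm_snd k).comp h.measurable_seq

theorem measure_norm_snd_le [IsProbabilityMeasure P] (h : PrimitiveIID P ζ T γ κ K) (k : ℕ)
    (t : ℝ) : P {ω | ‖(ζ k ω).2‖ ≤ t} = ENNReal.ofReal (distFun P (fun ω => ‖(ζ 0 ω).2‖) t) := by
  rw [distFun, ofReal_measureReal]
  exact ((h.iid.identDistrib k).comp (measurable_norm.comp measurable_snd)).measure_mem_eq
    (measurableSet_Iic (a := t))

/-- Functions of the matrices up to time `j` are independent of later vectors. -/
theorem lintegral_mul_prod (h : PrimitiveIID P ζ T γ κ K) {j : ℕ} (s : Finset ℕ)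
    (hs : ∀ k ∈ s, j ≤ k) {G : (ℕ → ARPair d) → ENNReal} (hG : Measurable G)
    (hGj : ∀ z z' : ℕ → ARPair d, (∀ i < j, z i = z' i) → G z = G z')
    {φ : ℕ → (Fin d → ℝ) → ENNReal} (hφ : ∀ k, Measurable (φ k)) :
    ∫⁻ ω, G (fun k => ζ k ω) * ∏ k ∈ s, φ k (ζ k ω).2 ∂P
      = (∫⁻ ω, G (fun k => ζ k ω) ∂P) * ∏ k ∈ s, ∫⁻ ω, φ k (ζ k ω).2 ∂P := by
  have hφ' : ∀ k, Measurable fun x : ARPair d => φ k x.2 := fun k => (hφ k).comp measurable_snd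
  have hm : Measurable fun z : ℕ → ARPair d => ∏ k ∈ s, φ k (z k).2 :=
    Finset.measurable_prod _ fun k _ => (hφ' k).comp (measurable_pi_apply k)
  have hind := indepFun_of_dependsOn h.iid.indep h.iid.measurable (S := {i | i < j})
    (T := {i | j ≤ i}) (F := G) (G := fun z => ∏ k ∈ s, φ k (z k).2)
    (Set.disjoint_left.2 fun i (hi : i < j) (hi' : j ≤ i) => absurd hi (not_lt.2 hi')) hG hm
    (fun z z' hz => hGj z z' fun i hi => hz i hi)
    (fun z z' hz => Finset.prod_congr rfl fun k hk => by rw [hz k (hs k hk)])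
  refine (lintegral_mul_eq_lintegral_mul_lintegral_of_indepFun''
    (hG.comp h.measurable_seq).aemeasurable (hm.comp h.measurable_seq).aemeasurable hind).trans ?_
  congr 1
  exact lintegral_prod_eq_prod_lintegral_of_indepFun s (fun k ω => φ k (ζ k ω).2)
    (h.iid.indep.comp (fun k x => φ k x.2) hφ') fun k => (hφ' k).comp (h.iid.measurable k)

variable {lam y C₀ c : ℝ} {δ π : ℕ → ℝ}

/-- The event that `S_j` deviates from `j * lam` by more than `δ j`. -/
def deviates (lam : ℝ) (δ : ℕ → ℝ) (j : ℕ) : Set (ℕ → ARPair d) :=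
  {z | j = 0 ∨ δ j < |decay z j - j * lam|}

theorem measurableSet_deviates (j : ℕ) :
    MeasurableSet (deviates (d := d) lam δ j) := by
  rcases Nat.eq_zero_or_pos j with rfl | hj
  · have : deviates (d := d) lam δ 0 = Set.univ := by ext; simp [deviates]
    rw [this]; exact MeasurableSet.univ
  · have : deviates (d := d) lam δ j = {z | δ j < |decay z j - j * lam|} := by
      ext; simp [deviates, hj.ne']
    rw [this]
    exact measurableSet_lt measurable_const
      (continuous_abs.measurable.comp ((SubcriticalAR.measurable_decay j).sub_const _))

theorem deviates_congr {j : ℕ} {z z' : ℕ → ARPair d} (h : ∀ i < j, z i = z' i) :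
    z ∈ deviates lam δ j ↔ z' ∈ deviates lam δ j := by
  simp only [deviates, Set.mem_ofPred_eq, decay, seqProd_mats_congr h]

/-- At `j = 0` the event is everything and the exponent, a division by zero, is `0`. The prefactor
`max C₀ 1` makes the bound hold there too. -/
theorem measure_deviates_le [IsProbabilityMeasure P]
    (hconc : ∀ n : ℕ, 1 ≤ n → ∀ t : ℝ, 0 ≤ t → P.real {ω | t ≤ |decay (fun k => ζ k ω) n - n * lam|}
      ≤ C₀ * Real.exp (-(c * t ^ 2 / n))) (hδ : ∀ k, 0 ≤ δ k) (j : ℕ) :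
    P {ω | (fun k => ζ k ω) ∈ deviates lam δ j}
      ≤ ENNReal.ofReal (max C₀ 1 * Real.exp (-(c * δ j ^ 2 / j))) := by
  rcases Nat.eq_zero_or_pos j with rfl | hj
  · refine prob_le_one.trans ?_
    simp
  · rw [← ofReal_measureReal]
    refine ENNReal.ofReal_le_ofReal ?_
    refine (measureReal_mono fun ω hω => ?_).trans ((hconc j hj _ (hδ j)).trans
      (mul_le_mul_of_nonneg_right (le_max_left _ _) (Real.exp_pos _).le))
    exact (hω.resolve_left hj.ne').le

theorem norm_seqProd_eq [NeZero d] (hT : IsPrimitiveSet T γ κ K) {z : ℕ → ARPair d}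
    (hz : ∀ k, mats z k ∈ T) (n : ℕ) : ‖seqProd (mats z) n‖ = Real.exp (-decay z n) := by
  rw [decay, neg_neg, Real.exp_log (hT.norm_seqProd_pos hz n)]

theorem summable_exp_neg_half {lam : ℝ} (hlam : 0 < lam) (B : ℝ) :
    Summable fun i : ℕ => Real.exp (-(lam * i / 2) + B) := by
  have := (summable_exp_neg_rpow (half_pos hlam) one_pos).mul_right (Real.exp B)
  refine this.congr fun i => ?_
  rw [← Real.exp_add, Real.rpow_one]
  ring_nf

/-- After the last deviation, the partial products are summable. -/
theorem exists_sumNorm_le [NeZero d] (hT : IsPrimitiveSet T γ κ K) (hlam : 0 < lam)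
    {B₁ : ℝ} (hδ : ∀ k : ℕ, δ k ≤ lam * k / 2 + B₁) :
    ∃ (M : ℕ) (B : ℝ), 0 ≤ B ∧ ∀ z : ℕ → ARPair d, (∀ k, mats z k ∈ T) → ∀ j n : ℕ,
      (∀ k, j < k → k ≤ n → z ∉ deviates lam δ k) → ∀ k ≤ n,
        sumNorm z k ≤ Real.exp (M * j * lam + B) := by
  have hs := summable_exp_neg_half hlam B₁
  set s₀ := ∑' i : ℕ, Real.exp (-(lam * i / 2) + B₁) with hs₀
  have hs₀0 : 0 ≤ s₀ := tsum_nonneg fun i => (Real.exp_pos _).le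
  -- Up to the last deviation `j` only the crude bound `γ ^ j` is available. The choice of `M` gives
  -- `(j + 1) * γ ^ j ≤ exp (M * j * lam)`; the later terms form a convergent series.
  obtain ⟨M, hM⟩ := exists_nat_ge ((1 + Real.log γ) / lam)
  rw [div_le_iff₀ hlam] at hM
  have hγ0 : 0 < γ := by linarith [hT.one_le]
  refine ⟨M, s₀, hs₀0, fun z hz j n hdev k hk => ?_⟩
  have hterm : ∀ i < k, ‖seqProd (mats z) i‖ ≤
      (if i ≤ j then γ ^ j else 0) + Real.exp (-(lam * i / 2) + B₁) := by
    intro i hi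
    split_ifs with hij
    · have h1 := (hT.norm_seqProd_le hz i).trans (pow_le_pow_right₀ hT.one_le hij)
      linarith [Real.exp_pos (-(lam * i / 2) + B₁)]
    · have h1 := hdev i (not_le.1 hij) (by omega)
      simp only [deviates, Set.mem_ofPred_eq, not_or, not_lt] at h1
      rw [norm_seqProd_eq hT hz, zero_add, Real.exp_le_exp]
      have h2 := (abs_le.1 h1.2).1
      have h3 := hδ i
      linarith
  have h1 : sumNorm z k ≤ (j + 1) * γ ^ j + s₀ := by
    calc sumNorm z k ≤ ∑ i ∈ Finset.range k,
          ((if i ≤ j then γ ^ j else 0) + Real.exp (-(lam * i / 2) + B₁)) :=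
          Finset.sum_le_sum fun i hi => hterm i (Finset.mem_range.1 hi)
      _ ≤ _ := by
          rw [Finset.sum_add_distrib]
          refine add_le_add ?_ (hs.sum_le_tsum _ fun i _ => (Real.exp_pos _).le)
          rw [← Finset.sum_filter, Finset.sum_const, nsmul_eq_mul]
          refine mul_le_mul_of_nonneg_right ?_ (by positivity)
          have : ((Finset.range k).filter fun i => i ≤ j).card ≤ j + 1 := by
            rw [← Finset.card_range (j + 1)]
            exact Finset.card_le_card fun i hi =>
              Finset.mem_range.2 (Nat.lt_succ_of_le (Finset.mem_filter.1 hi).2)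
          exact_mod_cast this
  have h2 : ((j : ℝ) + 1) * γ ^ j ≤ Real.exp (M * j * lam) := by
    calc ((j : ℝ) + 1) * γ ^ j ≤ Real.exp j * Real.exp (j * Real.log γ) := by
          refine mul_le_mul (Real.add_one_le_exp _) ?_ (by positivity) (Real.exp_pos _).le
          rw [← Real.log_pow, Real.exp_log (by positivity)]
      _ ≤ _ := by
          rw [← Real.exp_add, Real.exp_le_exp]
          have := mul_le_mul_of_nonneg_left hM (Nat.cast_nonneg (α := ℝ) j)
          linarith
  have h3 : 1 ≤ Real.exp (M * j * lam) := Real.one_le_exp (by positivity)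
  rw [Real.exp_add]
  have h4 := Real.add_one_le_exp s₀
  have h5 : Real.exp (M * j * lam) * (s₀ + 1) ≤ Real.exp (M * j * lam) * Real.exp s₀ :=
    mul_le_mul_of_nonneg_left h4 (by linarith)
  nlinarith

/-- The main upper bound: if the rate `π` is summable, then so are the expected products of the
probabilities `smallBound`. -/
theorem tsum_lintegral_prod_smallBound_ne_top [NeZero d] [IsProbabilityMeasure P]
    (h : PrimitiveIID P ζ T γ κ K) (hlam : 0 < lam) (hc : 0 < c)
    (hconc : ∀ n : ℕ, 1 ≤ n → ∀ t : ℝ, 0 ≤ t → P.real {ω | t ≤ |decay (fun k => ζ k ω) n - n * lam|}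
      ≤ C₀ * Real.exp (-(c * t ^ 2 / n)))
    (hy : 0 < y) (hf : 0 < distFun P (fun ω => ‖(ζ 0 ω).2‖) y)
    (hrate : UpperRate (distFun P fun ω => ‖(ζ 0 ω).2‖) lam y δ π) (hπ : Summable π) (C : ℝ) :
    ∑' n : ℕ, ∫⁻ ω, ∏ k ∈ Finset.Ico 1 n, smallBound C (fun k => ζ k ω) k ∂P ≠ ⊤ := by
  classical
  set F := distFun P fun ω => ‖(ζ 0 ω).2‖ with hF
  obtain ⟨B₁, hB₁⟩ := hrate.le_half
  obtain ⟨M, B₂, hB₂, hsumNorm⟩ := exists_sumNorm_le (d := d) h.prim hlam hB₁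
  set B := B₂ + max 0 (Real.log (max C 1 / y)) + |Real.log y| with hB
  have hB0 : 0 ≤ B := by have := le_max_left 0 (Real.log (max C 1 / y)); positivity
  -- Above this threshold, which belongs to time `k + M * j`, the quotient in `smallBound` is at
  -- most `exp (-δ k)`: the shift by `M * j` compensates `sumNorm`, one `δ` compensates the
  -- deviation of `S_k`, and the other one is the gain. The part `|ln y|` of `B` makes the threshold
  -- at least one, so that the first case of `smallBound` does not arise.
  set thr : ℕ → ℕ → ℝ := fun j k =>
    y * Real.exp ((k + M * j : ℕ) * lam + 2 * δ (k + M * j) + B) with hthr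
  have hthr1 : ∀ j k, 1 ≤ thr j k := by
    intro j k
    have h1 := hrate.nonneg (k + M * j)
    have h2 := neg_abs_le (Real.log y)
    have h3 := le_max_left 0 (Real.log (max C 1 / y))
    have h4 : (0 : ℝ) ≤ (k + M * j : ℕ) * lam := by positivity
    calc (1 : ℝ) ≤ Real.exp (Real.log y + ((k + M * j : ℕ) * lam + 2 * δ (k + M * j) + B)) :=
          Real.one_le_exp (by linarith)
      _ = _ := by rw [Real.exp_add, Real.exp_log hy]
  set φ : ℕ → ℕ → (Fin d → ℝ) → ENNReal := fun j k v =>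
    if ‖v‖ ≤ thr j k then 1 else ENNReal.ofReal (Real.exp (-δ k)) with hφ
  have hφm : ∀ j k, Measurable (φ j k) := fun j k =>
    Measurable.ite (measurableSet_le measurable_norm measurable_const) measurable_const
      measurable_const
  -- pointwise bound after the last deviation
  have hpt : ∀ z : ℕ → ARPair d, (∀ k, mats z k ∈ T) → ∀ j n : ℕ,
      (∀ k, j < k → k ≤ n → z ∉ deviates lam δ k) → ∀ k, j < k → k ≤ n →
        smallBound C z k ≤ φ j k (z k).2 := by
    intro z hz j n hdev k hjk hkn
    simp only [hφ]
    split_ifs with hle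
    · exact smallBound_le_one _ _ _
    · rw [not_le] at hle
      have h1 : ¬ ‖(z k).2‖ < 1 := not_lt.2 ((hthr1 j k).trans hle.le)
      rw [smallBound, if_neg h1]
      refine (min_le_right _ _).trans (ENNReal.ofReal_le_ofReal ?_)
      have hQ := hsumNorm z hz j n hdev k hkn
      have hQ0 : 0 ≤ sumNorm z k := Finset.sum_nonneg fun i _ => norm_nonneg _
      have hd := hdev k hjk hkn
      simp only [deviates, Set.mem_ofPred_eq, not_or, not_lt] at hd
      have hS := (abs_le.1 hd.2).2
      rw [norm_seqProd_eq h.prim hz, div_le_iff₀ (mul_pos (Real.exp_pos _)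
        (lt_of_lt_of_le zero_lt_one (not_lt.1 h1)))]
      have hC1 : 0 < max C 1 := lt_max_of_lt_right one_pos
      have hBC : max C 1 * Real.exp B₂ ≤ y * Real.exp B := by
        have h2 : Real.log (max C 1 / y) + B₂ ≤ B := by
          have := le_max_right 0 (Real.log (max C 1 / y))
          have := abs_nonneg (Real.log y)
          linarith
        have h3 := Real.exp_le_exp.2 h2
        rw [Real.exp_add, Real.exp_log (by positivity), div_mul_eq_mul_div, div_le_iff₀ hy] at h3
        linarith
      calc C * sumNorm z k ≤ max C 1 * Real.exp (M * j * lam + B₂) := by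
            refine mul_le_mul (le_max_left _ _) hQ hQ0 hC1.le
        _ = (max C 1 * Real.exp B₂) * Real.exp (M * j * lam) := by rw [Real.exp_add]; ring
        _ ≤ (y * Real.exp B) * Real.exp (M * j * lam) := by gcongr
        _ = Real.exp (-δ k) * (Real.exp (-(k * lam + δ k)) *
            (y * Real.exp ((k + M * j : ℕ) * lam + 2 * δ k + B))) := by
            rw [mul_assoc y, ← Real.exp_add, mul_left_comm (Real.exp (-(k * lam + δ k))),
              mul_left_comm (Real.exp (-δ k)), ← Real.exp_add, ← Real.exp_add]
            congr 2
            push_cast; ring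
        _ ≤ Real.exp (-δ k) * (Real.exp (-decay z k) * ‖(z k).2‖) := by
            refine mul_le_mul_of_nonneg_left ?_ (Real.exp_pos _).le
            refine mul_le_mul (Real.exp_le_exp.2 (by linarith)) (le_trans ?_ hle.le)
              (by positivity) (Real.exp_pos _).le
            have := hrate.mono (show k ≤ k + M * j by omega)
            simp only [hthr]
            gcongr
  -- decomposition at the last deviation
  have hdecomp : ∀ z : ℕ → ARPair d, (∀ k, mats z k ∈ T) → ∀ n : ℕ,
      ∏ k ∈ Finset.Ico 1 n, smallBound C z k ≤ ∑ j ∈ Finset.range (n + 1),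
        (deviates lam δ j).indicator 1 z * ∏ k ∈ Finset.Ico (j + 1) n, φ j k (z k).2 := by
    intro z hz n
    -- Time `0` counts as a deviation, so the last deviation always exists.
    set τ := Nat.findGreatest (fun j => z ∈ deviates lam δ j) n with hτ
    have hτn : τ ≤ n := Nat.findGreatest_le n
    have hτd : z ∈ deviates lam δ τ := by
      rcases Nat.eq_zero_or_pos τ with h0 | h0
      · rw [h0]; exact Or.inl rfl
      · exact Nat.findGreatest_of_ne_zero hτ.symm h0.ne'
    have hafter : ∀ k, τ < k → k ≤ n → z ∉ deviates lam δ k := fun k hk hkn =>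
      Nat.findGreatest_is_greatest hk hkn
    calc ∏ k ∈ Finset.Ico 1 n, smallBound C z k
        ≤ ∏ k ∈ Finset.Ico (τ + 1) n, smallBound C z k := by
          refine Finset.prod_le_prod_of_subset_of_le_one' (Finset.Ico_subset_Ico (by omega) le_rfl)
            fun k _ _ => smallBound_le_one _ _ _
      _ ≤ ∏ k ∈ Finset.Ico (τ + 1) n, φ τ k (z k).2 :=
          Finset.prod_le_prod' fun k hk => hpt z hz τ n hafter k
            (by have := (Finset.mem_Ico.1 hk).1; omega) (Finset.mem_Ico.1 hk).2.le
      _ = (deviates lam δ τ).indicator 1 z * ∏ k ∈ Finset.Ico (τ + 1) n, φ τ k (z k).2 := by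
          rw [Set.indicator_of_mem hτd, Pi.one_apply, one_mul]
      _ ≤ _ := Finset.single_le_sum (f := fun j => (deviates lam δ j).indicator 1 z *
            ∏ k ∈ Finset.Ico (j + 1) n, φ j k (z k).2) (fun _ _ => zero_le)
            (Finset.mem_range.2 (by omega))
  have hf1 : ∀ j k, F y ≤ F (thr j k) := fun j k => distFun_mono _ (by
    refine le_mul_of_one_le_right hy.le (Real.one_le_exp ?_)
    have := hrate.nonneg (k + M * j)
    positivity)
  obtain ⟨C₂, hC₂⟩ := hrate.prod_le B hB0
  set s₁ := ∑' k, Real.exp (-δ k) with hs₁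
  -- Since `F (thr j k) ≥ F y`, the additional term `exp (-δ k)` becomes a factor `exp (exp (-δ k) /
  -- F y)`, and the product of these factors is bounded.
  have hφint : ∀ j k, ∫⁻ ω, φ j k (ζ k ω).2 ∂P ≤
      ENNReal.ofReal (Real.exp (Real.exp (-δ k) / F y) * F (thr j k)) := by
    intro j k
    have h1 : ∀ ω, φ j k (ζ k ω).2 ≤ {ω | ‖(ζ k ω).2‖ ≤ thr j k}.indicator 1 ω +
        ENNReal.ofReal (Real.exp (-δ k)) := by
      intro ω
      simp only [hφ]
      split_ifs with hle
      · rw [Set.indicator_of_mem (by exact hle)]; exact le_self_add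
      · exact le_add_self
    refine (lintegral_mono h1).trans ?_
    rw [lintegral_add_right _ measurable_const, lintegral_const, measure_univ, mul_one,
      lintegral_indicator_one (measurableSet_le (h.measurable_norm_snd k) measurable_const),
      h.measure_norm_snd_le, ← ENNReal.ofReal_add (distFun_nonneg _ _) (Real.exp_pos _).le]
    refine ENNReal.ofReal_le_ofReal ?_
    have h2 := Real.add_one_le_exp (Real.exp (-δ k) / F y)
    have h3 : Real.exp (-δ k) ≤ Real.exp (-δ k) / F y * F (thr j k) := by
      rw [div_mul_eq_mul_div, le_div_iff₀ hf]
      exact mul_le_mul_of_nonneg_left (hf1 j k) (Real.exp_pos _).le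
    have h4 : 0 ≤ F (thr j k) := distFun_nonneg _ _
    nlinarith
  have hprodφ : ∀ j n, ∏ k ∈ Finset.Ico (j + 1) n, ∫⁻ ω, φ j k (ζ k ω).2 ∂P ≤
      ENNReal.ofReal (Real.exp (s₁ / F y) * (C₂ * (π n / π ((M + 1) * j)))) := by
    intro j n
    refine (Finset.prod_le_prod' fun k _ => hφint j k).trans ?_
    rw [← ENNReal.ofReal_prod_of_nonneg fun k _ =>
      mul_nonneg (Real.exp_pos _).le (distFun_nonneg _ _)]
    refine ENNReal.ofReal_le_ofReal ?_
    rw [Finset.prod_mul_distrib, ← Real.exp_sum, ← Finset.sum_div]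
    refine mul_le_mul ?_ ?_ (Finset.prod_nonneg fun k _ => distFun_nonneg _ _) (Real.exp_pos _).le
    · refine Real.exp_le_exp.2 (div_le_div_of_nonneg_right ?_ hf.le)
      exact hrate.summable_exp.sum_le_tsum _ fun k _ => (Real.exp_pos _).le
    -- Reindexing by `M * j` makes the thresholds unshifted, with indices from `(M + 1) * j + 1` to
    -- below `n + M * j`; the factors with index `n` or larger are at most one and are dropped.
    · refine le_trans ?_ (hC₂ ((M + 1) * j) n)
      have h1 : ∏ k ∈ Finset.Ico (j + 1) n, F (thr j k)
          = ∏ k ∈ Finset.Ico (j + 1 + M * j) (n + M * j),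
            F (y * Real.exp (k * lam + 2 * δ k + B)) :=
        (Finset.prod_Ico_add' (fun k : ℕ => F (y * Real.exp (k * lam + 2 * δ k + B))) _ _ _)
      rw [h1]
      refine prod_le_prod_of_superset_of_le_one ?_ (fun k => distFun_nonneg _ _)
        fun k => distFun_le_one _ _
      intro k hk
      rw [Finset.mem_Ico] at hk ⊢
      constructor
      · have := hk.1; ring_nf at this ⊢; omega
      · omega
  have hC₂0 : 0 ≤ C₂ := by
    have := hC₂ 0 0
    simp only [Finset.Ico_eq_empty (show ¬ 0 + 1 < 0 by omega), Finset.prod_empty] at this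
    have h1 := div_pos (hrate.pos 0) (hrate.pos 0)
    nlinarith
  set A₁ := max C₀ 1 * (Real.exp (s₁ / F y) * C₂) with hA₁
  have hA₁0 : 0 ≤ A₁ := by
    have : 0 ≤ max C₀ 1 := le_max_of_le_right zero_le_one
    positivity
  have hdevsum := hrate.summable_dev c hc (M + 1)
  set s₂ := ∑' j : ℕ, Real.exp (-(c * δ j ^ 2 / j)) / π ((M + 1) * j) with hs₂
  have hterm0 : ∀ j : ℕ, 0 ≤ Real.exp (-(c * δ j ^ 2 / j)) / π ((M + 1) * j) := fun j =>
    div_nonneg (Real.exp_pos _).le (hrate.pos _).le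
  have hs₂0 : 0 ≤ s₂ := tsum_nonneg hterm0
  have hfinal : ∀ n, ∫⁻ ω, ∏ k ∈ Finset.Ico 1 n, smallBound C (fun k => ζ k ω) k ∂P
      ≤ ENNReal.ofReal (A₁ * s₂ * π n) := by
    intro n
    have hind : ∀ j, Measurable fun z : ℕ → ARPair d =>
        (deviates lam δ j).indicator (1 : (ℕ → ARPair d) → ENNReal) z := fun j =>
      measurable_one.indicator (measurableSet_deviates j)
    calc _ ≤ ∫⁻ ω, ∑ j ∈ Finset.range (n + 1),
          (deviates lam δ j).indicator 1 (fun k => ζ k ω) *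
            ∏ k ∈ Finset.Ico (j + 1) n, φ j k (ζ k ω).2 ∂P := by
          refine lintegral_mono_ae ?_
          filter_upwards [h.mem] with ω hω
          exact hdecomp _ hω n
      _ = ∑ j ∈ Finset.range (n + 1), ∫⁻ ω, (deviates lam δ j).indicator 1 (fun k => ζ k ω) *
            ∏ k ∈ Finset.Ico (j + 1) n, φ j k (ζ k ω).2 ∂P := by
          refine lintegral_finsetSum _ fun j _ => ?_
          exact ((hind j).comp h.measurable_seq).mul (Finset.measurable_prod _ fun k _ =>
            (hφm j k).comp (measurable_snd.comp (h.iid.measurable k)))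
      _ ≤ ∑ j ∈ Finset.range (n + 1), ENNReal.ofReal
            (A₁ * π n * (Real.exp (-(c * δ j ^ 2 / j)) / π ((M + 1) * j))) := by
          refine Finset.sum_le_sum fun j _ => ?_
          rw [h.lintegral_mul_prod (j := j) _ (fun k hk => by
              have := (Finset.mem_Ico.1 hk).1; omega) (hind j) (fun z z' hz => by
              simp only [Set.indicator_apply, deviates_congr hz, Pi.one_apply]) (hφm j)]
          have h1 : ∫⁻ ω, (deviates lam δ j).indicator (1 : (ℕ → ARPair d) → ENNReal)
              (fun k => ζ k ω) ∂P = P {ω | (fun k => ζ k ω) ∈ deviates lam δ j} :=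
            lintegral_indicator_one (measurableSet_deviates j |>.preimage h.measurable_seq)
          rw [h1]
          refine (mul_le_mul' (measure_deviates_le hconc hrate.nonneg j) (hprodφ j n)).trans ?_
          rw [← ENNReal.ofReal_mul (mul_nonneg (le_max_of_le_right zero_le_one)
            (Real.exp_pos _).le)]
          refine ENNReal.ofReal_le_ofReal (le_of_eq ?_)
          rw [hA₁]; ring
      _ = ENNReal.ofReal (∑ j ∈ Finset.range (n + 1),
            A₁ * π n * (Real.exp (-(c * δ j ^ 2 / j)) / π ((M + 1) * j))) :=
          (ENNReal.ofReal_sum_of_nonneg fun j _ =>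
            mul_nonneg (mul_nonneg hA₁0 (hrate.pos n).le) (hterm0 j)).symm
      _ ≤ _ := by
          refine ENNReal.ofReal_le_ofReal ?_
          rw [← Finset.mul_sum]
          have := hdevsum.sum_le_tsum (Finset.range (n + 1)) fun j _ => hterm0 j
          calc _ ≤ A₁ * π n * s₂ :=
                mul_le_mul_of_nonneg_left this (mul_nonneg hA₁0 (hrate.pos n).le)
            _ = _ := by ring
  exact ne_top_of_le_ne_top (hπ.mul_left (A₁ * s₂)).tsum_ofReal_ne_top
    (ENNReal.tsum_le_tsum hfinal)

end PrimitiveIID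

end

/-! ### The main lower bound -/

section

variable {Ω : Type*} [MeasurableSpace Ω] {P : Measure Ω} {d : ℕ}

/-- The sum of the vectors `y_k` transported by `a_0 ⋯ a_{k-1}`. -/
def transportSum (z : ℕ → ARPair d) (n : ℕ) : Fin d → ℝ :=
  ∑ k ∈ Finset.range n, (seqProd (mats z) k).mulVec (z k).2

theorem measurable_mulVec_apply {α : Type*} [MeasurableSpace α]
    {f : α → Matrix (Fin d) (Fin d) ℝ} {g : α → Fin d → ℝ}
    (hf : ∀ i j, Measurable fun x => f x i j) (hg : Measurable g) :
    Measurable fun x => (f x).mulVec (g x) := by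
  refine measurable_pi_lambda _ fun i => ?_
  simp only [Matrix.mulVec, dotProduct]
  exact Finset.measurable_sum _ fun j _ => (hf i j).mul ((measurable_pi_apply j).comp hg)

theorem measurable_transport (k : ℕ) :
    Measurable fun z : ℕ → ARPair d => (seqProd (mats z) k).mulVec (z k).2 :=
  measurable_mulVec_apply (measurable_seqProd_apply measurable_mats_apply k)
    (measurable_snd.comp (measurable_pi_apply k))

theorem measurable_transportSum (n : ℕ) :
    Measurable fun z : ℕ → ARPair d => transportSum z n :=
  Finset.measurable_sum _ fun k _ => measurable_transport k

namespace PrimitiveIID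

variable {ζ : ℕ → Ω → ARPair d} {T : Set (Matrix (Fin d) (Fin d) ℝ)} {γ κ : ℝ} {K : ℕ}
  {lam y C₀ c : ℝ} {δ : ℕ → ℝ}

/-- The main lower bound: if the products of probabilities are not summable, then the transported
sums are bounded with probabilities that are not summable. -/
theorem exists_tsum_measure_transportSum_eq_top [NeZero d] [IsProbabilityMeasure P]
    (h : PrimitiveIID P ζ T γ κ K) (hlam : 0 < lam) (hc : 0 < c)
    (hconc : ∀ n : ℕ, 1 ≤ n → ∀ t : ℝ, 0 ≤ t → P.real {ω | t ≤ |decay (fun k => ζ k ω) n - n * lam|}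
      ≤ C₀ * Real.exp (-(c * t ^ 2 / n)))
    (hy : 0 < y) (hf : 0 < distFun P (fun ω => ‖(ζ 0 ω).2‖) y)
    (hrate : UpperRate (distFun P fun ω => ‖(ζ 0 ω).2‖) lam y δ
      (survProd (distFun P fun ω => ‖(ζ 0 ω).2‖) lam y))
    (hlow : ∃ c : ℝ, 0 < c ∧ ∀ n, c * survProd (distFun P fun ω => ‖(ζ 0 ω).2‖) lam y n ≤
      ∏ m ∈ Finset.range n, distFun P (fun ω => ‖(ζ 0 ω).2‖)
        (max y (y * Real.exp (m * lam - 2 * δ m - 0))))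
    (hp : ¬ Summable (survProd (distFun P fun ω => ‖(ζ 0 ω).2‖) lam y)) :
    ∃ b : ℝ, 0 < b ∧ ∑' n, P {ω | ‖transportSum (fun k => ζ k ω) n‖ ≤ b} = ⊤ := by
  classical
  set F := distFun P fun ω => ‖(ζ 0 ω).2‖ with hF
  set p := survProd F lam y with hpdef
  obtain ⟨c₁, hc₁, hlow⟩ := hlow
  obtain ⟨B₁, hB₁⟩ := hrate.le_half
  -- If `‖y_k‖ ≤ t k` and time `k` is no deviation, the transported vector has norm at most `y *
  -- (exp (-k * lam + δ k) + exp (-δ k))`. This is at most the summable `w k` below.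
  set t : ℕ → ℝ := fun k => max y (y * Real.exp (k * lam - 2 * δ k - 0)) with ht
  set q : ℕ → ℝ := fun n => ∏ k ∈ Finset.range n, F (t k) with hq
  have hFt : ∀ k, 0 < F (t k) := fun k => hf.trans_le (distFun_mono _ (le_max_left _ _))
  have hq0 : ∀ n, 0 < q n := fun n => Finset.prod_pos fun k _ => hFt k
  have hqp : ∀ n, c₁ * p n ≤ q n := hlow
  have hp0 : ∀ n, 0 < p n := hrate.pos
  -- the tail of the deviation probabilities
  set e : ℕ → ℝ := fun j => max C₀ 1 * Real.exp (-(c * δ j ^ 2 / j)) / q j with he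
  have he0 : ∀ j, 0 ≤ e j := fun j => div_nonneg
    (mul_nonneg (le_max_of_le_right zero_le_one) (Real.exp_pos _).le) (hq0 j).le
  have hes : Summable e := by
    refine Summable.of_nonneg_of_le he0 (fun j => ?_)
      ((hrate.summable_dev c hc 1).mul_left (max C₀ 1 / c₁))
    rw [one_mul, div_mul_div_comm]
    exact div_le_div_of_nonneg_left (mul_nonneg (le_max_of_le_right zero_le_one)
      (Real.exp_pos _).le) (mul_pos hc₁ (hp0 j)) (hqp j)
  obtain ⟨k₀, hk₀1, hk₀⟩ : ∃ k₀ : ℕ, 1 ≤ k₀ ∧ ∀ n, ∑ j ∈ Finset.Ico k₀ n, e j ≤ 1 / 2 := by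
    have h1 := (tendsto_order.1 (tendsto_sum_nat_add e)).2 (1 / 2) (by norm_num)
    obtain ⟨k₀, hk₀⟩ := eventually_atTop.1 h1
    refine ⟨max k₀ 1, le_max_right _ _, fun n => ?_⟩
    have h2 := hk₀ (max k₀ 1) (le_max_left _ _)
    rw [Finset.sum_Ico_eq_sum_range]
    refine le_trans ?_ h2.le
    have h3 := ((summable_nat_add_iff (max k₀ 1)).2 hes).sum_le_tsum
      (Finset.range (n - max k₀ 1)) fun j _ => he0 _
    refine le_trans (le_of_eq ?_) h3
    exact Finset.sum_congr rfl fun j _ => by rw [add_comm]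
  -- deterministic bound
  have hs₁ := summable_exp_neg_half hlam B₁
  set w : ℕ → ℝ := fun k => y * (Real.exp (-(lam * k / 2) + B₁) + Real.exp (-δ k)) with hw
  have hw0 : ∀ k, 0 ≤ w k := fun k =>
    mul_nonneg hy.le (add_nonneg (Real.exp_pos _).le (Real.exp_pos _).le)
  have hws : Summable w := (hs₁.add hrate.summable_exp).mul_left y
  have ht0 : ∀ k, 0 ≤ t k := fun k => hy.le.trans (le_max_left _ _)
  have hγ0 : 0 ≤ γ := zero_le_one.trans h.prim.one_le
  set b := ∑ k ∈ Finset.range k₀, γ ^ k * t k + ∑' k, w k + 1 with hb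
  have hb0 : 0 < b := by
    have h1 : 0 ≤ ∑ k ∈ Finset.range k₀, γ ^ k * t k := Finset.sum_nonneg fun k _ =>
      mul_nonneg (pow_nonneg hγ0 k) (ht0 k)
    have h2 : 0 ≤ ∑' k, w k := tsum_nonneg hw0
    linarith
  set D : ℕ → Set Ω := fun n => {ω | ∀ k ∈ Finset.range n, ‖(ζ k ω).2‖ ≤ t k} with hD
  set dev : ℕ → Set Ω := fun j => {ω | (fun k => ζ k ω) ∈ deviates lam δ j} with hdev
  have hdet : ∀ ω, (∀ k, mats (fun k => ζ k ω) k ∈ T) → ∀ n, ω ∈ D n →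
      (∀ j ∈ Finset.Ico k₀ n, ω ∉ dev j) → ‖transportSum (fun k => ζ k ω) n‖ ≤ b := by
    intro ω hω n hDn hdn
    have hterm : ∀ k ∈ Finset.range n,
        ‖(seqProd (mats fun k => ζ k ω) k).mulVec (ζ k ω).2‖ ≤
          (if k < k₀ then γ ^ k * t k else 0) + w k := by
      intro k hk
      have h1 : ‖(seqProd (mats fun k => ζ k ω) k).mulVec (ζ k ω).2‖ ≤
          ‖seqProd (mats fun k => ζ k ω) k‖ * t k :=
        (Matrix.linfty_opNorm_mulVec _ _).trans
          (mul_le_mul_of_nonneg_left (hDn k hk) (norm_nonneg _))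
      refine h1.trans ?_
      split_ifs with hkk
      · have h2 := mul_le_mul_of_nonneg_right (h.prim.norm_seqProd_le hω k) (ht0 k)
        linarith [hw0 k]
      · rw [zero_add]
        have h2 := hdn k (Finset.mem_Ico.2 ⟨not_lt.1 hkk, Finset.mem_range.1 hk⟩)
        simp only [hdev, deviates, Set.mem_ofPred_eq, not_or, not_lt] at h2
        have h3 := (abs_le.1 h2.2).1
        rw [norm_seqProd_eq h.prim hω]
        have h4 : Real.exp (-decay (fun k => ζ k ω) k) ≤ Real.exp (-(k * lam) + δ k) :=
          Real.exp_le_exp.2 (by linarith)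
        have h5 : t k ≤ y + y * Real.exp (k * lam - 2 * δ k) := by
          refine max_le ?_ ?_
          · linarith [mul_pos hy (Real.exp_pos (k * lam - 2 * δ k))]
          · rw [sub_zero]; linarith
        calc Real.exp (-decay (fun k => ζ k ω) k) * t k
            ≤ Real.exp (-(k * lam) + δ k) * (y + y * Real.exp (k * lam - 2 * δ k)) :=
              mul_le_mul h4 h5 (ht0 k) (Real.exp_pos _).le
          _ = y * (Real.exp (-(k * lam) + δ k) +
              Real.exp (-(k * lam) + δ k) * Real.exp (k * lam - 2 * δ k)) := by ring
          _ ≤ w k := by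
              rw [← Real.exp_add]
              refine mul_le_mul_of_nonneg_left (add_le_add ?_ ?_) hy.le
              · exact Real.exp_le_exp.2 (by linarith [hB₁ k])
              · exact Real.exp_le_exp.2 (by linarith)
    refine (norm_sum_le _ _).trans ((Finset.sum_le_sum hterm).trans ?_)
    rw [Finset.sum_add_distrib]
    have h6 := hws.sum_le_tsum (Finset.range n) fun k _ => hw0 k
    have h7 : ∑ k ∈ Finset.range n, (if k < k₀ then γ ^ k * t k else 0)
        ≤ ∑ k ∈ Finset.range k₀, γ ^ k * t k := by
      rw [← Finset.sum_filter]
      refine Finset.sum_le_sum_of_subset_of_nonneg (fun k hk =>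
        Finset.mem_range.2 (Finset.mem_filter.1 hk).2) fun k _ _ =>
        mul_nonneg (pow_nonneg hγ0 k) (ht0 k)
    linarith
  -- probabilities
  set φ : ℕ → (Fin d → ℝ) → ENNReal := fun k v => if ‖v‖ ≤ t k then 1 else 0 with hφ
  have hφm : ∀ k, Measurable (φ k) := fun k =>
    Measurable.ite (measurableSet_le measurable_norm measurable_const) measurable_const
      measurable_const
  have hφint : ∀ k, ∫⁻ ω, φ k (ζ k ω).2 ∂P = ENNReal.ofReal (F (t k)) := by
    intro k
    rw [← h.measure_norm_snd_le, ← lintegral_indicator_one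
      (measurableSet_le (h.measurable_norm_snd k) measurable_const)]
    refine lintegral_congr fun ω => ?_
    simp only [hφ, Set.indicator_apply, Set.mem_ofPred_eq, Pi.one_apply]
  have hDm : ∀ n, MeasurableSet (D n) := fun n => by
    have : D n = ⋂ k ∈ Finset.range n, {ω | ‖(ζ k ω).2‖ ≤ t k} := by ext; simp [hD]
    rw [this]
    exact Finset.measurableSet_biInter _ fun k _ =>
      measurableSet_le (h.measurable_norm_snd k) measurable_const
  have hdm : ∀ j, MeasurableSet (dev j) := fun j =>
    (measurableSet_deviates j).preimage h.measurable_seq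
  have hprodφ : ∀ (s : Finset ℕ) (ω : Ω),
      ∏ k ∈ s, φ k (ζ k ω).2 = if ∀ k ∈ s, ‖(ζ k ω).2‖ ≤ t k then 1 else 0 := by
    intro s ω
    split_ifs with hs
    · exact Finset.prod_eq_one fun k hk => if_pos (hs k hk)
    · push Not at hs
      obtain ⟨k, hk, hlt⟩ := hs
      exact Finset.prod_eq_zero hk (if_neg (not_le.2 hlt))
  have hPD : ∀ n, P (D n) = ENNReal.ofReal (q n) := by
    intro n
    have h1 := h.lintegral_mul_prod (j := 0) (Finset.range n) (fun _ _ => Nat.zero_le _)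
      (G := fun _ => 1) measurable_const (fun _ _ _ => rfl) hφm
    simp only [one_mul, lintegral_const, measure_univ, hprodφ, hφint] at h1
    rw [← lintegral_indicator_one (hDm n), hq, ENNReal.ofReal_prod_of_nonneg fun k _ => (hFt k).le,
      ← h1]
    refine lintegral_congr fun ω => ?_
    simp only [hD, Set.indicator_apply, Set.mem_ofPred_eq, Pi.one_apply]
  -- The deviation at `j` depends on the pairs before `j`, hence is independent of the restrictions
  -- from `j` on. The restrictions before `j` are dropped at the cost of `1 / q j`, which is the
  -- denominator in `e j`.
  have hPdev : ∀ n, ∀ j ∈ Finset.Ico k₀ n, P (D n ∩ dev j) ≤ ENNReal.ofReal (e j * q n) := by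
    intro n j hj
    have hjn := (Finset.mem_Ico.1 hj).2
    have h1 := h.lintegral_mul_prod (j := j) (Finset.Ico j n)
      (fun k hk => (Finset.mem_Ico.1 hk).1)
      (G := (deviates lam δ j).indicator 1) (measurable_one.indicator (measurableSet_deviates j))
      (fun z z' hz => by simp only [Set.indicator_apply, deviates_congr hz, Pi.one_apply]) hφm
    have h2 : ∫⁻ ω, (deviates lam δ j).indicator (1 : (ℕ → ARPair d) → ENNReal)
        (fun k => ζ k ω) ∂P = P (dev j) :=
      lintegral_indicator_one (hdm j)
    rw [h2] at h1
    simp only [hφint] at h1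
    calc P (D n ∩ dev j) = ∫⁻ ω, (D n ∩ dev j).indicator 1 ω ∂P :=
          (lintegral_indicator_one ((hDm n).inter (hdm j))).symm
      _ ≤ _ := by
          refine lintegral_mono fun ω => ?_
          by_cases hω : ω ∈ D n ∩ dev j
          · rw [Set.indicator_of_mem hω, Set.indicator_of_mem (by exact hω.2), hprodφ, if_pos]
            · simp
            · exact fun k hk => hω.1 k (Finset.mem_range.2 (Finset.mem_Ico.1 hk).2)
          · rw [Set.indicator_of_notMem hω]
            exact bot_le
      _ = _ := h1
      _ ≤ ENNReal.ofReal (max C₀ 1 * Real.exp (-(c * δ j ^ 2 / j))) *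
            ∏ k ∈ Finset.Ico j n, ENNReal.ofReal (F (t k)) :=
          mul_le_mul_left (measure_deviates_le hconc hrate.nonneg j) _
      _ = _ := by
          rw [← ENNReal.ofReal_prod_of_nonneg fun k _ => (hFt k).le, ← ENNReal.ofReal_mul
            (mul_nonneg (le_max_of_le_right zero_le_one) (Real.exp_pos _).le)]
          congr 1
          have h3 : q n = q j * ∏ k ∈ Finset.Ico j n, F (t k) :=
            (Finset.prod_range_mul_prod_Ico _ hjn.le).symm
          rw [he, h3]
          have := (hq0 j).ne'
          field_simp
  have hmain : ∀ n, ENNReal.ofReal (c₁ / 2 * p n) ≤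
      P {ω | ‖transportSum (fun k => ζ k ω) n‖ ≤ b} := by
    intro n
    set E := {ω | ‖transportSum (fun k => ζ k ω) n‖ ≤ b} with hE
    have h1 : ∀ᵐ ω ∂P, ω ∈ D n → ω ∈ E ∪ ⋃ j ∈ Finset.Ico k₀ n, (D n ∩ dev j) := by
      filter_upwards [h.mem] with ω hω hDn
      by_cases hall : ∀ j ∈ Finset.Ico k₀ n, ω ∉ dev j
      · exact Or.inl (hdet ω hω n hDn hall)
      · push Not at hall
        obtain ⟨j, hj, hjd⟩ := hall
        exact Or.inr (Set.mem_iUnion₂.2 ⟨j, hj, hDn, hjd⟩)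
    -- Deviations before `k₀` are harmless, since `b` contains the worst case of the first `k₀`
    -- terms. The later ones remove at most half of the probability of `D n`.
    have h2 : P (D n) ≤ P E + ENNReal.ofReal (1 / 2 * q n) := by
      refine (measure_mono_ae h1).trans ((measure_union_le _ _).trans (add_le_add le_rfl ?_))
      refine (measure_biUnion_finset_le _ _).trans ((Finset.sum_le_sum (hPdev n)).trans ?_)
      rw [← ENNReal.ofReal_sum_of_nonneg fun j _ => mul_nonneg (he0 j) (hq0 n).le,
        ← Finset.sum_mul]
      exact ENNReal.ofReal_le_ofReal (mul_le_mul_of_nonneg_right (hk₀ n) (hq0 n).le)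
    rw [hPD] at h2
    have h3 : ENNReal.ofReal (q n) = ENNReal.ofReal (1 / 2 * q n) + ENNReal.ofReal (1 / 2 * q n) := by
      have := hq0 n
      rw [← ENNReal.ofReal_add (by positivity) (by positivity)]; congr 1; ring
    rw [h3] at h2
    have h4 := (ENNReal.add_le_add_iff_right ENNReal.ofReal_ne_top).1 h2
    refine le_trans (ENNReal.ofReal_le_ofReal ?_) h4
    linarith [hqp n]
  refine ⟨b, hb0, ?_⟩
  by_contra hne
  refine hp ?_
  have h1 := ENNReal.summable_toReal (ne_top_of_le_ne_top hne (ENNReal.tsum_le_tsum hmain))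
  have h2 : Summable fun n => c₁ / 2 * p n := by
    refine h1.congr fun n => ENNReal.toReal_ofReal ?_
    have := hp0 n
    positivity
  exact (summable_mul_left_iff (by positivity)).1 h2

end PrimitiveIID

end

/-! ### The autoregressive chains -/

section

/-- The reversal of the first `n` indices. -/
def revIndex (n k : ℕ) : ℕ := if k < n then n - 1 - k else k

theorem revIndex_injective (n : ℕ) : (revIndex n).Injective := by
  intro a b h
  simp only [revIndex] at h
  split_ifs at h <;> omega

theorem revIndex_of_lt {n k : ℕ} (h : k < n) : revIndex n k = n - 1 - k := if_pos h

section Chains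

variable {Ω : Type*} {d : ℕ} {A : ℕ → Ω → Matrix (Fin d) (Fin d) ℝ} {Y : ℕ → Ω → Fin d → ℝ}

theorem transportSum_congr {z z' : ℕ → ARPair d} {n : ℕ} (h : ∀ i < n, z i = z' i) :
    transportSum z n = transportSum z' n := by
  refine Finset.sum_congr rfl fun k hk => ?_
  have hk' := Finset.mem_range.1 hk
  rw [seqProd_mats_congr fun i hi => h i (hi.trans hk'), h k hk']

theorem transportSum_succ (z : ℕ → ARPair d) (n : ℕ) :
    transportSum z (n + 1) =
      (mats z 0).mulVec (transportSum (fun k => z (k + 1)) n) + (z 0).2 := by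
  rw [transportSum, Finset.sum_range_succ', transportSum, Matrix.mulVec_sum]
  congr 1
  · refine Finset.sum_congr rfl fun k _ => ?_
    rw [seqProd_succ', ← Matrix.mulVec_mulVec]
    rfl
  · rw [seqProd, Matrix.one_mulVec]

/-- Unrolling the recursion, the innovation of time `n - k` reaches time `n` through `A_n ⋯
A_{n-k+1}`. The reversal depends on `n`, which is harmless because only the law at a single time
enters recurrence. -/
theorem arChain_eq_transportSum (n : ℕ) (ω : Ω) :
    arChain A (fromZero Y) n ω = transportSum (fun k => arPair A Y (revIndex n k) ω) n := by
  induction n with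
  | zero => simp [arChain, fromZero, transportSum]
  | succ n ih =>
    rw [transportSum_succ, arChain, ih]
    congr 1
    have h0 : mats (fun k => arPair A Y (revIndex (n + 1) k) ω) 0 = A (n + 1) ω := by
      simp only [mats, revIndex_of_lt (Nat.succ_pos n)]; rfl
    rw [h0]
    congr 1
    refine transportSum_congr fun i hi => ?_
    simp only [revIndex_of_lt hi, revIndex_of_lt (Nat.succ_lt_succ hi)]
    congr 1
    omega

/-- A nonnegative matrix is monotone but does not commute with the coordinatewise maximum, so `M_n`
may exceed the maximum of the transported vectors. The inequality in this direction is all that is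
needed. -/
theorem transport_le_maxChain (hA : ∀ n ω i j, 0 ≤ A (n + 1) ω i j) (n : ℕ) (ω : Ω) :
    ∀ k < n, (seqProd (mats fun k => arPair A Y (revIndex n k) ω) k).mulVec
      (arPair A Y (revIndex n k) ω).2 ≤ maxChain A (fromZero Y) n ω := by
  induction n with
  | zero => intro k hk; omega
  | succ n ih =>
    intro k hk
    rw [maxChain]
    cases k with
    | zero =>
      rw [seqProd, Matrix.one_mulVec, revIndex_of_lt (Nat.succ_pos n)]
      exact le_sup_right
    | succ k =>
      have hk' : k < n := by omega
      refine le_trans ?_ le_sup_left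
      refine le_trans (le_of_eq ?_) (mulVec_mono (hA n ω) (ih k hk'))
      rw [seqProd_succ', ← Matrix.mulVec_mulVec]
      have h0 : mats (fun k => arPair A Y (revIndex (n + 1) k) ω) 0 = A (n + 1) ω := by
        simp only [mats, revIndex_of_lt (Nat.succ_pos n)]; rfl
      rw [h0]
      have hi : ∀ i < n, revIndex (n + 1) (i + 1) = revIndex n i := fun i hi => by
        rw [revIndex_of_lt hi, revIndex_of_lt (Nat.succ_lt_succ hi)]; omega
      congr 1
      rw [hi k hk']
      congr 1
      exact seqProd_congr fun i hik => by simp only [mats, hi i (hik.trans hk')]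

theorem maxChain_nonneg (hA : ∀ n ω i j, 0 ≤ A (n + 1) ω i j) (n : ℕ) (ω : Ω) :
    0 ≤ maxChain A (fromZero Y) n ω := by
  induction n with
  | zero => exact le_rfl
  | succ n ih => exact (mulVec_nonneg (hA n ω) ih).trans le_sup_left

theorem maxChain_le_arChain (hA : ∀ n ω i j, 0 ≤ A (n + 1) ω i j) (hY : ∀ n ω i, 0 ≤ Y n ω i)
    (n : ℕ) (ω : Ω) : maxChain A (fromZero Y) n ω ≤ arChain A (fromZero Y) n ω := by
  induction n with
  | zero => exact le_rfl
  | succ n ih =>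
    rw [maxChain, arChain]
    have h1 := mulVec_mono (hA n ω) ih
    have h2 : (0 : Fin d → ℝ) ≤ fromZero Y (n + 1) ω := fun i => hY (n + 1) ω i
    have h3 : (0 : Fin d → ℝ) ≤ (A (n + 1) ω).mulVec (arChain A (fromZero Y) n ω) :=
      (mulVec_nonneg (hA n ω) (maxChain_nonneg hA n ω)).trans h1
    exact sup_le (h1.trans (le_add_of_nonneg_right h2)) (le_add_of_nonneg_left h3)

end Chains

variable {Ω : Type*} [MeasurableSpace Ω] {P : Measure Ω} {d : ℕ}
  {A : ℕ → Ω → Matrix (Fin d) (Fin d) ℝ} {Y : ℕ → Ω → Fin d → ℝ}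
  {T : Set (Matrix (Fin d) (Fin d) ℝ)} {γ κ : ℝ} {K : ℕ}

theorem IsARData.primitiveIID (hdata : IsARData P A Y) (hT : IsPrimitiveSet T γ κ K)
    (hmem : ∀ᵐ ω ∂P, ∀ k, mats (fun k => arPair A Y k ω) k ∈ T) :
    PrimitiveIID P (arPair A Y) T γ κ K :=
  ⟨hdata.isIID, hT, hmem, fun k ω i => hdata.nonneg_Y (k + 1) ω i⟩

/-- At time `K + 1` the innovation `Y_1` has passed through `K` matrices, so every coordinate is at
least `κ * ‖Y_1‖`, and this exceeds any bound with positive probability. -/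
theorem isIrreducible_maxChain (hdata : IsARData P A Y)
    (h : PrimitiveIID P (arPair A Y) T γ κ K) : IsIrreducible P (maxChain A (fromZero Y)) := by
  intro x hx
  refine ⟨K + 1, (hdata.unbounded (‖x‖ / κ)).trans_le (measure_mono_ae ?_)⟩
  filter_upwards [h.mem] with ω hω hlt i
  have h1 := transport_le_maxChain (Y := Y) hdata.nonneg_A (K + 1) ω K (Nat.lt_succ_self K) i
  have h2 := h.prim.le_seqProd_mulVec (a := mats fun k => arPair A Y (revIndex (K + 1) k) ω)
    (fun k => hω _) (h.nonneg (revIndex (K + 1) K) ω) i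
  refine le_trans ?_ (h2.trans h1)
  have h3 : revIndex (K + 1) K = 0 := by rw [revIndex_of_lt (Nat.lt_succ_self K)]; omega
  rw [h3]
  have h4 : ‖x‖ / κ < ‖Y 1 ω‖ := hlt
  rw [div_lt_iff₀ h.prim.pos] at h4
  have h5 := (le_abs_self _).trans (norm_le_pi_norm x i)
  show x i ≤ κ * ‖Y 1 ω‖
  linarith

theorem isIrreducible_mono {V W : ℕ → Ω → Fin d → ℝ} (h : IsIrreducible P V)
    (hVW : ∀ n ω, V n ω ≤ W n ω) : IsIrreducible P W := by
  intro x hx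
  obtain ⟨n, hn⟩ := h x hx
  exact ⟨n, hn.trans_le (measure_mono fun ω hω => le_trans hω (hVW n ω))⟩

/-- `P[‖X_n‖ ≤ b]` in terms of the time-reversed sum. -/
theorem measure_arChain_le (hdata : IsARData P A Y) (n : ℕ) (b : ℝ) :
    P {ω | ‖arChain A (fromZero Y) n ω‖ ≤ b} =
      P {ω | ‖transportSum (fun k => arPair A Y k ω) n‖ ≤ b} := by
  simp only [arChain_eq_transportSum]
  exact (hdata.isIID.identDistrib_reindex (revIndex_injective n)).measure_mem_eq
    (s := {z | ‖transportSum z n‖ ≤ b})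
    (measurableSet_le (measurable_norm.comp (measurable_transportSum n)) measurable_const)

/-- If the chain is at most `b`, then so is each transported vector, and bounded distortion makes
`‖a_0 ⋯ a_{k-1}‖ * ‖y_k‖` at most `b / c`. Every factor `smallBound` is then one, so the product
dominates the indicator. Here `sumNorm ≥ 1` is only a loss; it is present for the sake of the
branching process. -/
theorem measure_maxChain_le [NeZero d] (hdata : IsARData P A Y)
    (h : PrimitiveIID P (arPair A Y) T γ κ K) (b : ℝ) :
    ∃ C : ℝ, ∀ n, P {ω | ‖maxChain A (fromZero Y) n ω‖ ≤ b} ≤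
      ∫⁻ ω, ∏ k ∈ Finset.Ico 1 n, smallBound C (fun k => arPair A Y k ω) k ∂P := by
  obtain ⟨c, hc, -, hlow⟩ := h.prim.exists_mul_norm_le
  refine ⟨b / c, fun n => ?_⟩
  set s : Set (ℕ → ARPair d) :=
    {z | ∀ k ∈ Finset.range n, ‖(seqProd (mats z) k).mulVec (z k).2‖ ≤ b} with hs
  have hsm : MeasurableSet s := by
    have : s = ⋂ k ∈ Finset.range n, {z | ‖(seqProd (mats z) k).mulVec (z k).2‖ ≤ b} := by
      ext; simp [hs]
    rw [this]
    exact Finset.measurableSet_biInter _ fun k _ =>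
      measurableSet_le (measurable_norm.comp (measurable_transport k)) measurable_const
  have h1 : P {ω | ‖maxChain A (fromZero Y) n ω‖ ≤ b} ≤
      P {ω | (fun k => arPair A Y (revIndex n k) ω) ∈ s} := by
    refine measure_mono fun ω hω k hk => ?_
    have hk' := Finset.mem_range.1 hk
    refine le_trans (norm_mono ?_ (transport_le_maxChain hdata.nonneg_A n ω k hk')) hω
    exact mulVec_nonneg (seqProd_nonneg (fun i => hdata.nonneg_A (revIndex n i) ω) k)
      (h.nonneg _ ω)
  have h2 : P {ω | (fun k => arPair A Y (revIndex n k) ω) ∈ s}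
      = P {ω | (fun k => arPair A Y k ω) ∈ s} :=
    (hdata.isIID.identDistrib_reindex (revIndex_injective n)).measure_mem_eq hsm
  refine h1.trans (h2.trans_le ?_)
  have h3 : P {ω | (fun k => arPair A Y k ω) ∈ s}
      = ∫⁻ ω, {ω | (fun k => arPair A Y k ω) ∈ s}.indicator 1 ω ∂P :=
    (lintegral_indicator_one (hsm.preimage h.measurable_seq)).symm
  rw [h3]
  refine lintegral_mono_ae ?_
  filter_upwards [h.mem] with ω hω
  by_cases hωs : ω ∈ {ω | (fun k => arPair A Y k ω) ∈ s}
  · rw [Set.indicator_of_mem hωs, Pi.one_apply]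
    refine Finset.one_le_prod' fun k hk => ?_
    obtain ⟨hk1, hkn⟩ := Finset.mem_Ico.1 hk
    have h4 : ‖(seqProd (mats fun k => arPair A Y k ω) k).mulVec (arPair A Y k ω).2‖ ≤ b :=
      hωs k (Finset.mem_range.2 hkn)
    rw [smallBound]
    split_ifs with h5
    · exact le_rfl
    · refine le_min le_rfl ?_
      rw [← ENNReal.ofReal_one]
      refine ENNReal.ofReal_le_ofReal ?_
      have h6 := h.prim.norm_seqProd_pos hω k
      have h7 : 0 < ‖(arPair A Y k ω).2‖ := lt_of_lt_of_le one_pos (not_lt.1 h5)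
      have h8 := (hlow _ hω k _ (h.nonneg k ω)).trans h4
      have h9 : 1 ≤ sumNorm (fun k => arPair A Y k ω) k := by
        have := Finset.single_le_sum
          (f := fun i => ‖seqProd (mats fun k => arPair A Y k ω) i‖)
          (fun i _ => norm_nonneg _) (Finset.mem_range.2 (show 0 < k by omega))
        simpa [seqProd, sumNorm] using this
      rw [one_le_div (mul_pos h6 h7)]
      have h10 : ‖seqProd (mats fun k => arPair A Y k ω) k‖ * ‖(arPair A Y k ω).2‖ ≤ b / c := by
        rw [le_div_iff₀ hc]; linarith
      have h11 : 0 ≤ b / c := (mul_pos h6 h7).le.trans h10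
      exact h10.trans (le_mul_of_one_le_right h11 h9)
  · rw [Set.indicator_of_notMem hωs]
    exact bot_le

theorem rr_iff [IsProbabilityMeasure P] {lam y : ℝ} :
    RR P Y lam y ↔ ¬ Summable (survProd (distFun P fun ω => ‖Y 1 ω‖) lam y) := by
  have h1 : ∀ n : ℕ, ∏ m ∈ Finset.range (n + 1), P {ω | ‖Y 1 ω‖ ≤ y * Real.exp (m * lam)}
      = ENNReal.ofReal (survProd (distFun P fun ω => ‖Y 1 ω‖) lam y (n + 1)) := by
    intro n
    rw [survProd, ENNReal.ofReal_prod_of_nonneg fun m _ => distFun_nonneg _ _]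
    exact Finset.prod_congr rfl fun m _ => by
      rw [distFun, ofReal_measureReal]
  have h0 : ∀ n, 0 ≤ survProd (distFun P fun ω => ‖Y 1 ω‖) lam y n := fun n =>
    Finset.prod_nonneg fun m _ => distFun_nonneg _ _
  rw [RR, ← summable_nat_add_iff 1]
  simp only [h1]
  constructor
  · intro h hs
    exact hs.tsum_ofReal_ne_top h
  · intro h
    by_contra hne
    exact h ((ENNReal.summable_toReal hne).congr fun n => ENNReal.toReal_ofReal (h0 _))

/-- Under the first alternative of (REG) the rate is the survival product itself, so upper and lower
bound match. Under the second one the series in (RR) converges, and any summable rate suffices. -/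
theorem exists_rate_of_reg [IsProbabilityMeasure P] (hY : Measurable (Y 1)) {lam y : ℝ}
    (hlam : 0 < lam) (hreg : REG P Y lam) (hy : 0 < y)
    (hf : 0 < distFun P (fun ω => ‖Y 1 ω‖) y) :
    (∃ δ : ℕ → ℝ, UpperRate (distFun P fun ω => ‖Y 1 ω‖) lam y δ
        (survProd (distFun P fun ω => ‖Y 1 ω‖) lam y) ∧
      ∃ c : ℝ, 0 < c ∧ ∀ n, c * survProd (distFun P fun ω => ‖Y 1 ω‖) lam y n ≤
      ∏ m ∈ Finset.range n, distFun P (fun ω => ‖Y 1 ω‖)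
        (max y (y * Real.exp (m * lam - 2 * δ m - 0)))) ∨
    (∃ δ π : ℕ → ℝ, UpperRate (distFun P fun ω => ‖Y 1 ω‖) lam y δ π ∧ Summable π ∧
      Summable (survProd (distFun P fun ω => ‖Y 1 ω‖) lam y)) := by
  have hN : Measurable fun ω => ‖Y 1 ω‖ := measurable_norm.comp hY
  rcases hreg with ⟨β, hβ, hβ1, ht⟩ | hlim
  · obtain ⟨δ, h1, h2⟩ := exists_rate_of_tail hN (fun ω => norm_nonneg _) hlam hy hf hβ hβ1 ht
    exact Or.inl ⟨δ, h1, h2 0 le_rfl⟩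
  · obtain ⟨q, hq1, hq2⟩ := ENNReal.lt_iff_exists_nnreal_btwn.1 hlim
    refine Or.inr (exists_rate_of_heavy_tail hN hlam hy (q := q) ?_ ?_)
    · rw [← ENNReal.ofReal_coe_nnreal, ENNReal.ofReal_lt_ofReal_iff_of_nonneg hlam.le] at hq1
      exact hq1
    · filter_upwards [eventually_lt_of_lt_liminf hq2, eventually_ge_atTop 0] with x hx hx0
      rw [← ofReal_measureReal, ← ENNReal.ofReal_mul hx0, ← ENNReal.ofReal_coe_nnreal] at hx
      exact (ENNReal.ofReal_lt_ofReal_iff_of_nonneg q.2).1 hx |>.le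

/-- If the chain `V` avoids large values at most with the probabilities of the main upper bound and
its returns have infinite expectation, then (RR) holds. -/
theorem rr_of_tsum_eq_top [NeZero d] [IsProbabilityMeasure P]
    (h : PrimitiveIID P (arPair A Y) T γ κ K) {lam C₀ c y : ℝ} (hlam : 0 < lam) (hc : 0 < c)
    (hconc : ∀ n : ℕ, 1 ≤ n → ∀ t : ℝ, 0 ≤ t →
      P.real {ω | t ≤ |decay (fun k => arPair A Y k ω) n - n * lam|}
        ≤ C₀ * Real.exp (-(c * t ^ 2 / n)))
    (hreg : REG P Y lam) (hy : 0 < y) (hf : 0 < P {ω | ‖Y 1 ω‖ ≤ y}) {C : ℝ} {v : ℕ → ENNReal}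
    (hv : ∀ n, v n ≤ ∫⁻ ω, ∏ k ∈ Finset.Ico 1 n, smallBound C (fun k => arPair A Y k ω) k ∂P)
    (hsum : ∑' n, v n = ⊤) : RR P Y lam y := by
  rw [rr_iff]
  intro hs
  have hf' : 0 < distFun P (fun ω => ‖Y 1 ω‖) y :=
    ENNReal.toReal_pos hf.ne' (measure_ne_top _ _)
  have hY : Measurable (Y 1) := measurable_snd.comp (h.iid.measurable 0)
  obtain ⟨δ, π, hrate, hπ⟩ : ∃ δ π : ℕ → ℝ,
      UpperRate (distFun P fun ω => ‖Y 1 ω‖) lam y δ π ∧ Summable π := by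
    rcases exists_rate_of_reg hY hlam hreg hy hf' with ⟨δ, h1, -⟩ | ⟨δ, π, h1, h2, -⟩
    · exact ⟨δ, _, h1, hs⟩
    · exact ⟨δ, π, h1, h2⟩
  refine h.tsum_lintegral_prod_smallBound_ne_top hlam hc hconc hy hf' hrate hπ C ?_
  exact top_le_iff.1 (hsum.symm.le.trans (ENNReal.tsum_le_tsum hv))

theorem rr_of_mr [NeZero d] [IsProbabilityMeasure P] (hdata : IsARData P A Y)
    (h : PrimitiveIID P (arPair A Y) T γ κ K) {lam C₀ c y : ℝ} (hlam : 0 < lam) (hc : 0 < c)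
    (hconc : ∀ n : ℕ, 1 ≤ n → ∀ t : ℝ, 0 ≤ t →
      P.real {ω | t ≤ |decay (fun k => arPair A Y k ω) n - n * lam|}
        ≤ C₀ * Real.exp (-(c * t ^ 2 / n)))
    (hreg : REG P Y lam) (hy : 0 < y) (hf : 0 < P {ω | ‖Y 1 ω‖ ≤ y}) (hmr : MR P A Y) :
    RR P Y lam y := by
  obtain ⟨-, b, -, hsum⟩ := hmr
  obtain ⟨C, hC⟩ := measure_maxChain_le hdata h b
  exact rr_of_tsum_eq_top h hlam hc hconc hreg hy hf hC hsum

theorem xr_of_rr [NeZero d] [IsProbabilityMeasure P] (hdata : IsARData P A Y)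
    (h : PrimitiveIID P (arPair A Y) T γ κ K) {lam C₀ c y : ℝ} (hlam : 0 < lam) (hc : 0 < c)
    (hconc : ∀ n : ℕ, 1 ≤ n → ∀ t : ℝ, 0 ≤ t →
      P.real {ω | t ≤ |decay (fun k => arPair A Y k ω) n - n * lam|}
        ≤ C₀ * Real.exp (-(c * t ^ 2 / n)))
    (hreg : REG P Y lam) (hy : 0 < y) (hf : 0 < P {ω | ‖Y 1 ω‖ ≤ y}) (hrr : RR P Y lam y) :
    XR P A Y := by
  rw [rr_iff] at hrr
  have hf' : 0 < distFun P (fun ω => ‖Y 1 ω‖) y :=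
    ENNReal.toReal_pos hf.ne' (measure_ne_top _ _)
  have hY : Measurable (Y 1) := measurable_snd.comp (h.iid.measurable 0)
  refine ⟨isIrreducible_mono (isIrreducible_maxChain hdata h)
    (maxChain_le_arChain hdata.nonneg_A hdata.nonneg_Y), ?_⟩
  rcases exists_rate_of_reg hY hlam hreg hy hf' with ⟨δ, h1, h2⟩ | ⟨δ, π, -, -, h3⟩
  · obtain ⟨b, hb, hsum⟩ :=
      h.exists_tsum_measure_transportSum_eq_top hlam hc hconc hy hf' h1 h2 hrr
    refine ⟨b, hb, ?_⟩
    simp only [measure_arChain_le hdata]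
    exact hsum
  · exact absurd h3 hrr

theorem mr_of_xr (hdata : IsARData P A Y) (h : PrimitiveIID P (arPair A Y) T γ κ K)
    (hxr : XR P A Y) : MR P A Y := by
  obtain ⟨-, b, hb, hsum⟩ := hxr
  refine ⟨isIrreducible_maxChain hdata h, b, hb, top_le_iff.1 (hsum.symm.le.trans
    (ENNReal.tsum_le_tsum fun n => measure_mono fun ω hω => ?_))⟩
  refine le_trans ?_ (show ‖arChain A (fromZero Y) n ω‖ ≤ b from hω)
  exact norm_mono (maxChain_nonneg hdata.nonneg_A n ω)
    (maxChain_le_arChain hdata.nonneg_A hdata.nonneg_Y n ω)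

end

/-! ### Offspring in a fixed environment -/

section

/-- A family of independent random variables with the uniform distribution on `[0, 1]`. -/
structure IsUniformFamily {Ω ι : Type*} [MeasurableSpace Ω] (P : Measure Ω)
    (t : ι → Ω → unitInterval) : Prop where
  measurable : ∀ i, Measurable (t i)
  map_eq : ∀ i, P.map (t i) = volume
  indep : iIndepFun t P

namespace EnvSpace

variable {E : Type*} [MeasurableSpace E] {d : ℕ}

/-- The environment states in which the offspring vectors have finite second moments and covariance
matrices of norm at most `γ`. -/
def boundedStates (R : EnvSpace E d) (γ : ℝ) : Set E :=
  {e | ∀ j, (∀ i, MemLp (R.children e i j) 2 volume) ∧ ‖R.covMatrix e j‖ ≤ γ}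

theorem measurable_rule (R : EnvSpace E d) (i j : Fin d) :
    Measurable fun p : E × unitInterval => (R.rule p.1 j).1 p.2 i :=
  (measurable_pi_apply i).comp (R.measurable_eval j)

theorem measurable_children (R : EnvSpace E d) (i j : Fin d) :
    Measurable fun p : E × unitInterval => R.children p.1 i j p.2 :=
  (measurable_of_countable (fun n : ℕ => (n : ℝ))).comp (R.measurable_rule i j)

theorem children_nonneg (R : EnvSpace E d) (e : E) (i j : Fin d) (s : unitInterval) :
    0 ≤ R.children e i j s := Nat.cast_nonneg _

theorem measurable_meanMatrix_apply (R : EnvSpace E d) (i j : Fin d) :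
    Measurable fun e => R.meanMatrix e i j :=
  ((R.measurable_children i j).stronglyMeasurable.integral_prod_right').measurable

theorem measurable_covMatrix_apply (R : EnvSpace E d) (i j k : Fin d) :
    Measurable fun e => R.covMatrix e j i k := by
  have h : ∀ i, Measurable fun p : E × unitInterval =>
      R.children p.1 i j p.2 - R.meanMatrix p.1 i j := fun i =>
    (R.measurable_children i j).sub ((R.measurable_meanMatrix_apply i j).comp measurable_fst)
  exact (((h i).mul (h k)).stronglyMeasurable.integral_prod_right').measurable

/-- Measurability is what carries (BD2) from `Ψ_1` to all `Ψ_n` by equality of laws. -/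
theorem measurableSet_boundedStates (R : EnvSpace E d) (γ : ℝ) :
    MeasurableSet (R.boundedStates γ) := by
  have h1 : R.boundedStates γ = ⋂ j, ((⋂ i, {e | eLpNorm (R.children e i j) 2 volume < ⊤}) ∩
      {e | ‖R.covMatrix e j‖ ≤ γ}) := by
    ext e
    simp only [boundedStates, Set.mem_ofPred_eq, Set.mem_iInter, Set.mem_inter_iff]
    refine forall_congr' fun j => and_congr (forall_congr' fun i => ?_) Iff.rfl
    exact ⟨fun h => h.2, fun h => ⟨((R.measurable_children i j).comp
      measurable_prodMk_left).aestronglyMeasurable, h⟩⟩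
  rw [h1]
  refine MeasurableSet.iInter fun j => (MeasurableSet.iInter fun i => ?_).inter
    (measurableSet_le (measurable_norm_matrix fun i k => R.measurable_covMatrix_apply i j k)
      measurable_const)
  refine measurableSet_lt ?_ measurable_const
  simp only [eLpNorm_eq_lintegral_rpow_enorm_toReal two_ne_zero ENNReal.ofNat_ne_top]
  refine Measurable.pow_const ?_ _
  exact (((R.measurable_children i j).enorm).pow_const _).lintegral_prod_right'

variable (R : EnvSpace E d) {e : E} {γ : ℝ} (w : Fin d → ℝ) (j : Fin d)

/-- The total weight of the children of an individual of type `j`. -/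
def childWeight (e : E) (s : unitInterval) : ℝ := ∑ i, w i * R.children e i j s

theorem measurable_childWeight (e : E) : Measurable (R.childWeight w j e) :=
  Finset.measurable_sum _ fun i _ =>
    ((R.measurable_children i j).comp measurable_prodMk_left).const_mul _

variable {R}

theorem memLp_childWeight (he : e ∈ R.boundedStates γ) :
    MemLp (R.childWeight w j e) 2 volume :=
  memLp_finsetSum _ fun i _ => ((he j).1 i).const_mul _

theorem integral_childWeight (he : e ∈ R.boundedStates γ) :
    ∫ s, R.childWeight w j e s = Matrix.vecMul w (R.meanMatrix e) j := by
  simp only [childWeight]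
  rw [integral_finsetSum _ fun i _ =>
    (((he j).1 i).integrable one_le_two).const_mul _]
  simp only [integral_const_mul]
  rfl

/-- The variance is the quadratic form of the covariance matrix at `w`, and each of its `d` rows has
absolute sum at most `γ`. -/
theorem variance_childWeight_le (he : e ∈ R.boundedStates γ) :
    variance (R.childWeight w j e) volume ≤ d * γ * ‖w‖ ^ 2 := by
  have h0 : 0 ≤ γ := (norm_nonneg _).trans (he j).2
  have h1 := (norm_matrix_le_iff h0).1 (he j).2
  have h2 : variance (R.childWeight w j e) volume
      = ∑ i, ∑ k, w i * (w k * R.covMatrix e j i k) := by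
    refine (variance_fun_sum fun i => ((he j).1 i).const_mul (w i)).trans ?_
    refine Finset.sum_congr rfl fun i _ => Finset.sum_congr rfl fun k _ => ?_
    rw [covariance_const_mul_left, covariance_const_mul_right]
    rfl
  rw [h2]
  calc ∑ i, ∑ k, w i * (w k * R.covMatrix e j i k)
      ≤ ∑ i, ∑ k, ‖w‖ ^ 2 * |R.covMatrix e j i k| := by
        refine Finset.sum_le_sum fun i _ => Finset.sum_le_sum fun k _ => ?_
        refine (le_abs_self _).trans ?_
        rw [abs_mul, abs_mul, ← mul_assoc, sq]
        exact mul_le_mul_of_nonneg_right (mul_le_mul (norm_le_pi_norm w i) (norm_le_pi_norm w k)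
          (abs_nonneg _) (norm_nonneg _)) (abs_nonneg _)
    _ = ‖w‖ ^ 2 * ∑ i, ∑ k, |R.covMatrix e j i k| := by simp only [Finset.mul_sum]
    _ ≤ ‖w‖ ^ 2 * ∑ _i : Fin d, γ :=
        mul_le_mul_of_nonneg_left (Finset.sum_le_sum fun i _ => h1 i) (sq_nonneg _)
    _ = d * γ * ‖w‖ ^ 2 := by simp; ring

end EnvSpace

section Offspring

variable {Ω E : Type*} [MeasurableSpace Ω] [MeasurableSpace E] {P : Measure Ω} {d : ℕ}

/-- The numbers of children of a population of `β j` individuals of each type `j`, the `k`-th of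
which reproduces according to the variable `t (k, j)`. -/
def offspring (R : EnvSpace E d) (e : E) (β : Fin d → ℕ) (t : ℕ × Fin d → unitInterval)
    (i : Fin d) : ℕ :=
  ∑ j, ∑ k ∈ Finset.range (β j), (R.rule e j).1 (t (k, j)) i

theorem measurable_sum_range {α : Type*} [MeasurableSpace α] {N : α → ℕ} (hN : Measurable N)
    {f : ℕ → α → ℕ} (hf : ∀ k, Measurable (f k)) :
    Measurable fun x => ∑ k ∈ Finset.range (N x), f k x := by
  have h : Measurable fun p : α × ℕ => ∑ k ∈ Finset.range p.2, f k p.1 :=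
    measurable_from_prod_countable_left fun n =>
      Finset.measurable_sum (Finset.range n) fun k _ => hf k
  exact h.comp (measurable_id.prodMk hN)

theorem measurable_offspring (R : EnvSpace E d) {α : Type*} [MeasurableSpace α] {e : α → E}
    (he : Measurable e) {β : α → Fin d → ℕ} (hβ : Measurable β)
    {t : α → ℕ × Fin d → unitInterval} (ht : Measurable t) :
    Measurable fun x => offspring R (e x) (β x) (t x) :=
  measurable_pi_lambda _ fun i => Finset.measurable_sum _ fun j _ =>
    measurable_sum_range ((measurable_pi_apply j).comp hβ) fun k =>
      (R.measurable_rule i j).comp (he.prodMk ((measurable_pi_apply (k, j)).comp ht))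

/-- The total weight of a population. -/
def weight (w : Fin d → ℝ) (β : Fin d → ℕ) : ℝ := ∑ i, w i * β i

theorem weight_nonneg {w : Fin d → ℝ} (hw : 0 ≤ w) (β : Fin d → ℕ) : 0 ≤ weight w β :=
  Finset.sum_nonneg fun i _ => mul_nonneg (hw i) (Nat.cast_nonneg _)

theorem measurable_weight (w : Fin d → ℝ) : Measurable (weight w) :=
  measurable_of_countable _

/-- A sum over individuals, driven by distinct uniform variables: expectation and variance are then
sums over individuals too. -/
theorem weight_offspring (R : EnvSpace E d) (e : E) (β : Fin d → ℕ) (w : Fin d → ℝ)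
    (t : ℕ × Fin d → unitInterval) : weight w (offspring R e β t) =
      ∑ p ∈ Finset.univ.sigma fun j => Finset.range (β j),
        R.childWeight w p.1 e (t (p.2, p.1)) := by
  rw [Finset.sum_sigma]
  simp only [weight, offspring, EnvSpace.childWeight, Nat.cast_sum, Finset.mul_sum,
    EnvSpace.children]
  rw [Finset.sum_comm]
  exact Finset.sum_congr rfl fun j _ => Finset.sum_comm

variable {R : EnvSpace E d} {e : E} {γ : ℝ} {t : ℕ × Fin d → Ω → unitInterval}

theorem IsUniformFamily.memLp_comp {ι : Type*} {t : ι → Ω → unitInterval}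
    (ht : IsUniformFamily P t) (i : ι) {f : unitInterval → ℝ} (hf : MemLp f 2 volume) :
    MemLp (fun ω => f (t i ω)) 2 P := by
  rw [← ht.map_eq i] at hf
  exact hf.comp_of_map (ht.measurable i).aemeasurable

theorem IsUniformFamily.precomp {ι ι' : Type*} {t : ι → Ω → unitInterval}
    (ht : IsUniformFamily P t) {g : ι' → ι} (hg : g.Injective) :
    IsUniformFamily P fun i => t (g i) :=
  ⟨fun _ => ht.measurable _, fun _ => ht.map_eq _, ht.indep.precomp hg⟩

theorem memLp_weight_offspring (ht : IsUniformFamily P t) (he : e ∈ R.boundedStates γ)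
    (β : Fin d → ℕ) (w : Fin d → ℝ) :
    MemLp (fun ω => weight w (offspring R e β fun p => t p ω)) 2 P := by
  simp only [weight_offspring]
  exact memLp_finsetSum _ fun p _ =>
    ht.memLp_comp (p.2, p.1) (EnvSpace.memLp_childWeight w p.1 he)

theorem integral_weight_offspring [IsProbabilityMeasure P] (ht : IsUniformFamily P t)
    (he : e ∈ R.boundedStates γ)
    (β : Fin d → ℕ) (w : Fin d → ℝ) :
    ∫ ω, weight w (offspring R e β fun p => t p ω) ∂P
      = weight (Matrix.vecMul w (R.meanMatrix e)) β := by
  simp only [weight_offspring]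
  rw [integral_finsetSum _ fun p _ => (ht.memLp_comp (p.2, p.1)
    (EnvSpace.memLp_childWeight w p.1 he)).integrable one_le_two, Finset.sum_sigma, weight]
  refine Finset.sum_congr rfl fun j _ => ?_
  have h : ∀ k, ∫ ω, R.childWeight w j e (t (k, j) ω) ∂P
      = Matrix.vecMul w (R.meanMatrix e) j := by
    intro k
    rw [← EnvSpace.integral_childWeight w j he, ← ht.map_eq (k, j), integral_map
      (ht.measurable _).aemeasurable (R.measurable_childWeight w j e).aestronglyMeasurable]
  simp only [h, Finset.sum_const, Finset.card_range, nsmul_eq_mul, mul_comm]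

theorem variance_weight_offspring_le [IsProbabilityMeasure P] (ht : IsUniformFamily P t)
    (he : e ∈ R.boundedStates γ)
    (β : Fin d → ℕ) (w : Fin d → ℝ) :
    variance (fun ω => weight w (offspring R e β fun p => t p ω)) P
      ≤ d * γ * ‖w‖ ^ 2 * weight 1 β := by
  have h1 : (fun ω => weight w (offspring R e β fun p => t p ω)) =
      ∑ p ∈ Finset.univ.sigma fun j => Finset.range (β j),
        fun ω => R.childWeight w p.1 e (t (p.2, p.1) ω) := by
    ext ω
    rw [weight_offspring, Finset.sum_apply]
  rw [h1, IndepFun.variance_sum]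
  · rw [Finset.sum_sigma, weight, Finset.mul_sum]
    refine Finset.sum_le_sum fun j _ => ?_
    have h : ∀ k, variance (fun ω => R.childWeight w j e (t (k, j) ω)) P
        ≤ d * γ * ‖w‖ ^ 2 := by
      intro k
      refine le_trans (le_of_eq ?_) (EnvSpace.variance_childWeight_le w j he)
      rw [← ht.map_eq (k, j), variance_map
        (by exact (R.measurable_childWeight w j e).aemeasurable) (ht.measurable _).aemeasurable]
      rfl
    refine (Finset.sum_le_card_nsmul _ _ _ fun k _ => h k).trans_eq ?_
    simp [mul_comm]
  · exact fun p _ => ht.memLp_comp (p.2, p.1) (EnvSpace.memLp_childWeight w p.1 he)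
  · intro p _ q _ hpq
    have hne : (p.2, p.1) ≠ (q.2, q.1) := fun h => hpq (by
      rw [Prod.mk.injEq] at h
      exact Sigma.ext h.2 (heq_of_eq h.1))
    exact (ht.indep.indepFun hne).comp (R.measurable_childWeight w p.1 e)
      (R.measurable_childWeight w q.1 e)

theorem lintegral_weight_offspring [IsProbabilityMeasure P] (ht : IsUniformFamily P t)
    (he : e ∈ R.boundedStates γ) (β : Fin d → ℕ) {w : Fin d → ℝ} (hw : 0 ≤ w) :
    ∫⁻ ω, ENNReal.ofReal (weight w (offspring R e β fun p => t p ω)) ∂P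
      = ENNReal.ofReal (weight (Matrix.vecMul w (R.meanMatrix e)) β) := by
  rw [← integral_weight_offspring ht he, ofReal_integral_eq_lintegral_ofReal
    ((memLp_weight_offspring ht he β w).integrable one_le_two)
    (ae_of_all _ fun ω => weight_nonneg hw _)]

/-- Squared mean plus variance. The form with `ENNReal`-valued integrals can be iterated over the
generations without integrability conditions. -/
theorem lintegral_weight_offspring_sq_le [IsProbabilityMeasure P] (ht : IsUniformFamily P t)
    (he : e ∈ R.boundedStates γ) (β : Fin d → ℕ) (w : Fin d → ℝ) :
    ∫⁻ ω, ENNReal.ofReal (weight w (offspring R e β fun p => t p ω) ^ 2) ∂P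
      ≤ ENNReal.ofReal (weight (Matrix.vecMul w (R.meanMatrix e)) β ^ 2)
        + ENNReal.ofReal (d * γ * ‖w‖ ^ 2) * ENNReal.ofReal (weight 1 β) := by
  have h1 := variance_weight_offspring_le ht he β w
  have hL := memLp_weight_offspring ht he β w
  rw [variance_eq_sub hL, integral_weight_offspring ht he] at h1
  rw [← ofReal_integral_eq_lintegral_ofReal hL.integrable_sq
    (ae_of_all _ fun ω => sq_nonneg _), ← ENNReal.ofReal_mul' (weight_nonneg zero_le_one β),
    ← ENNReal.ofReal_add (sq_nonneg _)]
  · refine ENNReal.ofReal_le_ofReal ?_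
    simp only [Pi.pow_apply] at h1
    linarith
  · rcases isEmpty_or_nonempty (Fin d) with h | ⟨⟨j⟩⟩
    · simp [weight]
    · have h0 : 0 ≤ γ := (norm_nonneg _).trans (he j).2
      have := weight_nonneg (w := 1) zero_le_one β
      positivity

end Offspring

end

/-! ### Moments of a cohort in a fixed environment -/

section

variable {Ω E : Type*} [MeasurableSpace E] {d : ℕ}

/-- The index of the variable governing the reproduction at time `m + l` of the `k`-th individual of
type `j` in the cohort of time `m`. -/
def cohortIndex (m l : ℕ) (p : ℕ × Fin d) : UIndex d :=
  ⟨(m, m + l + 1, p.1, p.2), Nat.lt_succ_of_le (Nat.le_add_right m l)⟩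

theorem cohortIndex_injective (m l : ℕ) : (cohortIndex (d := d) m l).Injective := by
  rintro ⟨k, j⟩ ⟨k', j'⟩ h
  simpa [cohortIndex] using h

/-- The cohort of time `m` after `l` steps, in the fixed environment `e`, started from `v`. -/
def quenchedCohort (R : EnvSpace E d) (e : ℕ → E) (v : Fin d → ℕ) (m : ℕ)
    (u : UIndex d → unitInterval) : ℕ → Fin d → ℕ
  | 0 => v
  | l + 1 => offspring R (e (m + l)) (quenchedCohort R e v m u l) fun p => u (cohortIndex m l p)

theorem cohort_eq_quenchedCohort (R : EnvSpace E d) (Ψ : ℕ → Ω → E) (Y : ℕ → Ω → Fin d → ℝ)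
    (U : ℕ → ℕ → ℕ → Fin d → Ω → unitInterval) (m l : ℕ) (ω : Ω) :
    cohort R Ψ Y U m l ω = quenchedCohort R (fun n => Ψ (n + 1) ω) (fun i => ⌊Y m ω i⌋₊) m
      (fun p => U p.1.1 p.1.2.1 p.1.2.2.1 p.1.2.2.2 ω) l := by
  induction l with
  | zero => rfl
  | succ l ih => rw [cohort, quenchedCohort, ih]; rfl

theorem measurable_quenchedCohort (R : EnvSpace E d) {α : Type*} [MeasurableSpace α]
    {e : α → ℕ → E} (he : Measurable e) {v : α → Fin d → ℕ} (hv : Measurable v)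
    {u : α → UIndex d → unitInterval} (hu : Measurable u) (m l : ℕ) :
    Measurable fun x => quenchedCohort R (e x) (v x) m (u x) l := by
  induction l with
  | zero => exact hv
  | succ l ih =>
    exact measurable_offspring R ((measurable_pi_apply (m + l)).comp he) ih
      (measurable_pi_lambda _ fun p => (measurable_pi_apply (cohortIndex m l p)).comp hu)

theorem quenchedCohort_congr (R : EnvSpace E d) (e : ℕ → E) (v : Fin d → ℕ) (m l : ℕ)
    {u u' : UIndex d → unitInterval}
    (h : ∀ p : UIndex d, p.1.1 = m → p.1.2.1 ≤ m + l → u p = u' p) :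
    quenchedCohort R e v m u l = quenchedCohort R e v m u' l := by
  induction l with
  | zero => rfl
  | succ l ih =>
    rw [quenchedCohort, quenchedCohort, ih fun p h1 h2 => h p h1 (h2.trans (Nat.le_succ _))]
    congr 1
    funext p
    exact h _ rfl le_rfl

variable [MeasurableSpace Ω] {P : Measure Ω} [IsProbabilityMeasure P] {R : EnvSpace E d} {e : ℕ → E} {γ : ℝ}
  {u : UIndex d → Ω → unitInterval}

/-- The Markov property in a fixed environment: the last reproduction uses variables with time index
`m + l + 1`, the earlier ones only indices up to `m + l`. -/
theorem lintegral_quenchedCohort_succ (hu : IsUniformFamily P u) (v : Fin d → ℕ) (m l : ℕ)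
    (φ : (Fin d → ℕ) → ENNReal) :
    ∫⁻ ω, φ (quenchedCohort R e v m (fun p => u p ω) (l + 1)) ∂P =
      ∫⁻ ω, ∫⁻ ω', φ (offspring R (e (m + l)) (quenchedCohort R e v m (fun p => u p ω) l)
        fun p => u (cohortIndex m l p) ω') ∂P ∂P := by
  have hF : Measurable fun u : UIndex d → unitInterval => quenchedCohort R e v m u l :=
    measurable_quenchedCohort R measurable_const measurable_const measurable_id m l
  have hG : Measurable fun (u : UIndex d → unitInterval) p => u (cohortIndex m l p) :=
    measurable_pi_lambda _ fun p => measurable_pi_apply _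
  have hum : Measurable fun ω p => u p ω := measurable_pi_lambda _ hu.measurable
  have hind := indepFun_of_dependsOn hu.indep hu.measurable
    (S := {p : UIndex d | p.1.2.1 ≤ m + l}) (T := {p : UIndex d | p.1.2.1 = m + l + 1})
    (F := fun u => quenchedCohort R e v m u l) (G := fun u p => u (cohortIndex m l p))
    (Set.disjoint_left.2 fun p (hp : p.1.2.1 ≤ m + l) (hp' : p.1.2.1 = m + l + 1) => by omega)
    hF hG
    (fun x y hxy => quenchedCohort_congr R e v m l fun p _ hp => hxy p hp)
    (fun x y hxy => funext fun p => hxy _ rfl)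
  refine lintegral_of_indepFun (X := fun ω => quenchedCohort R e v m (fun p => u p ω) l)
    (Z := fun ω p => u (cohortIndex m l p) ω) (hF.comp hum) (hG.comp hum) hind
    (φ := fun x => φ (offspring R (e (m + l)) x.1 x.2)) ?_
  exact (measurable_of_countable φ).comp
    (measurable_offspring R measurable_const measurable_fst measurable_snd)

theorem weight_eq_dotProduct (w : Fin d → ℝ) (v : Fin d → ℕ) :
    weight w v = dotProduct w fun i => (v i : ℝ) := rfl

theorem meanMatrix_nonneg (R : EnvSpace E d) (e : E) (i j : Fin d) : 0 ≤ R.meanMatrix e i j :=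
  integral_nonneg fun _ => R.children_nonneg e i j _

theorem vecMul_nonneg {M : Matrix (Fin d) (Fin d) ℝ} (hM : ∀ i j, 0 ≤ M i j) {w : Fin d → ℝ}
    (hw : 0 ≤ w) : 0 ≤ Matrix.vecMul w M := fun j =>
  show 0 ≤ ∑ i, w i * M i j from Finset.sum_nonneg fun i _ => mul_nonneg (hw i) (hM i j)

/-- Here `b 0` is the matrix of the latest generation. Conditioning on the generation before
replaces the test vector `w` by `w * b 0`, which drives the inductions on `l` below. -/
theorem dotProduct_seqProd_succ (w : Fin d → ℝ) (b : ℕ → Matrix (Fin d) (Fin d) ℝ) (l : ℕ)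
    (v : Fin d → ℝ) : dotProduct w ((seqProd b (l + 1)).mulVec v) =
      dotProduct (Matrix.vecMul w (b 0)) ((seqProd (fun k => b (k + 1)) l).mulVec v) := by
  rw [seqProd_succ', ← Matrix.mulVec_mulVec, Matrix.dotProduct_mulVec]

/-- The quenched mean of a cohort. -/
theorem lintegral_weight_quenchedCohort (hu : IsUniformFamily P u)
    (he : ∀ n, e n ∈ R.boundedStates γ) (v : Fin d → ℕ) (m l : ℕ) {w : Fin d → ℝ} (hw : 0 ≤ w)
    {b : ℕ → Matrix (Fin d) (Fin d) ℝ}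
    (hb : ∀ i < l, b i = R.meanMatrix (e (m + (l - 1 - i)))) :
    ∫⁻ ω, ENNReal.ofReal (weight w (quenchedCohort R e v m (fun p => u p ω) l)) ∂P
      = ENNReal.ofReal (dotProduct w ((seqProd b l).mulVec fun i => (v i : ℝ))) := by
  induction l generalizing w b with
  | zero => simp [quenchedCohort, seqProd, weight_eq_dotProduct]
  | succ l ih =>
    have hb0 : b 0 = R.meanMatrix (e (m + l)) := hb 0 (Nat.succ_pos l)
    rw [lintegral_quenchedCohort_succ hu v m l fun β => ENNReal.ofReal (weight w β),
      dotProduct_seqProd_succ]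
    simp only [lintegral_weight_offspring (hu.precomp (cohortIndex_injective m l)) (he _) _ hw]
    rw [← ih (w := Matrix.vecMul w (b 0)) (b := fun k => b (k + 1)), hb0]
    · rw [hb0]
      exact vecMul_nonneg (meanMatrix_nonneg R _) hw
    · intro i hi
      rw [hb (i + 1) (Nat.succ_lt_succ hi)]
      congr 3
      omega

/-- The quenched second moment of a cohort. -/
theorem lintegral_weight_quenchedCohort_sq_le (hu : IsUniformFamily P u)
    (he : ∀ n, e n ∈ R.boundedStates γ) (v : Fin d → ℕ) (m l : ℕ) {w : Fin d → ℝ} (hw : 0 ≤ w)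
    {b : ℕ → Matrix (Fin d) (Fin d) ℝ}
    (hb : ∀ i < l, b i = R.meanMatrix (e (m + (l - 1 - i)))) :
    ∫⁻ ω, ENNReal.ofReal (weight w (quenchedCohort R e v m (fun p => u p ω) l) ^ 2) ∂P
      ≤ ENNReal.ofReal (dotProduct w ((seqProd b l).mulVec fun i => (v i : ℝ)) ^ 2) +
        ∑ i ∈ Finset.range l, ENNReal.ofReal (d * γ * ‖Matrix.vecMul w (seqProd b i)‖ ^ 2) *
          ENNReal.ofReal (dotProduct 1
            ((seqProd (fun k => b (i + 1 + k)) (l - 1 - i)).mulVec fun i => (v i : ℝ))) := by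
  induction l generalizing w b with
  | zero => simp [quenchedCohort, seqProd, weight_eq_dotProduct]
  | succ l ih =>
    have hb0 : b 0 = R.meanMatrix (e (m + l)) := hb 0 (Nat.succ_pos l)
    have hb' : ∀ i < l, b (i + 1) = R.meanMatrix (e (m + (l - 1 - i))) := by
      intro i hi
      rw [hb (i + 1) (Nat.succ_lt_succ hi)]
      congr 3
      omega
    rw [lintegral_quenchedCohort_succ hu v m l fun β => ENNReal.ofReal (weight w β ^ 2),
      dotProduct_seqProd_succ]
    -- One reproduction step adds `d * γ * ‖w‖ ^ 2` times the mean size of the previous generation.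
    -- This is the term `i = 0` of the sum; the others come from the induction hypothesis for the
    -- test vector `w * b 0`.
    refine (lintegral_mono fun ω => lintegral_weight_offspring_sq_le
      (hu.precomp (cohortIndex_injective m l)) (he _) _ w).trans ?_
    rw [lintegral_add_right', lintegral_const_mul', ← hb0,
      lintegral_weight_quenchedCohort hu he v m l zero_le_one hb',
      Finset.sum_range_succ' _ l]
    · have h1 := ih (w := Matrix.vecMul w (b 0)) (b := fun k => b (k + 1))
        (by rw [hb0]; exact vecMul_nonneg (meanMatrix_nonneg R _) hw) hb'
      refine (add_le_add_left h1 _).trans_eq ?_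
      rw [add_assoc]
      congr 2
      · refine Finset.sum_congr rfl fun i _ => ?_
        rw [Matrix.vecMul_vecMul, ← seqProd_succ', show l + 1 - 1 - (i + 1) = l - 1 - i by omega]
        simp only [add_right_comm _ _ 1]
      · simp [seqProd, add_comm]
    · exact ENNReal.ofReal_ne_top
    · exact (((ENNReal.measurable_ofReal.comp (measurable_weight 1)).comp
        (measurable_quenchedCohort R measurable_const measurable_const
          (measurable_pi_lambda _ hu.measurable) m l)).const_mul _).aemeasurable

/-- Chebyshev's inequality in terms of bounds for the first two moments. -/
theorem measure_le_half_mean {X : Ω → ℝ} (hX : Measurable X) (h0 : ∀ ω, 0 ≤ X ω) {μ s : ℝ}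
    (hμ : 0 < μ) (hs : 0 ≤ s) (h1 : ∫⁻ ω, ENNReal.ofReal (X ω) ∂P = ENNReal.ofReal μ)
    (h2 : ∫⁻ ω, ENNReal.ofReal (X ω ^ 2) ∂P ≤ ENNReal.ofReal (μ ^ 2 + s)) :
    P {ω | X ω ≤ μ / 2} ≤ ENNReal.ofReal (4 * s / μ ^ 2) := by
  have hL : MemLp X 2 P := by
    rw [memLp_two_iff_integrable_sq hX.aestronglyMeasurable]
    refine ⟨(hX.pow_const 2).aestronglyMeasurable, ?_⟩
    rw [hasFiniteIntegral_iff_ofReal (ae_of_all _ fun ω => sq_nonneg _)]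
    exact h2.trans_lt ENNReal.ofReal_lt_top
  have e1 : ∫ ω, X ω ∂P = μ := by
    rw [integral_eq_lintegral_of_nonneg_ae (ae_of_all _ h0) hX.aestronglyMeasurable, h1,
      ENNReal.toReal_ofReal hμ.le]
  have e2 : ∫ ω, X ω ^ 2 ∂P ≤ μ ^ 2 + s := by
    rw [integral_eq_lintegral_of_nonneg_ae (ae_of_all _ fun ω => sq_nonneg _)
      (hX.pow_const 2).aestronglyMeasurable]
    exact ENNReal.toReal_le_of_le_ofReal (by positivity) h2
  have hv : variance X P ≤ s := by
    rw [variance_eq_sub hL, e1]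
    simp only [Pi.pow_apply]
    linarith
  have h3 := meas_ge_le_variance_div_sq hL (half_pos hμ)
  rw [e1] at h3
  refine (measure_mono fun ω (hω : X ω ≤ μ / 2) => ?_).trans (h3.trans ?_)
  · show μ / 2 ≤ |X ω - μ|
    rw [abs_sub_comm]
    exact le_trans (by linarith) (le_abs_self _)
  · refine ENNReal.ofReal_le_ofReal ?_
    rw [div_pow, div_div_eq_mul_div, mul_comm, show (2 : ℝ) ^ 2 = 4 by norm_num]
    gcongr

end

/-! ### Small cohorts -/

section

theorem sum_norm_le_norm_matrix {d : ℕ} (M : Matrix (Fin d) (Fin d) ℝ) (i : Fin d) :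
    ∑ j, |M i j| ≤ ‖M‖ := (norm_matrix_le_iff (norm_nonneg M)).1 le_rfl i

theorem norm_vecMul_le {d : ℕ} (w : Fin d → ℝ) (M : Matrix (Fin d) (Fin d) ℝ) :
    ‖Matrix.vecMul w M‖ ≤ d * (‖w‖ * ‖M‖) := by
  refine (pi_norm_le_iff_of_nonneg (by positivity)).2 fun j => ?_
  calc ‖∑ i, w i * M i j‖ ≤ ∑ i, ‖w i * M i j‖ := norm_sum_le _ _
    _ ≤ ∑ _i : Fin d, ‖w‖ * ‖M‖ := by
        refine Finset.sum_le_sum fun i _ => ?_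
        rw [norm_mul]
        refine mul_le_mul (norm_le_pi_norm w i) ?_ (norm_nonneg _) (norm_nonneg _)
        exact (Finset.single_le_sum (f := fun j => |M i j|) (fun _ _ => abs_nonneg _)
          (Finset.mem_univ j)).trans (sum_norm_le_norm_matrix M i)
    _ = d * (‖w‖ * ‖M‖) := by simp

/-- Rounding down the immigration costs at most a factor two, unless all coordinates are below one.
This is the reason for the case distinction in `smallBound`. -/
theorem norm_le_two_mul_norm_floor {d : ℕ} {y : Fin d → ℝ} (hy : 0 ≤ y) (h1 : 1 ≤ ‖y‖) :
    ‖y‖ ≤ 2 * ‖fun i => (⌊y i⌋₊ : ℝ)‖ := by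
  set v : Fin d → ℝ := fun i => (⌊y i⌋₊ : ℝ) with hv
  have hvi : ∀ i, (⌊y i⌋₊ : ℝ) ≤ ‖v‖ := fun i => (le_abs_self _).trans (norm_le_pi_norm v i)
  have h2 : 1 ≤ ‖v‖ := by
    by_contra h
    refine absurd h1 (not_le.2 ((pi_norm_lt_iff one_pos).2 fun i => ?_))
    rw [Real.norm_of_nonneg (hy i)]
    have h3 := (hvi i).trans_lt (not_le.1 h)
    have h4 : ⌊y i⌋₊ < 1 := by exact_mod_cast h3
    exact (Nat.floor_lt_one (hy i)).1 h4
  refine (pi_norm_le_iff_of_nonneg (by positivity)).2 fun i => ?_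
  rw [Real.norm_of_nonneg (hy i)]
  have := Nat.lt_floor_add_one (y i)
  linarith [hvi i]

variable {Ω E : Type*} [MeasurableSpace Ω] [MeasurableSpace E] {P : Measure Ω}
  [IsProbabilityMeasure P] {d : ℕ} {R : EnvSpace E d} {γ' : ℝ}
  {u : UIndex d → Ω → unitInterval} {T : Set (Matrix (Fin d) (Fin d) ℝ)} {γ κ : ℝ} {K : ℕ}

/-- A cohort is at least half as large as its quenched mean, up to a small probability. -/
theorem IsPrimitiveSet.exists_measure_cohort_le_half [NeZero d] (hT : IsPrimitiveSet T γ κ K)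
    (hγ' : 0 ≤ γ') (hu : IsUniformFamily P u) :
    ∃ C : ℝ, 0 ≤ C ∧ ∀ (e : ℕ → E) (b : ℕ → Matrix (Fin d) (Fin d) ℝ) (m l : ℕ) (v : Fin d → ℕ)
      (w : Fin d → ℝ) (μ : ℝ), (∀ n, e n ∈ R.boundedStates γ') → (∀ i, b i ∈ T) →
      (∀ i < l, b i = R.meanMatrix (e (m + (l - 1 - i)))) → 0 ≤ w → ‖w‖ ≤ 1 → 0 < μ →
      μ ≤ dotProduct w ((seqProd b l).mulVec fun i => (v i : ℝ)) →
      P {ω | weight w (quenchedCohort R e v m (fun p => u p ω) l) ≤ μ / 2} ≤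
        ENNReal.ofReal (C * (‖seqProd b l‖ * ‖fun i => (v i : ℝ)‖ *
          ∑ i ∈ Finset.range l, ‖seqProd b i‖) / μ ^ 2) := by
  obtain ⟨c, hc, hdrop⟩ := hT.exists_mul_norm_seqProd_drop_le
  refine ⟨4 * (d * γ' * d ^ 3 / c), by positivity, fun e b m l v w μ he hbT hb hw hw1 hμ hμle => ?_⟩
  set V : Fin d → ℝ := fun i => (v i : ℝ) with hV
  set μ' := dotProduct w ((seqProd b l).mulVec V) with hμ'
  set s := d * γ' * d ^ 3 / c * (‖seqProd b l‖ * ‖V‖ * ∑ i ∈ Finset.range l, ‖seqProd b i‖) with hs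
  have hV0 : 0 ≤ V := fun i => Nat.cast_nonneg _
  have hμ'0 : 0 < μ' := hμ.trans_le hμle
  have hs0 : 0 ≤ s := by
    have : 0 ≤ ∑ i ∈ Finset.range l, ‖seqProd b i‖ := Finset.sum_nonneg fun i _ => norm_nonneg _
    positivity
  have hterm : ∀ i ∈ Finset.range l, ENNReal.ofReal (d * γ' * ‖Matrix.vecMul w (seqProd b i)‖ ^ 2) *
      ENNReal.ofReal (dotProduct 1 ((seqProd (fun k => b (i + 1 + k)) (l - 1 - i)).mulVec V)) ≤
      ENNReal.ofReal (d * γ' * d ^ 3 / c * (‖seqProd b l‖ * ‖V‖ * ‖seqProd b i‖)) := by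
    intro i hi
    have hil := Finset.mem_range.1 hi
    rw [← ENNReal.ofReal_mul (by positivity)]
    refine ENNReal.ofReal_le_ofReal ?_
    set Q := seqProd (fun k => b (i + 1 + k)) (l - 1 - i) with hQ
    have h1 : ‖Matrix.vecMul w (seqProd b i)‖ ≤ d * ‖seqProd b i‖ := by
      refine (norm_vecMul_le _ _).trans ?_
      gcongr
      exact mul_le_of_le_one_left (norm_nonneg _) hw1
    have h2 : dotProduct 1 (Q.mulVec V) ≤ d * (‖Q‖ * ‖V‖) := by
      rw [one_dotProduct]
      refine (sum_le_norm _).trans ?_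
      gcongr
      exact Matrix.linfty_opNorm_mulVec _ _
    -- The variance term contains the norm of `seqProd b i` twice. One copy recombines with `Q` to
    -- the full product, from which only the factor with index `i` is missing; the other copy
    -- remains in the sum.
    have h3 : ‖seqProd b i‖ * ‖Q‖ ≤ ‖seqProd b l‖ / c := by
      rw [le_div_iff₀ hc, mul_comm]
      have := hdrop b hbT i (l - 1 - i)
      rwa [show i + 1 + (l - 1 - i) = l by omega] at this
    have h4 : 0 ≤ dotProduct 1 (Q.mulVec V) := by
      rw [one_dotProduct]
      exact Finset.sum_nonneg fun j _ =>
        mulVec_nonneg (hT.seqProd_nonneg (fun k => hbT (i + 1 + k)) _) hV0 j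
    calc d * γ' * ‖Matrix.vecMul w (seqProd b i)‖ ^ 2 * dotProduct 1 (Q.mulVec V)
        ≤ d * γ' * (d * ‖seqProd b i‖) ^ 2 * (d * (‖Q‖ * ‖V‖)) := by gcongr
      _ = d * γ' * d ^ 3 * (‖V‖ * ‖seqProd b i‖) * (‖seqProd b i‖ * ‖Q‖) := by ring
      _ ≤ d * γ' * d ^ 3 * (‖V‖ * ‖seqProd b i‖) * (‖seqProd b l‖ / c) := by gcongr
      _ = _ := by ring
  have h2 : ∫⁻ ω, ENNReal.ofReal (weight w (quenchedCohort R e v m (fun p => u p ω) l) ^ 2) ∂P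
      ≤ ENNReal.ofReal (μ' ^ 2 + s) := by
    refine (lintegral_weight_quenchedCohort_sq_le hu he v m l hw hb).trans ?_
    rw [ENNReal.ofReal_add (sq_nonneg _) hs0]
    refine add_le_add_right ((Finset.sum_le_sum hterm).trans_eq ?_) _
    rw [← ENNReal.ofReal_sum_of_nonneg fun i _ => by positivity, hs]
    simp only [Finset.mul_sum]
  have hmeas : Measurable fun ω => weight w (quenchedCohort R e v m (fun p => u p ω) l) :=
    (measurable_weight w).comp (measurable_quenchedCohort R measurable_const measurable_const
      (measurable_pi_lambda _ hu.measurable) m l)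
  have h3 := measure_le_half_mean hmeas (fun ω => weight_nonneg hw _) hμ'0 hs0
    (lintegral_weight_quenchedCohort hu he v m l hw hb) h2
  refine (measure_mono fun ω hω => ?_).trans (h3.trans (ENNReal.ofReal_le_ofReal ?_))
  · exact le_trans (show _ ≤ μ / 2 from hω) (by linarith)
  · rw [mul_assoc 4, ← hs]
    gcongr

/-- A cohort is small with at most the probability of the main upper bound. -/
theorem IsPrimitiveSet.exists_measure_cohort_le [NeZero d] (hT : IsPrimitiveSet T γ κ K)
    (hγ' : 0 ≤ γ') (hu : IsUniformFamily P u) {t : ℝ} (ht : 0 ≤ t) :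
    ∃ C : ℝ, ∀ (e : ℕ → E) (z : ℕ → ARPair d) (m k : ℕ), (∀ n, e n ∈ R.boundedStates γ') →
      (∀ i, mats z i ∈ T) → (∀ i < k, mats z i = R.meanMatrix (e (m + (k - 1 - i)))) →
      0 ≤ (z k).2 → 1 ≤ k →
      P {ω | weight 1 (quenchedCohort R e (fun i => ⌊(z k).2 i⌋₊) m (fun p => u p ω) k) ≤ t} ≤
        smallBound C z k := by
  obtain ⟨c, hc, -, hlow⟩ := hT.exists_mul_norm_le
  obtain ⟨C, hC, hhalf⟩ := hT.exists_measure_cohort_le_half (R := R) hγ' hu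
  -- The first summand comes from Chebyshev's inequality, used when half of the lower bound `μ` for
  -- the mean is at least `t`. Otherwise the second summand makes the quotient in `smallBound` at
  -- least one. Both contain a factor two for the rounding.
  refine ⟨2 * C / c ^ 2 + 4 * t / c, fun e z m k he hzT hz hy hk => ?_⟩
  rw [smallBound]
  split_ifs with h1
  · exact prob_le_one
  refine le_min prob_le_one ?_
  have hy1 := not_lt.1 h1
  set V : Fin d → ℝ := fun i => (⌊(z k).2 i⌋₊ : ℝ) with hV
  have hV0 : 0 ≤ V := fun i => Nat.cast_nonneg _
  have hyV : ‖(z k).2‖ ≤ 2 * ‖V‖ := norm_le_two_mul_norm_floor hy hy1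
  set p := ‖seqProd (mats z) k‖ with hp
  have hp0 : 0 < p := hT.norm_seqProd_pos hzT k
  have hVpos : 0 < ‖V‖ := by linarith
  have hN : 1 ≤ sumNorm z k := by
    have := Finset.single_le_sum (f := fun i => ‖seqProd (mats z) i‖)
      (fun i _ => norm_nonneg _) (Finset.mem_range.2 (show 0 < k by omega))
    simpa [seqProd, sumNorm] using this
  have hden : p * ‖(z k).2‖ ≤ 2 * (p * ‖V‖) := by
    have := mul_le_mul_of_nonneg_left hyV hp0.le
    linarith
  have hden0 : 0 < p * ‖(z k).2‖ := mul_pos hp0 (by linarith)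
  set μ := c * (p * ‖V‖) with hμ
  have hμ0 : 0 < μ := by positivity
  by_cases hcase : t ≤ μ / 2
  · have hμle : μ ≤ dotProduct 1 ((seqProd (mats z) k).mulVec V) := by
      rw [one_dotProduct]
      exact (hlow _ hzT k V hV0).trans
        (norm_le_sum (mulVec_nonneg (hT.seqProd_nonneg hzT k) hV0))
    have h2 := hhalf e (mats z) m k (fun i => ⌊(z k).2 i⌋₊) 1 μ he hzT hz zero_le_one
      (by simp) hμ0 hμle
    refine (measure_mono fun ω hω => ?_).trans (h2.trans (ENNReal.ofReal_le_ofReal ?_))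
    · exact le_trans (show _ ≤ t from hω) hcase
    · have h3 : C * (p * ‖V‖ * ∑ i ∈ Finset.range k, ‖seqProd (mats z) i‖) / μ ^ 2
          = C / c ^ 2 * sumNorm z k / (p * ‖V‖) := by
        rw [hμ, sumNorm]
        field_simp
      rw [h3, div_le_div_iff₀ (by positivity) hden0]
      have hN0 : 0 ≤ sumNorm z k := by linarith
      calc C / c ^ 2 * sumNorm z k * (p * ‖(z k).2‖)
          ≤ C / c ^ 2 * sumNorm z k * (2 * (p * ‖V‖)) := by gcongr
        _ = 2 * C / c ^ 2 * sumNorm z k * (p * ‖V‖) := by ring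
        _ ≤ (2 * C / c ^ 2 + 4 * t / c) * sumNorm z k * (p * ‖V‖) := by
            gcongr
            exact le_add_of_nonneg_right (by positivity)
  · refine prob_le_one.trans ?_
    rw [← ENNReal.ofReal_one]
    refine ENNReal.ofReal_le_ofReal ?_
    rw [one_le_div hden0]
    have h4 : p * ‖V‖ ≤ 2 * t / c := by
      rw [le_div_iff₀ hc]
      rw [hμ] at hcase
      linarith
    calc p * ‖(z k).2‖ ≤ 2 * (p * ‖V‖) := hden
      _ ≤ 4 * t / c := by
          have : 4 * t / c = 2 * (2 * t / c) := by ring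
          linarith
      _ ≤ 2 * C / c ^ 2 + 4 * t / c := le_add_of_nonneg_left (by positivity)
      _ ≤ (2 * C / c ^ 2 + 4 * t / c) * sumNorm z k :=
          le_mul_of_one_le_right (by positivity) hN

/-- Functions of disjoint families of independent random variables. -/
theorem lintegral_prod_of_dependsOn {ι α β : Type*} [MeasurableSpace β] {f : ι → Ω → β}
    (hf : iIndepFun f P) (hm : ∀ i, Measurable (f i)) {G : α → (ι → β) → ENNReal}
    (hG : ∀ k, Measurable (G k)) {S : α → Set ι}
    (hGS : ∀ k x y, (∀ i ∈ S k, x i = y i) → G k x = G k y) (s : Finset α)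
    (hS : (s : Set α).PairwiseDisjoint S) :
    ∫⁻ ω, ∏ k ∈ s, G k (fun i => f i ω) ∂P = ∏ k ∈ s, ∫⁻ ω, G k (fun i => f i ω) ∂P := by
  classical
  have hfm : Measurable fun ω i => f i ω := measurable_pi_lambda _ hm
  induction s using Finset.induction_on with
  | empty => simp
  | insert a s ha ih =>
    have hprod : Measurable fun x : ι → β => ∏ k ∈ s, G k x :=
      Finset.measurable_prod _ fun k _ => hG k
    have hind := indepFun_of_dependsOn hf hm (S := S a) (T := ⋃ k ∈ s, S k) (F := G a)
      (G := fun x => ∏ k ∈ s, G k x)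
      (Set.disjoint_iUnion₂_right.2 fun k hk => hS (Finset.mem_coe.2 (Finset.mem_insert_self a s))
        (Finset.mem_coe.2 (Finset.mem_insert_of_mem hk)) fun h => ha (h ▸ hk)) (hG a) hprod
      (hGS a) (fun x y hxy => Finset.prod_congr rfl fun k hk =>
        hGS k x y fun i hi => hxy i (Set.mem_biUnion (Finset.mem_coe.2 hk) hi))
    simp only [Finset.prod_insert ha]
    rw [← ih (hS.subset (Finset.coe_subset.2 (Finset.subset_insert a s)))]
    exact lintegral_mul_eq_lintegral_mul_lintegral_of_indepFun''
      ((hG a).comp hfm).aemeasurable (hprod.comp hfm).aemeasurable hind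

end

/-! ### The branching process in a fixed environment -/

section

section Quenched

variable {Ω E : Type*} [MeasurableSpace E] {d : ℕ}

/-- The branching process with immigration in the fixed environment `e` with fixed immigration. -/
def quenchedChain (R : EnvSpace E d) (e : ℕ → E) (y : ℕ → Fin d → ℝ) (n : ℕ)
    (u : UIndex d → unitInterval) : Fin d → ℝ := fun i =>
  ((∑ m ∈ Finset.range (n + 1), quenchedCohort R e (fun i => ⌊y m i⌋₊) m u (n - m) i : ℕ) : ℝ)

theorem branchingChain_eq_quenchedChain (R : EnvSpace E d) (Ψ : ℕ → Ω → E) (Y : ℕ → Ω → Fin d → ℝ)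
    (U : ℕ → ℕ → ℕ → Fin d → Ω → unitInterval) (n : ℕ) (ω : Ω) :
    branchingChain R Ψ Y U n ω = quenchedChain R (fun n => Ψ (n + 1) ω) (fun m => Y m ω) n
      fun p => U p.1.1 p.1.2.1 p.1.2.2.1 p.1.2.2.2 ω := by
  funext i
  unfold branchingChain quenchedChain
  simp only [cohort_eq_quenchedCohort]

theorem measurable_quenchedChain (R : EnvSpace E d) (n : ℕ) {α : Type*} [MeasurableSpace α]
    {e : α → ℕ → E} (he : Measurable e) {y : α → ℕ → Fin d → ℝ} (hy : Measurable y)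
    {u : α → UIndex d → unitInterval} (hu : Measurable u) :
    Measurable fun x => quenchedChain R (e x) (y x) n (u x) := by
  refine measurable_pi_lambda _ fun i => Measurable.comp (g := fun n : ℕ => (n : ℝ))
    (measurable_of_countable _) ?_
  refine Finset.measurable_sum _ fun m _ => Measurable.comp (measurable_pi_apply i)
    (measurable_quenchedCohort R he ?_ hu m (n - m))
  exact measurable_pi_lambda _ fun i => Nat.measurable_floor.comp ((measurable_pi_apply i).comp
    ((measurable_pi_apply m).comp hy))

theorem quenchedChain_nonneg (R : EnvSpace E d) (e : ℕ → E) (y : ℕ → Fin d → ℝ) (n : ℕ)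
    (u : UIndex d → unitInterval) : 0 ≤ quenchedChain R e y n u := fun _ => Nat.cast_nonneg _

theorem sum_quenchedChain (R : EnvSpace E d) (e : ℕ → E) (y : ℕ → Fin d → ℝ) (n : ℕ)
    (u : UIndex d → unitInterval) : ∑ i, quenchedChain R e y n u i =
      ∑ m ∈ Finset.range (n + 1),
        weight 1 (quenchedCohort R e (fun i => ⌊y m i⌋₊) m u (n - m)) := by
  simp only [quenchedChain, weight, Pi.one_apply, one_mul, Nat.cast_sum]
  exact Finset.sum_comm

variable [MeasurableSpace Ω] {P : Measure Ω} [IsProbabilityMeasure P]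
  {R : EnvSpace E d} {γ' : ℝ} {u : UIndex d → Ω → unitInterval}
  {T : Set (Matrix (Fin d) (Fin d) ℝ)} {γ κ : ℝ} {K : ℕ}

/-- Cohorts with different immigration times use disjoint sets of uniform variables, so they are
independent in a fixed environment, and a bounded total forces each of them to be bounded. The
cohort of time `n - k` has age `k`; accordingly `z` lists the environment backwards from time `n`.
-/
theorem IsPrimitiveSet.exists_measure_quenchedChain_le [NeZero d] (hT : IsPrimitiveSet T γ κ K)
    (hγ' : 0 ≤ γ') (hu : IsUniformFamily P u) {b : ℝ} (hb : 0 ≤ b) :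
    ∃ C : ℝ, ∀ (e : ℕ → E) (y : ℕ → Fin d → ℝ) (z : ℕ → ARPair d) (n : ℕ),
      (∀ n, e n ∈ R.boundedStates γ') → (∀ i, mats z i ∈ T) → (∀ i, 0 ≤ y i) →
      (∀ i < n, mats z i = R.meanMatrix (e (n - 1 - i))) → (∀ i < n, (z i).2 = y (n - i)) →
      P {ω | ‖quenchedChain R e y n fun p => u p ω‖ ≤ b} ≤
        ∏ k ∈ Finset.Ico 1 n, smallBound C z k := by
  obtain ⟨C, hC⟩ := hT.exists_measure_cohort_le (R := R) hγ' hu (t := d * b) (by positivity)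
  refine ⟨C, fun e y z n he hzT hy hz hzy => ?_⟩
  set B : ℕ → (UIndex d → unitInterval) → Fin d → ℕ := fun k x =>
    quenchedCohort R e (fun i => ⌊y (n - k) i⌋₊) (n - k) x k with hB
  have hBm : ∀ k, Measurable (B k) := fun k =>
    measurable_quenchedCohort R measurable_const measurable_const measurable_id _ _
  have hset : ∀ k, MeasurableSet {x | weight 1 (B k x) ≤ d * b} := fun k =>
    measurableSet_le ((measurable_weight 1).comp (hBm k)) measurable_const
  set G : ℕ → (UIndex d → unitInterval) → ENNReal := fun k =>
    {x | weight 1 (B k x) ≤ d * b}.indicator 1 with hG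
  have hGS : ∀ k (x x' : UIndex d → unitInterval), (∀ p ∈ {p : UIndex d | p.1.1 = n - k},
      x p = x' p) → G k x = G k x' := by
    intro k x x' hxx
    have : B k x = B k x' := quenchedCohort_congr R e _ _ _ fun p hp _ => hxx p hp
    simp only [hG, Set.indicator, Set.mem_ofPred_eq, this, Pi.one_apply]
  have hum : Measurable fun ω p => u p ω := measurable_pi_lambda _ hu.measurable
  have hchain : Measurable fun ω => quenchedChain R e y n fun p => u p ω :=
    measurable_quenchedChain R n measurable_const measurable_const hum
  have h1 := lintegral_prod_of_dependsOn hu.indep hu.measurable (G := G)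
    (fun k => measurable_one.indicator (hset k)) (S := fun k => {p | p.1.1 = n - k})
    hGS (Finset.Ico 1 n) (by
      intro k hk k' hk' hne
      refine Set.disjoint_left.2 fun p (hp : p.1.1 = n - k) (hp' : p.1.1 = n - k') => ?_
      have := Finset.mem_Ico.1 (Finset.mem_coe.1 hk)
      have := Finset.mem_Ico.1 (Finset.mem_coe.1 hk')
      omega)
  have h2 : ∀ k ∈ Finset.Ico 1 n, ∫⁻ ω, G k (fun p => u p ω) ∂P ≤ smallBound C z k := by
    intro k hk
    obtain ⟨hk1, hkn⟩ := Finset.mem_Ico.1 hk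
    have h3 : ∫⁻ ω, G k (fun p => u p ω) ∂P
        = P {ω | weight 1 (B k fun p => u p ω) ≤ d * b} :=
      lintegral_indicator_one ((hset k).preimage hum)
    have h4 := hC e z (n - k) k he hzT
      (fun i hi => by rw [hz i (hi.trans hkn)]; congr 2; omega)
      (by rw [hzy k hkn]; exact hy _) hk1
    rw [hzy k hkn] at h4
    exact h3.trans_le h4
  refine le_trans ?_ (h1.trans_le (Finset.prod_le_prod' h2))
  have hsm : MeasurableSet {ω | ‖quenchedChain R e y n fun p => u p ω‖ ≤ b} :=
    measurableSet_le (measurable_norm.comp hchain) measurable_const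
  rw [← lintegral_indicator_one hsm]
  refine lintegral_mono fun ω => ?_
  refine Set.indicator_apply_le' (fun hω => ?_) fun _ => zero_le
  rw [Pi.one_apply]
  refine Finset.one_le_prod' fun k hk => ?_
  obtain ⟨hk1, hkn⟩ := Finset.mem_Ico.1 hk
  suffices hmem : weight 1 (B k fun p => u p ω) ≤ d * b from
    (Set.indicator_of_mem (s := {x | weight 1 (B k x) ≤ d * b}) hmem 1).symm.le
  have h5 : ‖quenchedChain R e y n fun p => u p ω‖ ≤ b := hω
  refine le_trans ?_ ((sum_le_norm _).trans (mul_le_mul_of_nonneg_left h5 (Nat.cast_nonneg d)))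
  rw [sum_quenchedChain]
  have h6 := Finset.single_le_sum (f := fun m => weight 1 (quenchedCohort R e
    (fun i => ⌊y m i⌋₊) m (fun p => u p ω) (n - m))) (fun m _ => weight_nonneg zero_le_one _)
    (Finset.mem_range.2 (show n - k < n + 1 by omega))
  simp only [show n - (n - k) = k by omega] at h6
  exact h6

/-- The quenched mean of the branching process is at most the autoregressive sum. -/
theorem lintegral_sum_quenchedChain_le (hu : IsUniformFamily P u) {e : ℕ → E}
    {y : ℕ → Fin d → ℝ} {z : ℕ → ARPair d} {n : ℕ} (he : ∀ n, e n ∈ R.boundedStates γ')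
    (hz0 : ∀ i j k, 0 ≤ mats z k i j) (hy : ∀ i, 0 ≤ y i) (hy0 : y 0 = 0)
    (hz : ∀ i < n, mats z i = R.meanMatrix (e (n - 1 - i))) (hzy : ∀ i < n, (z i).2 = y (n - i)) :
    ∫⁻ ω, ENNReal.ofReal (∑ i, quenchedChain R e y n (fun p => u p ω) i) ∂P
      ≤ ENNReal.ofReal (∑ i, transportSum z n i) := by
  have hnn : ∀ k, 0 ≤ (seqProd (mats z) k).mulVec fun i => (⌊y (n - k) i⌋₊ : ℝ) := fun k =>
    mulVec_nonneg (seqProd_nonneg (fun k i j => hz0 i j k) k) fun i => Nat.cast_nonneg _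
  have h1 : ∀ m ∈ Finset.range (n + 1), ∫⁻ ω, ENNReal.ofReal (weight 1 (quenchedCohort R e
      (fun i => ⌊y m i⌋₊) m (fun p => u p ω) (n - m))) ∂P
      = ENNReal.ofReal (∑ i, ((seqProd (mats z) (n - m)).mulVec
          fun i => (⌊y m i⌋₊ : ℝ)) i) := by
    intro m hm
    have hm' := Finset.mem_range.1 hm
    rw [lintegral_weight_quenchedCohort hu he _ m (n - m) zero_le_one (b := mats z)
      (fun i hi => by rw [hz i (by omega)]; congr 2; omega), one_dotProduct]
  simp only [sum_quenchedChain]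
  simp only [ENNReal.ofReal_sum_of_nonneg fun m _ => weight_nonneg zero_le_one _]
  have hm : ∀ m ∈ Finset.range (n + 1), Measurable fun ω => ENNReal.ofReal (weight 1
      (quenchedCohort R e (fun i => ⌊y m i⌋₊) m (fun p => u p ω) (n - m))) := fun m _ =>
    (ENNReal.measurable_ofReal.comp (measurable_weight 1)).comp
      (measurable_quenchedCohort R measurable_const measurable_const
        (measurable_pi_lambda _ hu.measurable) m _)
  rw [lintegral_finsetSum _ hm, Finset.sum_congr rfl h1, ← ENNReal.ofReal_sum_of_nonneg]
  · refine ENNReal.ofReal_le_ofReal ?_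
    -- Summing over ages instead of immigration times leaves the additional age `n`, which
    -- contributes nothing because `y 0 = 0`. Rounding down only decreases the remaining terms.
    rw [← Finset.sum_range_reflect, Finset.sum_range_succ, transportSum]
    simp only [Finset.sum_apply]
    rw [Finset.sum_comm (s := Finset.univ)]
    have h2 : n + 1 - 1 - n = 0 := by omega
    simp only [h2, hy0]
    have h3 : (fun i : Fin d => ((⌊(0 : Fin d → ℝ) i⌋₊ : ℕ) : ℝ)) = 0 := by
      funext i; simp
    rw [h3, Matrix.mulVec_zero]
    simp only [Pi.zero_apply, Finset.sum_const_zero, add_zero]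
    refine Finset.sum_le_sum fun k hk => Finset.sum_le_sum fun i _ => ?_
    have hk' := Finset.mem_range.1 hk
    rw [show n + 1 - 1 - k = n - k by omega, show n - (n - k) = k by omega, hzy k hk']
    exact mulVec_mono (seqProd_nonneg (fun k i j => hz0 i j k) k)
      (fun i => Nat.floor_le (hy _ i)) i
  · intro m hm
    have := hnn (n - m)
    rw [show n - (n - m) = m by have := Finset.mem_range.1 hm; omega] at this
    exact Finset.sum_nonneg fun i _ => this i

theorem half_le_measure_of_compl_le {s t : Set Ω} (hst : sᶜ ⊆ t) (ht : P t ≤ 1 / 2) :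
    1 / 2 ≤ P s := by
  have h1 : P Set.univ ≤ P s + 1 / 2 := by
    rw [← Set.union_compl_self s]
    exact (measure_union_le _ _).trans (add_le_add_right ((measure_mono hst).trans ht) _)
  rw [measure_univ, ← tsub_le_iff_right] at h1
  have h2 : (1 : ENNReal) - 1 / 2 = 1 / 2 := by rw [one_div, ENNReal.one_sub_inv_two]
  rwa [h2] at h1

/-- Markov's inequality for the total population, whose quenched mean is at most `d` times the norm
of the transported sum. -/
theorem half_le_measure_quenchedChain_le [NeZero d] (hu : IsUniformFamily P u) {e : ℕ → E}
    {y : ℕ → Fin d → ℝ} {z : ℕ → ARPair d} {n : ℕ} (he : ∀ n, e n ∈ R.boundedStates γ')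
    (hz0 : ∀ i j k, 0 ≤ mats z k i j) (hy : ∀ i, 0 ≤ y i) (hy0 : y 0 = 0)
    (hz : ∀ i < n, mats z i = R.meanMatrix (e (n - 1 - i))) (hzy : ∀ i < n, (z i).2 = y (n - i))
    {b : ℝ} (hb : 0 < b) (hzb : ‖transportSum z n‖ ≤ b) :
    1 / 2 ≤ P {ω | ‖quenchedChain R e y n fun p => u p ω‖ ≤ 2 * (d * b)} := by
  have hd : (0 : ℝ) < d := by exact_mod_cast Nat.pos_of_ne_zero (NeZero.ne d)
  have hdb : 0 < d * b := mul_pos hd hb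
  refine half_le_measure_of_compl_le (t := {ω | ENNReal.ofReal (2 * (d * b)) ≤
    ENNReal.ofReal (∑ i, quenchedChain R e y n (fun p => u p ω) i)}) (fun ω hω => ?_) ?_
  · have h1 : 2 * (d * b) < ‖quenchedChain R e y n fun p => u p ω‖ := not_le.1 hω
    exact ENNReal.ofReal_le_ofReal (h1.le.trans (norm_le_sum (quenchedChain_nonneg R e y n _)))
  · have h2 : ENNReal.ofReal (2 * (d * b)) ≠ 0 := by
      rw [Ne, ENNReal.ofReal_eq_zero, not_le]; linarith
    have hm : Measurable fun ω =>
        ENNReal.ofReal (∑ i, quenchedChain R e y n (fun p => u p ω) i) := by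
      have hc : Measurable fun ω => quenchedChain R e y n fun p => u p ω :=
        measurable_quenchedChain R n measurable_const measurable_const
          (measurable_pi_lambda _ hu.measurable)
      exact ENNReal.measurable_ofReal.comp (Finset.measurable_sum _ fun i _ =>
        (measurable_pi_apply i).comp hc)
    refine (meas_ge_le_lintegral_div hm.aemeasurable h2 ENNReal.ofReal_ne_top).trans ?_
    refine (ENNReal.div_le_div_right
      (lintegral_sum_quenchedChain_le hu he hz0 hy hy0 hz hzy) _).trans ?_
    refine (ENNReal.div_le_div_right (ENNReal.ofReal_le_ofReal
      ((sum_le_norm _).trans (mul_le_mul_of_nonneg_left hzb hd.le))) _).trans_eq ?_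
    rw [← ENNReal.ofReal_div_of_pos (by linarith), show d * b / (2 * (d * b)) = 1 / 2 by field_simp,
      ENNReal.ofReal_div_of_pos two_pos]
    simp

theorem IsPrimitiveSet.exists_half_le_measure_quenchedChain [NeZero d]
    (hT : IsPrimitiveSet T γ κ K) (hγ' : 0 ≤ γ') (hu : IsUniformFamily P u) (x : Fin d → ℝ) :
    ∃ r : ℝ, ∀ (e : ℕ → E) (y : ℕ → Fin d → ℝ) (b : ℕ → Matrix (Fin d) (Fin d) ℝ),
      (∀ n, e n ∈ R.boundedStates γ') → (∀ i, b i ∈ T) →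
      (∀ i < K, b i = R.meanMatrix (e (K - i))) → 0 ≤ y 1 → r < ‖y 1‖ →
      1 / 2 ≤ P {ω | x ≤ quenchedChain R e y (K + 1) fun p => u p ω} := by
  obtain ⟨C, hC, hhalf⟩ := hT.exists_measure_cohort_le_half (R := R) hγ' hu
  have hκ := hT.pos
  have hγ := hT.one_le
  have hd : (0 : ℝ) < d := by exact_mod_cast Nat.pos_of_ne_zero (NeZero.ne d)
  set D : ℝ := C * (γ ^ K * (K * γ ^ K)) / κ ^ 2 with hD
  have hD0 : 0 ≤ D := by positivity
  -- Only the cohort of time `1` is used, observed `K` steps later. The three bounds make, in this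
  -- order, the rounding cost at most a factor two, the Chebyshev errors `D / ‖V‖` of the `d` types
  -- add up to at most `1 / 2`, and half of the mean `κ * ‖V‖` exceed all coordinates of `x`.
  refine ⟨max 1 (max (4 * (d * D)) (4 * ‖x‖ / κ)), fun e y b he hbT hb hy hr => ?_⟩
  have h1 : 1 < ‖y 1‖ := (le_max_left _ _).trans_lt hr
  have h2 : 4 * (d * D) < ‖y 1‖ := ((le_max_left _ _).trans (le_max_right _ _)).trans_lt hr
  have h3 : 4 * ‖x‖ / κ < ‖y 1‖ := ((le_max_right _ _).trans (le_max_right _ _)).trans_lt hr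
  set V : Fin d → ℝ := fun i => (⌊y 1 i⌋₊ : ℝ) with hV
  have hV0 : 0 ≤ V := fun i => Nat.cast_nonneg _
  have hyV : ‖y 1‖ ≤ 2 * ‖V‖ := norm_le_two_mul_norm_floor hy h1.le
  have hVpos : 0 < ‖V‖ := by linarith
  set B : Ω → Fin d → ℕ := fun ω =>
    quenchedCohort R e (fun i => ⌊y 1 i⌋₊) 1 (fun p => u p ω) K with hB
  have hxV : ‖x‖ ≤ κ * ‖V‖ / 2 := by
    rw [div_lt_iff₀ hκ] at h3
    have := mul_le_mul_of_nonneg_left hyV hκ.le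
    linarith
  have hpow : ∀ i ∈ Finset.range K, ‖seqProd b i‖ ≤ γ ^ K := fun i hi =>
    (hT.norm_seqProd_le hbT i).trans (pow_le_pow_right₀ hγ (Finset.mem_range.1 hi).le)
  have hsum : ∑ i ∈ Finset.range K, ‖seqProd b i‖ ≤ K * γ ^ K := by
    simpa using Finset.sum_le_card_nsmul _ _ _ hpow
  have hone : ∀ i, P {ω | weight (Pi.single i 1) (B ω) ≤ κ * ‖V‖ / 2} ≤
      ENNReal.ofReal (D / ‖V‖) := by
    intro i
    have h4 := hhalf e b 1 K (fun i => ⌊y 1 i⌋₊) (Pi.single i 1) (κ * ‖V‖) he hbT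
      (fun j hj => by rw [hb j hj]; congr 2; omega)
      (Pi.single_nonneg.2 zero_le_one) (by simp [Pi.norm_single]) (by positivity)
      (by rw [single_one_dotProduct]; exact hT.le_seqProd_mulVec hbT hV0 i)
    refine h4.trans (ENNReal.ofReal_le_ofReal ?_)
    calc C * (‖seqProd b K‖ * ‖V‖ * ∑ i ∈ Finset.range K, ‖seqProd b i‖) / (κ * ‖V‖) ^ 2
        ≤ C * (γ ^ K * ‖V‖ * (K * γ ^ K)) / (κ * ‖V‖) ^ 2 := by
          have h5 := hT.norm_seqProd_le hbT K
          have h6 : 0 ≤ ∑ i ∈ Finset.range K, ‖seqProd b i‖ :=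
            Finset.sum_nonneg fun _ _ => norm_nonneg _
          gcongr
      _ = D / ‖V‖ := by rw [hD]; field_simp
  refine half_le_measure_of_compl_le
    (t := ⋃ i, {ω | weight (Pi.single i 1) (B ω) ≤ κ * ‖V‖ / 2}) (fun ω hω => ?_) ?_
  · have h4 : ¬ x ≤ quenchedChain R e y (K + 1) fun p => u p ω := hω
    rw [Pi.le_def, not_forall] at h4
    obtain ⟨i, hi⟩ := h4
    refine Set.mem_iUnion.2 ⟨i, ?_⟩
    have h5 : weight (Pi.single i 1) (B ω) = B ω i := by
      rw [weight_eq_dotProduct, single_one_dotProduct]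
    have h6 : (B ω i : ℝ) ≤ quenchedChain R e y (K + 1) (fun p => u p ω) i := by
      rw [quenchedChain, Nat.cast_le]
      have := Finset.single_le_sum (f := fun m => quenchedCohort R e
        (fun i => ⌊y m i⌋₊) m (fun p => u p ω) (K + 1 - m) i) (fun m _ => Nat.zero_le _)
        (Finset.mem_range.2 (show 1 < K + 1 + 1 by omega))
      simpa using this
    show weight (Pi.single i 1) (B ω) ≤ κ * ‖V‖ / 2
    rw [h5]
    have h7 := (le_abs_self _).trans (norm_le_pi_norm x i)
    linarith [not_le.1 hi]
  · refine (measure_iUnion_le _).trans ?_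
    rw [tsum_fintype]
    refine (Finset.sum_le_sum fun i _ => hone i).trans ?_
    rw [Finset.sum_const, Finset.card_univ, Fintype.card_fin, nsmul_eq_mul,
      ← ENNReal.ofReal_natCast, ← ENNReal.ofReal_mul hd.le,
      show (1 / 2 : ENNReal) = ENNReal.ofReal (1 / 2) by
        rw [ENNReal.ofReal_div_of_pos two_pos]; simp]
    refine ENNReal.ofReal_le_ofReal ?_
    rw [← mul_div_assoc, div_le_iff₀ hVpos]
    linarith

end Quenched

end

/-! ### The branching process in random environment -/

section

variable {Ω E : Type*} [MeasurableSpace Ω] [MeasurableSpace E] {P : Measure Ω} {d : ℕ}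
  {A : ℕ → Ω → Matrix (Fin d) (Fin d) ℝ} {Y : ℕ → Ω → Fin d → ℝ} {Ψ : ℕ → Ω → E}
  {U : ℕ → ℕ → ℕ → Fin d → Ω → unitInterval} {R : EnvSpace E d}

namespace IsBranchingData

theorem isUniformFamily (h : IsBranchingData P Ψ Y U) :
    IsUniformFamily P fun (p : UIndex d) ω => U p.1.1 p.1.2.1 p.1.2.2.1 p.1.2.2.2 ω :=
  ⟨fun p => h.measurable_U _ _ _ _ p.2, fun p => h.uniform_U _ _ _ _ p.2, h.indep_U⟩

theorem measurable_env (h : IsBranchingData P Ψ Y U) :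
    Measurable fun ω (n : ℕ) => Ψ (n + 1) ω :=
  measurable_pi_lambda _ fun n => measurable_fst.comp (h.measurable_pair n)

theorem measurable_immigration (h : IsBranchingData P Ψ Y U) :
    Measurable fun ω (n : ℕ) => Y n ω := by
  refine measurable_pi_lambda _ fun n => ?_
  cases n with
  | zero => exact h.measurable_Y_zero
  | succ n => exact measurable_snd.comp (h.measurable_pair n)

theorem fromZero [IsProbabilityMeasure P] (h : IsBranchingData P Ψ Y U) :
    IsBranchingData P Ψ (fromZero Y) U where
  nonneg_Y n ω i := by
    cases n with
    | zero => exact le_rfl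
    | succ n => exact h.nonneg_Y (n + 1) ω i
  measurable_pair := h.measurable_pair
  measurable_Y_zero := measurable_const
  indep := h.indep
  identDistrib := h.identDistrib
  indep_zero := indepFun_const_left (0 : Fin d → ℝ) _
  measurable_U := h.measurable_U
  uniform_U := h.uniform_U
  indep_U := h.indep_U
  indep_U_env := by
    have hm : Measurable fun y : ℕ → Fin d → ℝ => Function.update y 0 0 := by
      refine measurable_pi_lambda _ fun n => ?_
      cases n with
      | zero => exact measurable_const
      | succ n => exact measurable_pi_apply (n + 1)
    have h1 := h.indep_U_env.comp (measurable_fst.prodMk (hm.comp measurable_snd)) measurable_id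
    have h2 : (fun ω => ((fun n => Ψ (n + 1) ω, fun n => SubcriticalAR.fromZero Y n ω) :
        (ℕ → E) × (ℕ → Fin d → ℝ))) =
        fun ω => (fun n => Ψ (n + 1) ω, Function.update (fun n => Y n ω) 0 0) := by
      funext ω
      refine Prod.ext rfl (funext fun n => ?_)
      cases n <;> rfl
    rw [h2]
    exact h1

/-- The environment and the immigration can be frozen. -/
theorem measure_branchingChain_mem [IsProbabilityMeasure P] (h : IsBranchingData P Ψ Y U) (n : ℕ)
    {s : Set (Fin d → ℝ)} (hs : MeasurableSet s) :
    P {ω | branchingChain R Ψ Y U n ω ∈ s} = ∫⁻ ω, P {ω' | quenchedChain R (fun n => Ψ (n + 1) ω)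
      (fun m => Y m ω) n (fun p => U p.1.1 p.1.2.1 p.1.2.2.1 p.1.2.2.2 ω') ∈ s} ∂P := by
  have hum : Measurable fun ω (p : UIndex d) => U p.1.1 p.1.2.1 p.1.2.2.1 p.1.2.2.2 ω :=
    measurable_pi_lambda _ h.isUniformFamily.measurable
  have hq : Measurable fun x : ((ℕ → E) × (ℕ → Fin d → ℝ)) × (UIndex d → unitInterval) =>
      quenchedChain R x.1.1 x.1.2 n x.2 :=
    measurable_quenchedChain R n (measurable_fst.comp measurable_fst)
      (measurable_snd.comp measurable_fst) measurable_snd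
  have h1 : ∫⁻ ω, s.indicator 1 (branchingChain R Ψ Y U n ω) ∂P =
      ∫⁻ ω, ∫⁻ ω', s.indicator 1 (quenchedChain R (fun n => Ψ (n + 1) ω)
        (fun m => Y m ω) n (fun p => U p.1.1 p.1.2.1 p.1.2.2.1 p.1.2.2.2 ω')) ∂P ∂P := by
    simp only [branchingChain_eq_quenchedChain]
    exact lintegral_of_indepFun
      (X := fun ω => ((fun n => Ψ (n + 1) ω, fun n => Y n ω) : (ℕ → E) × (ℕ → Fin d → ℝ)))
      (Z := fun ω (p : UIndex d) => U p.1.1 p.1.2.1 p.1.2.2.1 p.1.2.2.2 ω)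
      (h.measurable_env.prodMk h.measurable_immigration) hum h.indep_U_env
      (φ := fun x => s.indicator 1 (quenchedChain R x.1.1 x.1.2 n x.2))
      ((measurable_one.indicator hs).comp hq)
  have h2 : ∀ ω, Measurable fun ω' => quenchedChain R (fun n => Ψ (n + 1) ω)
      (fun m => Y m ω) n (fun p => U p.1.1 p.1.2.1 p.1.2.2.1 p.1.2.2.2 ω') := fun ω =>
    measurable_quenchedChain R n measurable_const measurable_const hum
  have h3 : Measurable fun ω => branchingChain R Ψ Y U n ω := by
    simp only [branchingChain_eq_quenchedChain]
    exact measurable_quenchedChain R n h.measurable_env h.measurable_immigration hum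
  have h4 : ∀ {f : Ω → Fin d → ℝ}, Measurable f →
      P {ω | f ω ∈ s} = ∫⁻ ω, s.indicator 1 (f ω) ∂P := fun hf =>
    (lintegral_indicator_one (hf hs)).symm
  rw [h4 h3, h1]
  exact lintegral_congr fun ω => (h4 (h2 ω)).symm

theorem ae_boundedStates (h : IsBranchingData P Ψ Y U) {γ : ℝ}
    (hγ : ∀ᵐ ω ∂P, Ψ 1 ω ∈ R.boundedStates γ) :
    ∀ᵐ ω ∂P, ∀ n, Ψ (n + 1) ω ∈ R.boundedStates γ :=
  IsIID.ae_forall (ζ := envPair Ψ Y) ⟨h.measurable_pair, h.indep, h.identDistrib⟩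
    ((R.measurableSet_boundedStates γ).preimage measurable_fst) hγ

end IsBranchingData

variable [IsProbabilityMeasure P] [NeZero d] {T : Set (Matrix (Fin d) (Fin d) ℝ)} {γ κ : ℝ} {K : ℕ}

theorem rr_of_zr (h : PrimitiveIID P (arPair A Y) T γ κ K) {lam C₀ c y : ℝ} (hlam : 0 < lam)
    (hc : 0 < c)
    (hconc : ∀ n : ℕ, 1 ≤ n → ∀ t : ℝ, 0 ≤ t →
      P.real {ω | t ≤ |decay (fun k => arPair A Y k ω) n - n * lam|}
        ≤ C₀ * Real.exp (-(c * t ^ 2 / n)))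
    (hreg : REG P Y lam) (hy : 0 < y) (hf : 0 < P {ω | ‖Y 1 ω‖ ≤ y})
    (hB : IsBranchingData P Ψ Y U) (hA : ∀ n, ∀ᵐ ω ∂P, A (n + 1) ω = R.meanMatrix (Ψ (n + 1) ω))
    (hBD2 : BD2 P R Ψ) (hzr : ZR P R Ψ Y U) : RR P Y lam y := by
  obtain ⟨-, b, hb, hsum⟩ := hzr
  obtain ⟨γ', hγ'⟩ := hBD2
  have hB0 := hB.fromZero
  obtain ⟨C, hC⟩ := h.prim.exists_measure_quenchedChain_le (R := R) (Nat.cast_nonneg γ')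
    hB.isUniformFamily hb.le
  refine rr_of_tsum_eq_top h hlam hc hconc hreg hy hf (C := C) (fun n => ?_) hsum
  -- The quenched bound is a product along the environment read backwards from time `n`; integrated
  -- over the environment, it has the same expectation as along the original order.
  have hrev := (h.iid.identDistrib_reindex (revIndex_injective n)).comp
    (Finset.measurable_prod (Finset.Ico 1 n) fun k _ => measurable_smallBound C k)
  refine le_trans ?_ hrev.lintegral_eq.le
  refine (hB0.measure_branchingChain_mem n
    (measurableSet_le measurable_norm measurable_const)).trans_le (lintegral_mono_ae ?_)
  filter_upwards [hB.ae_boundedStates hγ', ae_all_iff.2 hA, h.mem] with ω hω hAω hmem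
  refine hC _ _ (fun k => arPair A Y (revIndex n k) ω) n hω (fun i => hmem _)
    (fun i => hB0.nonneg_Y i ω) (fun i hi => ?_) fun i hi => ?_
  · rw [← hAω (n - 1 - i), ← revIndex_of_lt hi]
    rfl
  · rw [revIndex_of_lt hi, show n - i = n - 1 - i + 1 by omega]
    rfl

theorem isIrreducible_branchingChain (hdata : IsARData P A Y)
    (h : PrimitiveIID P (arPair A Y) T γ κ K)
    (hB : IsBranchingData P Ψ Y U) (hA : ∀ n, ∀ᵐ ω ∂P, A (n + 1) ω = R.meanMatrix (Ψ (n + 1) ω))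
    (hBD2 : BD2 P R Ψ) : IsIrreducible P (branchingChain R Ψ (fromZero Y) U) := by
  intro x _
  obtain ⟨γ', hγ'⟩ := hBD2
  have hB0 := hB.fromZero
  obtain ⟨r, hr⟩ := h.prim.exists_half_le_measure_quenchedChain (R := R) (Nat.cast_nonneg γ')
    hB.isUniformFamily x
  have hY : Measurable (Y 1) := measurable_snd.comp (h.iid.measurable 0)
  have hset : MeasurableSet {ω | r < ‖Y 1 ω‖} :=
    measurableSet_lt measurable_const (measurable_norm.comp hY)
  refine ⟨K + 1, lt_of_lt_of_le (ENNReal.mul_pos (ENNReal.half_pos one_ne_zero).ne'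
    (hdata.unbounded r).ne')
    (le_trans ?_ (hB0.measure_branchingChain_mem (R := R) (K + 1) (measurableSet_Ici (a := x))).symm.le)⟩
  rw [← lintegral_indicator_const hset (1 / 2)]
  refine lintegral_mono_ae ?_
  filter_upwards [hB.ae_boundedStates hγ', ae_all_iff.2 hA, h.mem] with ω hω hAω hmem
  refine Set.indicator_apply_le' (fun hωr => ?_) fun _ => zero_le
  refine hr _ (fun m => fromZero Y m ω)
    (mats fun k => arPair A Y (revIndex (K + 1) k) ω) hω (fun i => hmem _) (fun i hi => ?_)
    (fun i => hB.nonneg_Y 1 ω i) hωr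
  rw [← hAω (K - i), show K - i = revIndex (K + 1) i by rw [revIndex_of_lt (by omega)]; omega]
  rfl

/-- The autoregressive chain in the actual environment bounds the quenched mean of `Z`. So wherever
that chain is at most `b`, the branching process is bounded with conditional probability at least
one half, and the divergent series is inherited. -/
theorem zr_of_xr (hdata : IsARData P A Y) (h : PrimitiveIID P (arPair A Y) T γ κ K)
    (hB : IsBranchingData P Ψ Y U) (hA : ∀ n, ∀ᵐ ω ∂P, A (n + 1) ω = R.meanMatrix (Ψ (n + 1) ω))
    (hBD2 : BD2 P R Ψ) (hxr : XR P A Y) : ZR P R Ψ Y U := by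
  refine ⟨isIrreducible_branchingChain hdata h hB hA hBD2, ?_⟩
  obtain ⟨-, b, hb, hsum⟩ := hxr
  obtain ⟨γ', hγ'⟩ := hBD2
  have hB0 := hB.fromZero
  have hd : (0 : ℝ) < d := by exact_mod_cast Nat.pos_of_ne_zero (NeZero.ne d)
  refine ⟨2 * (d * b), by positivity, ?_⟩
  have hle : ∀ n, 1 / 2 * P {ω | ‖arChain A (fromZero Y) n ω‖ ≤ b} ≤
      P {ω | ‖branchingChain R Ψ (fromZero Y) U n ω‖ ≤ 2 * (d * b)} := by
    intro n
    have hset : MeasurableSet {ω | ‖transportSum (fun k => arPair A Y (revIndex n k) ω) n‖ ≤ b} :=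
      measurableSet_le (measurable_norm.comp ((measurable_transportSum n).comp
        (measurable_pi_lambda _ fun k => h.iid.measurable _))) measurable_const
    simp only [arChain_eq_transportSum]
    rw [← lintegral_indicator_const hset (1 / 2)]
    refine le_trans (lintegral_mono_ae ?_) (hB0.measure_branchingChain_mem n
      (measurableSet_le measurable_norm measurable_const)).symm.le
    filter_upwards [hB.ae_boundedStates hγ', ae_all_iff.2 hA, h.mem] with ω hω hAω hmem
    refine Set.indicator_apply_le' (fun hωb => ?_) fun _ => zero_le
    refine half_le_measure_quenchedChain_le hB.isUniformFamily
      (z := fun k => arPair A Y (revIndex n k) ω) hω (fun i j k => hdata.nonneg_A _ ω i j)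
      (fun i => hB0.nonneg_Y i ω) rfl (fun i hi => ?_) (fun i hi => ?_) hb hωb
    · rw [← hAω (n - 1 - i), ← revIndex_of_lt hi]
      rfl
    · rw [revIndex_of_lt hi, show n - i = n - 1 - i + 1 by omega]
      rfl
  refine top_le_iff.1 (le_trans ?_ (ENNReal.tsum_le_tsum hle))
  rw [ENNReal.tsum_mul_left, hsum, ENNReal.mul_top (by simp)]

end

end

end SubcriticalAR

/-! ### The Lyapunov exponent and the equivalences -/

theorem theorem4p1 {Ω : Type*} [MeasurableSpace Ω] (P : MeasureTheory.Measure Ω)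
    [MeasureTheory.IsProbabilityMeasure P] {d : ℕ} [NeZero d]
    (A : ℕ → Ω → Matrix (Fin d) (Fin d) ℝ) (Y : ℕ → Ω → Fin d → ℝ)
    (hdata : SubcriticalAR.IsARData P A Y)
    (hBD1 : SubcriticalAR.BD1 P A) (hPR : SubcriticalAR.PR P A) :
    ∃ lam : ℝ, SubcriticalAR.IsNegLyapunov P A lam ∧
      (0 < lam → SubcriticalAR.REG P Y lam →
        ∀ y : ℝ, 0 < y → 0 < P {ω | ‖Y 1 ω‖ ≤ y} →
          List.TFAE [SubcriticalAR.XR P A Y, SubcriticalAR.MR P A Y,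
            SubcriticalAR.RR P Y lam y] ∧
          ∀ (E : Type*) [MeasurableSpace E] (R : SubcriticalAR.EnvSpace E d) (Ψ : ℕ → Ω → E)
            (U : ℕ → ℕ → ℕ → Fin d → Ω → unitInterval),
            SubcriticalAR.IsBranchingData P Ψ Y U →
            (∀ n, ∀ᵐ ω ∂P, A (n + 1) ω = R.meanMatrix (Ψ (n + 1) ω)) →
            SubcriticalAR.BD2 P R Ψ →
            List.TFAE [SubcriticalAR.XR P A Y, SubcriticalAR.MR P A Y,
              SubcriticalAR.RR P Y lam y, SubcriticalAR.ZR P R Ψ Y U]) := by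
  obtain ⟨T, γ, κ, K, hT, hmem⟩ := SubcriticalAR.exists_isPrimitiveSet hdata hBD1 hPR
  have h := hdata.primitiveIID hT hmem
  -- The centring constant of the concentration inequality is the almost sure limit of `S_n / n`, so
  -- the same `lam` serves both parts of the claim.
  obtain ⟨lam, C₀, c, -, hc, hconc⟩ := h.exists_concentration
  refine ⟨lam, ?_, fun hlam hreg y hy hf => ?_⟩
  · filter_upwards [SubcriticalAR.ae_tendsto_div_of_deviation hc hconc] with ω hω
    refine hω.congr fun n => ?_
    rw [SubcriticalAR.logNorm, SubcriticalAR.prodA_eq_seqProd A Y, SubcriticalAR.decay]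
  have hmr := SubcriticalAR.mr_of_xr hdata h
  have hrr := SubcriticalAR.rr_of_mr hdata h hlam hc hconc hreg hy hf
  have hxr := SubcriticalAR.xr_of_rr hdata h hlam hc hconc hreg hy hf
  refine ⟨?_, fun E _ R Ψ U hB hA hBD2 => ?_⟩
  · tfae_have 1 → 2 := hmr
    tfae_have 2 → 3 := hrr
    tfae_have 3 → 1 := hxr
    tfae_finish
  · tfae_have 1 → 2 := hmr
    tfae_have 2 → 3 := hrr
    tfae_have 3 → 1 := hxr
    tfae_have 1 → 4 := SubcriticalAR.zr_of_xr hdata h hB hA hBD2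
    tfae_have 4 → 3 := SubcriticalAR.rr_of_zr h hlam hc hconc hreg hy hf hB hA hBD2
    tfae_finish
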